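/- **Conventions.** A \emph{pocset} is a poset $(\mathcal P,\le)$ with an order-reversing involution ${}^*$ such that $\mathfrak h$ and $\mathfrak h^*$ are distinct and incomparable for every $\mathfrak h$; it is \emph{locally finite} if only finitely many elements lie between any two given elements. The pair $\hat{\mathfrak h}=\{\mathfrak h,\mathfrak h^*\}$ is the \emph{hyperplane} of $\mathfrak h$. Elements $\mathfrak h,\mathfrak k$ are \emph{facing} if $\mathfrak h>\mathfrak k^*$, \emph{incompatible} if $\mathfrak k\le \mathfrak h^*$ (otherwise \emph{compatible}), and \emph{transverse}, written $\mathfrak h\pitchfork\mathfrak k$, if none of $\mathfrak h\le\mathfrak k$, $\mathfrak h\le\mathfrak k^*$, $\mathfrak h^*\le\mathfrak k$, $\mathfrak h^*\le\mathfrak k^*$ holds. Distinct hyperplanes that are not transverse are \emph{disjoint}. A hyperplane $\hat{\mathfrak l}$ \emph{separates} $\hat{\mathfrak h},\hat{\mathfrak k}$ if $\mathfrak h<\mathfrak l<\mathfrak k$ for some orientations; two distinct hyperplanes are \emph{$A$-inseparable} if no hyperplane in $A$ separates them. For a ${}^*$-invariant equivalence relation $\sim$ on $\mathcal P$, the quotient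 $\mathcal P/{\sim}$ carries $[\mathfrak h]^*=[\mathfrak h^*]$ and the relation: $[\mathfrak h]<[\mathfrak k]$ if any representatives $\mathfrak h,\mathfrak k$ have disjoint hyperplanes and, whenever these are $([\hat{\mathfrak h}]\cup[\hat{\mathfrak k}])$-inseparable, $\mathfrak h<\mathfrak k$. A map $f:\mathcal P\to\mathcal P'$ is \emph{admissible} if (1) $f(\mathfrak h^*)=f(\mathfrak h)^*$; (2) $\mathfrak h\pitchfork\mathfrak k$ implies $f(\mathfrak h)\pitchfork f(\mathfrak k)$; (3) if $\mathfrak h,\mathfrak k$ are facing, $f(\hat{\mathfrak h})=f(\hat{\mathfrak k})$ and $\hat{\mathfrak h},\hat{\mathfrak k}$ are $f^{-1}(f(\hat{\mathfrak h}))$-inseparable, then $f(\mathfrak h)=f(\mathfrak k)$; (4) every hyperplane of $\mathcal P'$ that is not in the image of $f$ has an orientation compatible with all elements of $f(\mathcal P)$. It is an \emph{embedding} if it is admissible, injective, and $f(\mathfrak h)\le f(\mathfrak k)$ implies $\mathfrak h\le\mathfrak k$. It is a \emph{resolution} if it is admissible and the induced map $\mathcal P/{\sim_f}\to\mathcal P'$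 is an embedding, where $\mathfrak h\sim_f\mathfrak k$ means $f(\mathfrak h)=f(\mathfrak k)$. For a CAT(0) cube complex $X$ (a simply connected cube complex all of whose vertex links are flag), $\mathcal H(X)$ denotes the pocset of its halfspaces, ordered by inclusion, with complementation. For a pocset $\mathcal P$, the dual cube complex $X(\mathcal P)$ has as vertices the ultrafilters on $\mathcal P$ (upward closed subsets containing exactly one of $\mathfrak h,\mathfrak h^*$ for every $\mathfrak h$) without infinite strictly descending chains, and an $n$-cube for every $2^n$ such ultrafilters that differ only on a set of $n$ hyperplanes. A group acts \emph{without inversions} if no element maps some $\mathfrak h$ to $\mathfrak h^*$; it acts \emph{coboundedly} on a cube complex if, for the combinatorial metric, the translates of some ball cover the complex. **Lemma.** Let a group $G$ act coboundedly and without inversions on a CAT(0) cube complex $X$, and without inversions on a locally finite pocset $\mathcal H'$. Let $f:\mathcal H(X)\to\mathcal H'$ be a $G$-equivariant resolution, and let $\mathfrak h_1,\mathfrak h_2\in\mathcal H(X)$ be an elementary foldable pair, i.e. $\mathfrak h_1,\mathfrak h_2$ are facing, $f(\mathfrak h_1)=f(\mathfrak h_2)$, and there is no facing pair $(\mathfrak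 k_1,\mathfrak k_2)\neq(\mathfrak h_1,\mathfrak h_2)$ with $f(\mathfrak k_1)=f(\mathfrak k_2)$ and $\mathfrak k_i\le\mathfrak h_i$ for $i=1,2$. Let $\sim$ be the smallest $G$-invariant and ${}^*$-invariant equivalence relation on $\mathcal H(X)$ with $\mathfrak h_1\sim\mathfrak h_2$, and let $X'=X(\mathcal H(X)/{\sim})$ be the cube complex obtained by this elementary fold. If $X'$ is finite dimensional, then the action of $G$ on $X'$ is cobounded. -/

import Mathlib

/-! ## Cube complexes -/

/-- An (abstract) cube complex with vertex set `V`. A cube is recorded by its set of vertices: every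
cube is a copy of some `{0,1}ⁿ` in such a way that the cubes contained in it are exactly its faces,
every vertex is a cube, and two cubes that meet intersect in a cube (hence in a common face). -/
structure CubeComplex (V : Type*) where
  IsCube : Set V → Prop
  isCube_singleton : ∀ v, IsCube {v}
  exists_chart : ∀ C, IsCube C → ∃ (n : ℕ) (e : (Fin n → Bool) → V),
    Function.Injective e ∧ Set.range e = C ∧
      ∀ S, S ⊆ C → (IsCube S ↔
        ∃ (a : Fin n → Bool) (s : Set (Fin n)), S = e '' {x | ∀ i ∈ s, x i = a i})
  isCube_inter : ∀ C D, IsCube C → IsCube D → (C ∩ D).Nonempty → IsCube (C ∩ D)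

namespace CubeComplex

variable {V : Type*} (X : CubeComplex V)

/-- The 1-skeleton. -/
def graph : SimpleGraph V where
  Adj u v := u ≠ v ∧ X.IsCube {u, v}
  symm := ⟨fun u v h => ⟨h.1.symm, by rw [Set.pair_comm]; exact h.2⟩⟩
  loopless := ⟨fun _ h => h.1 rfl⟩

/-- `a, b, c, d` are the vertices of a square (2-cube), in cyclic order. -/
def IsSquare (a b c d : V) : Prop :=
  X.IsCube {a, b, c, d} ∧ a ≠ c ∧ b ≠ d ∧
    X.graph.Adj a b ∧ X.graph.Adj b c ∧ X.graph.Adj c d ∧ X.graph.Adj d a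

/-- Homotopy of edge paths with fixed end points: the equivalence relation generated by removing
backtracks and by pushing a path across a square. -/
inductive Homotopic : ∀ {u v : V}, X.graph.Walk u v → X.graph.Walk u v → Prop
  | refl {u v : V} (p : X.graph.Walk u v) : Homotopic p p
  | symm {u v : V} {p q : X.graph.Walk u v} : Homotopic p q → Homotopic q p
  | trans {u v : V} {p q r : X.graph.Walk u v} : Homotopic p q → Homotopic q r → Homotopic p r
  | cons {u v w : V} (h : X.graph.Adj u v) {p q : X.graph.Walk v w} :
      Homotopic p q → Homotopic (SimpleGraph.Walk.cons h p) (SimpleGraph.Walk.cons h q)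
  | backtrack {u v w : V} (h : X.graph.Adj u v) (h' : X.graph.Adj v u) (p : X.graph.Walk u w) :
      Homotopic (SimpleGraph.Walk.cons h (SimpleGraph.Walk.cons h' p)) p
  | square {a b c d w : V} (hab : X.graph.Adj a b) (hbc : X.graph.Adj b c)
      (had : X.graph.Adj a d) (hdc : X.graph.Adj d c) (hsq : X.IsSquare a b c d)
      (p : X.graph.Walk c w) :
      Homotopic (SimpleGraph.Walk.cons hab (SimpleGraph.Walk.cons hbc p))
        (SimpleGraph.Walk.cons had (SimpleGraph.Walk.cons hdc p))

/-- The complex is non-empty, connected, and every closed edge path is null-homotopic. -/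
def IsSimplyConnected : Prop :=
  X.graph.Connected ∧ ∀ (u : V) (p : X.graph.Walk u u), X.Homotopic p SimpleGraph.Walk.nil

/-- Every vertex link is a flag complex. The vertices of the link of `v` are the edges at `v`
(equivalently, the neighbours of `v`), and finitely many of them span a simplex of the link when
they lie in a common cube at `v`. -/
def IsNonpositivelyCurved : Prop :=
  ∀ (v : V) (N : Finset V), (∀ u ∈ N, X.graph.Adj v u) →
    (∀ u ∈ N, ∀ w ∈ N, u ≠ w → ∃ C, X.IsCube C ∧ v ∈ C ∧ u ∈ C ∧ w ∈ C) →
      ∃ C, X.IsCube C ∧ v ∈ C ∧ (N : Set V) ⊆ C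

/-- CAT(0) cube complexes. -/
def IsCAT0 : Prop := X.IsNonpositivelyCurved ∧ X.IsSimplyConnected

/-- The dimensions of the cubes are bounded. -/
def IsFiniteDimensional : Prop := ∃ d : ℕ, ∀ C, X.IsCube C → C.ncard ≤ 2 ^ d

/-- The group `G` acts on the complex by automorphisms. -/
class IsAction (G : Type*) [Group G] [MulAction G V] : Prop where
  isCube_image : ∀ (g : G) (C : Set V), X.IsCube C → X.IsCube ((fun v => g • v) '' C)

/-- The action is cobounded for the combinatorial metric: the translates of some ball cover. -/
def IsCobounded (G : Type*) [Group G] [MulAction G V] : Prop :=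
  ∃ (x₀ : V) (R : ℕ), ∀ x : V, ∃ g : G, X.graph.edist x (g • x₀) ≤ R

/-- `X.Dual a b u v`: the edge `uv` crosses the hyperplane of the edge `ab`, that is, it is obtained
from `ab` by passing repeatedly to the opposite edge in a square. -/
inductive Dual (a b : V) : V → V → Prop
  | base : Dual a b a b
  | flip {u v : V} : Dual a b u v → Dual a b v u
  | opposite {u v w z : V} : Dual a b u v → X.IsSquare u v w z → Dual a b z w

/-- `u` and `v` lie in the same component of the complement of the hyperplane of the edge `ab`. -/
def SameSide (a b : V) : V → V → Prop :=
  Relation.ReflTransGen (fun u v => X.graph.Adj u v ∧ ¬ X.Dual a b u v)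

/-- `S` is (the vertex set of) a halfspace: for some edge `ab`, `S` and its complement are the two
components of the complement of the hyperplane of `ab`, namely those of `a` and of `b`. -/
def IsHalfspace (S : Set V) : Prop :=
  ∃ a b, X.graph.Adj a b ∧ S = {v | X.SameSide a b a v} ∧ Sᶜ = {v | X.SameSide a b b v}

/-- The set of halfspaces. -/
def Halfspace : Type _ := {S : Set V // X.IsHalfspace S}

end CubeComplex

/-! ## Pocsets -/

/-- A relation `≤` together with an involution. The laws of a pocset are stated in `IsPocset`;
keeping them apart lets us write down the quotient structure before knowing that it is a pocset. -/
class PrePocset (P : Type*) extends LE P, Compl P where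
  compl_invol : ∀ a : P, aᶜᶜ = a

/-- Pocsets: posets with an order reversing involution such that `a` and `aᶜ` are distinct and
incomparable. -/
structure IsPocset (P : Type*) [PrePocset P] : Prop where
  le_refl : ∀ a : P, a ≤ a
  le_trans : ∀ a b c : P, a ≤ b → b ≤ c → a ≤ c
  le_antisymm : ∀ a b : P, a ≤ b → b ≤ a → a = b
  compl_le_compl : ∀ a b : P, a ≤ b → bᶜ ≤ aᶜ
  not_le_compl : ∀ a : P, ¬ a ≤ aᶜ
  not_compl_le : ∀ a : P, ¬ aᶜ ≤ a

namespace Pocset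

variable {P : Type*} [PrePocset P]

/-- Only finitely many elements lie between two given ones. -/
def IsLocallyFinite (P : Type*) [PrePocset P] : Prop :=
  ∀ a b : P, {c : P | a ≤ c ∧ c ≤ b}.Finite

/-- The strict order. -/
def Lt (a b : P) : Prop := a ≤ b ∧ a ≠ b

/-- `a` and `b` bound the same hyperplane. -/
def SameHyp (a b : P) : Prop := a = b ∨ a = bᶜ

/-- `a` and `b` face each other. -/
def Facing (a b : P) : Prop := Lt bᶜ a

/-- `a` and `b` are transverse: no orientations of the two hyperplanes are nested. -/
def Transverse (a b : P) : Prop := ¬ a ≤ b ∧ ¬ a ≤ bᶜ ∧ ¬ aᶜ ≤ b ∧ ¬ aᶜ ≤ bᶜ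

/-- The hyperplanes of `a` and `b` are distinct and not transverse. -/
def DisjointHyp (a b : P) : Prop := ¬ SameHyp a b ∧ ¬ Transverse a b

/-- `a` and `b` are compatible, i.e. not incompatible. -/
def Compatible (a b : P) : Prop := ¬ b ≤ aᶜ

/-- The hyperplane of `c` separates those of `a` and `b`. -/
def Separates (c a b : P) : Prop :=
  ∃ a' c' b', SameHyp a' a ∧ SameHyp c' c ∧ SameHyp b' b ∧ Lt a' c' ∧ Lt c' b'

/-- The hyperplanes of `a` and `b` are distinct and not separated by the hyperplane of an element
of `A`. -/
def Inseparable (A : Set P) (a b : P) : Prop := ¬ SameHyp a b ∧ ∀ c ∈ A, ¬ Separates c a b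

/-! ### Quotients -/

/-- An equivalence relation that is invariant under the involution. -/
structure Congr (P : Type*) [PrePocset P] extends Setoid P where
  compl_rel : ∀ {a b : P}, r a b → r aᶜ bᶜ

/-- The quotient set. -/
def Congr.Quot (r : Congr P) : Type _ := Quotient r.toSetoid

/-- The quotient map. -/
def Congr.proj (r : Congr P) (a : P) : r.Quot := Quotient.mk r.toSetoid a

/-- The strict order of the quotient: any representatives have disjoint hyperplanes, and if
moreover no hyperplane of the two classes separates them, then they are strictly nested. -/
def Congr.QLt (r : Congr P) (x y : r.Quot) : Prop :=
  ∀ a b, r.proj a = x → r.proj b = y →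
    DisjointHyp a b ∧ (Inseparable {c | r.proj c = x ∨ r.proj c = y} a b → Lt a b)

instance (r : Congr P) : PrePocset r.Quot where
  le x y := x = y ∨ r.QLt x y
  compl := Quotient.map (fun a => aᶜ) (fun _ _ h => r.compl_rel h)
  compl_invol x := by
    induction x using Quotient.inductionOn with
    | h a => exact congrArg (Quotient.mk r.toSetoid) (PrePocset.compl_invol a)

/-! ### Maps -/

variable {Q : Type*} [PrePocset Q]

/-- Admissible maps of pocsets. -/
structure IsAdmissible (f : P → Q) : Prop where
  map_compl : ∀ a, f aᶜ = (f a)ᶜ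
  map_transverse : ∀ a b, Transverse a b → Transverse (f a) (f b)
  map_facing : ∀ a b, Facing a b → SameHyp (f a) (f b) →
    Inseparable {c | SameHyp (f c) (f a)} a b → f a = f b
  compatible_image : ∀ y : Q, (∀ a, ¬ SameHyp y (f a)) →
    ∃ y', SameHyp y' y ∧ ∀ a, Compatible y' (f a)

/-- Embeddings of pocsets. -/
structure IsEmbedding (f : P → Q) : Prop where
  admissible : IsAdmissible f
  injective : Function.Injective f
  le_of_map_le : ∀ a b, f a ≤ f b → a ≤ b

/-- The relation `a ∼ b ↔ f a = f b`. -/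
def kerCongr (f : P → Q) (hf : IsAdmissible f) : Congr P where
  toSetoid := Setoid.ker f
  compl_rel {a b} h := by
    change f aᶜ = f bᶜ
    rw [hf.map_compl, hf.map_compl, show f a = f b from h]

/-- The map induced by `f` on the quotient by `a ∼ b ↔ f a = f b`. -/
def kerLift (f : P → Q) (hf : IsAdmissible f) : (kerCongr f hf).Quot → Q :=
  Quotient.lift f (fun _ _ h => h)

/-- Resolutions of pocsets: admissible maps that induce an embedding on the quotient. -/
def IsResolution (f : P → Q) : Prop := ∃ hf : IsAdmissible f, IsEmbedding (kerLift f hf)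

/-! ### Group actions -/

/-- The group `G` acts on the pocset by automorphisms. -/
class IsAction (G P : Type*) [Group G] [PrePocset P] [MulAction G P] : Prop where
  smul_le_smul : ∀ (g : G) (a b : P), a ≤ b → g • a ≤ g • b
  smul_compl : ∀ (g : G) (a : P), g • aᶜ = (g • a)ᶜ

/-- No group element maps an element to its complement. -/
def WithoutInversions (G P : Type*) [Group G] [PrePocset P] [MulAction G P] : Prop :=
  ∀ (g : G) (a : P), g • a ≠ aᶜ

/-! ### Elementary folds -/

/-- The facing pair `a`, `b` is elementary foldable for `f`: it is identified by `f`, and there is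
no other facing pair below it that is identified by `f`. -/
def IsElementaryFoldable (f : P → Q) (a b : P) : Prop :=
  Facing a b ∧ f a = f b ∧
    ∀ c d, Facing c d → f c = f d → c ≤ a → d ≤ b → c = a ∧ d = b

section Fold

variable (G : Type*) [Group G] [MulAction G P]

/-- The smallest equivalence relation that is invariant under `G` and under the involution and
identifies `a` and `b`. -/
inductive FoldRel (a b : P) : P → P → Prop
  | base : FoldRel a b a b
  | refl (c : P) : FoldRel a b c c
  | symm {c d : P} : FoldRel a b c d → FoldRel a b d c
  | trans {c d e : P} : FoldRel a b c d → FoldRel a b d e → FoldRel a b c e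
  | compl {c d : P} : FoldRel a b c d → FoldRel a b cᶜ dᶜ
  | smul (g : G) {c d : P} : FoldRel a b c d → FoldRel a b (g • c) (g • d)

/-- `FoldRel` as an involution invariant equivalence relation. -/
def foldCongr (a b : P) : Congr P where
  r := FoldRel G a b
  iseqv := ⟨FoldRel.refl, FoldRel.symm, FoldRel.trans⟩
  compl_rel := FoldRel.compl

/-- The quotient of `P` by the equivalence relation that folds `a` onto `b` equivariantly. -/
abbrev Fold (a b : P) : Type _ := (foldCongr G a b).Quot

instance (a b : P) : MulAction G (Fold G a b) where
  smul g := Quotient.map (fun c => g • c) (fun _ _ h => FoldRel.smul g h)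
  one_smul x := by
    induction x using Quotient.inductionOn with
    | h c => exact congrArg (Quotient.mk _) (one_smul G c)
  mul_smul g g' x := by
    induction x using Quotient.inductionOn with
    | h c => exact congrArg (Quotient.mk _) (mul_smul g g' c)

theorem foldCongr_proj_smul (a b : P) (g : G) (c : P) :
    (foldCongr G a b).proj (g • c) = g • (foldCongr G a b).proj c := rfl

end Fold

section Invariance

variable {G : Type*} [Group G] [MulAction G P] [IsAction G P] (g : G)

theorem smul_le_iff {a b : P} : g • a ≤ g • b ↔ a ≤ b :=
  ⟨fun h => by simpa using IsAction.smul_le_smul g⁻¹ _ _ h, IsAction.smul_le_smul g a b⟩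

theorem smul_lt_iff {a b : P} : Lt (g • a) (g • b) ↔ Lt a b := by
  simp [Lt, smul_le_iff]

theorem smul_sameHyp_iff {a b : P} : SameHyp (g • a) (g • b) ↔ SameHyp a b := by
  simp [SameHyp, ← IsAction.smul_compl]

theorem smul_transverse_iff {a b : P} : Transverse (g • a) (g • b) ↔ Transverse a b := by
  simp [Transverse, ← IsAction.smul_compl, smul_le_iff]

theorem smul_disjointHyp_iff {a b : P} : DisjointHyp (g • a) (g • b) ↔ DisjointHyp a b := by
  simp [DisjointHyp, smul_sameHyp_iff, smul_transverse_iff]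

theorem Separates.smul {c a b : P} (h : Separates c a b) :
    Separates (g • c) (g • a) (g • b) := by
  obtain ⟨a', c', b', ha, hc, hb, h1, h2⟩ := h
  exact ⟨g • a', g • c', g • b', (smul_sameHyp_iff g).2 ha, (smul_sameHyp_iff g).2 hc,
    (smul_sameHyp_iff g).2 hb, (smul_lt_iff g).2 h1, (smul_lt_iff g).2 h2⟩

theorem fold_qLt_smul (a b : P) {x y : Fold G a b} (h : (foldCongr G a b).QLt x y) :
    (foldCongr G a b).QLt (g • x) (g • y) := by
  intro c d hc hd
  obtain ⟨h1, h2⟩ := h (g⁻¹ • c) (g⁻¹ • d)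
    (by rw [foldCongr_proj_smul, hc, inv_smul_smul]) (by rw [foldCongr_proj_smul, hd, inv_smul_smul])
  refine ⟨(smul_disjointHyp_iff g⁻¹).1 h1, fun hi => (smul_lt_iff g⁻¹).1 (h2 ⟨fun hs => hi.1
    ((smul_sameHyp_iff g⁻¹).1 hs), fun e he hs => hi.2 (g • e) ?_ ?_⟩)⟩
  · rcases he with he | he
    · exact Or.inl (by rw [foldCongr_proj_smul, he])
    · exact Or.inr (by rw [foldCongr_proj_smul, he])
  · simpa using hs.smul g

instance (a b : P) : IsAction G (Fold G a b) where
  smul_le_smul g x y h := by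
    rcases h with h | h
    · exact Or.inl (congrArg (fun z => g • z) h)
    · exact Or.inr (fold_qLt_smul g a b h)
  smul_compl g x := by
    induction x using Quotient.inductionOn with
    | h c => exact congrArg (Quotient.mk _) (IsAction.smul_compl g c)

end Invariance

/-! ### The dual cube complex -/

/-- The ultrafilters on `P` that satisfy the descending chain condition. -/
structure DualVertex (P : Type*) [PrePocset P] where
  carrier : Set P
  compl_mem_iff : ∀ a, aᶜ ∈ carrier ↔ a ∉ carrier
  mem_of_le : ∀ a b, a ∈ carrier → a ≤ b → b ∈ carrier
  dcc : ¬ ∃ s : ℕ → P, (∀ n, s n ∈ carrier) ∧ ∀ n, Lt (s (n + 1)) (s n)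

theorem DualVertex.ext' {U W : DualVertex P} (h : ∀ a, a ∈ U.carrier ↔ a ∈ W.carrier) :
    U = W := by
  cases U; cases W; congr; exact Set.ext h

theorem SameHyp.symm {a b : P} (h : SameHyp a b) : SameHyp b a := by
  rcases h with h | h
  · exact Or.inl h.symm
  · exact Or.inr (by rw [h, PrePocset.compl_invol])

theorem SameHyp.trans {a b c : P} (h : SameHyp a b) (h' : SameHyp b c) : SameHyp a c := by
  rcases h with h | h <;> rcases h' with h' | h' <;> subst h <;> subst h'
  · exact Or.inl rfl
  · exact Or.inr rfl
  · exact Or.inr rfl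
  · exact Or.inl (PrePocset.compl_invol _)

/-- `W` and `U` agree on every hyperplane that is not bounded by an element of `A`. -/
def AgreeOff (A : Finset P) (U W : DualVertex P) : Prop :=
  ∀ c, (∀ a ∈ A, ¬ SameHyp c a) → (c ∈ W.carrier ↔ c ∈ U.carrier)

/-- The cubes of the dual complex: `A` contains one halfspace for each of the `n` hyperplanes of the
cube, and the `2ⁿ` vertices of the cube are all the ways to change `U` on these hyperplanes. -/
def IsDualCube (C : Set (DualVertex P)) : Prop :=
  ∃ (U : DualVertex P) (A : Finset P),
    (∀ a ∈ A, ∀ b ∈ A, SameHyp a b → a = b) ∧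
    (∀ B : Set P, ∃ W, AgreeOff A U W ∧ ∀ a ∈ A, (a ∈ W.carrier ↔ a ∈ B)) ∧
    C = {W | AgreeOff A U W}

theorem SameHyp.mem_iff {a b : P} (h : SameHyp a b) {U W : DualVertex P}
    (hb : b ∈ W.carrier ↔ b ∈ U.carrier) : a ∈ W.carrier ↔ a ∈ U.carrier := by
  rcases h with h | h <;> subst h
  · exact hb
  · rw [W.compl_mem_iff, U.compl_mem_iff, hb]

theorem isDualCube_singleton (U : DualVertex P) : IsDualCube ({U} : Set (DualVertex P)) := by
  refine ⟨U, ∅, by simp, fun B => ⟨U, fun c _ => Iff.rfl, by simp⟩, ?_⟩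
  ext W
  refine ⟨fun h => h ▸ fun c _ => Iff.rfl, fun h => DualVertex.ext' fun a => h a (by simp)⟩

theorem isDualCube_inter (C D : Set (DualVertex P)) (hC : IsDualCube C) (hD : IsDualCube D)
    (hCD : (C ∩ D).Nonempty) : IsDualCube (C ∩ D) := by
  classical
  obtain ⟨U, A, hA, hfull, rfl⟩ := hC
  obtain ⟨U', A', -, -, rfl⟩ := hD
  obtain ⟨W₀, h0, h0'⟩ := hCD
  refine ⟨W₀, A.filter (fun a => ∃ a' ∈ A', SameHyp a a'), ?_, ?_, ?_⟩
  · intro a ha b hb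
    exact hA a (Finset.mem_filter.1 ha).1 b (Finset.mem_filter.1 hb).1
  · intro B
    obtain ⟨W, hW, hW'⟩ := hfull {a | (∃ a' ∈ A', SameHyp a a') ∧ a ∈ B ∨
      ¬ (∃ a' ∈ A', SameHyp a a') ∧ a ∈ W₀.carrier}
    refine ⟨W, ?_, ?_⟩
    · intro c hc
      by_cases h : ∃ a ∈ A, SameHyp c a
      · obtain ⟨a, ha, hca⟩ := h
        refine hca.mem_iff ?_
        have : ¬ ∃ a' ∈ A', SameHyp a a' := fun h' => hc a (Finset.mem_filter.2 ⟨ha, h'⟩) hca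
        rw [hW' a ha]
        exact ⟨fun h => h.elim (fun h => absurd h.1 this) And.right, fun h => Or.inr ⟨this, h⟩⟩
      · push Not at h
        rw [hW c h, h0 c h]
    · intro a ha
      obtain ⟨h1, h2⟩ := Finset.mem_filter.1 ha
      rw [hW' a h1]
      exact ⟨fun h => h.elim And.right (fun h => absurd h2 h.1), fun h => Or.inl ⟨h2, h⟩⟩
  · ext W
    constructor
    · rintro ⟨h1, h2⟩ c hc
      by_cases h : ∃ a ∈ A, SameHyp c a
      · obtain ⟨a, ha, hca⟩ := h
        have : ∀ a' ∈ A', ¬ SameHyp c a' := fun a' ha' hs =>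
          hc a (Finset.mem_filter.2 ⟨ha, a', ha', hca.symm.trans hs⟩) hca
        rw [h2 c this, h0' c this]
      · push Not at h
        rw [h1 c h, h0 c h]
    · intro h
      refine ⟨fun c hc => ?_, fun c hc => ?_⟩
      · rw [h c (fun a ha => hc a (Finset.mem_filter.1 ha).1), h0 c hc]
      · rw [h c ?_, h0' c hc]
        intro a ha hs
        obtain ⟨-, a', ha', h'⟩ := Finset.mem_filter.1 ha
        exact hc a' ha' (hs.trans h')

theorem isDualCube_chart (C : Set (DualVertex P)) (hC : IsDualCube C) :
    ∃ (n : ℕ) (e : (Fin n → Bool) → DualVertex P),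
      Function.Injective e ∧ Set.range e = C ∧
        ∀ S, S ⊆ C → (IsDualCube S ↔
          ∃ (a : Fin n → Bool) (s : Set (Fin n)), S = e '' {x | ∀ i ∈ s, x i = a i}) := by
  classical
  obtain ⟨U, A, hA, hfull, rfl⟩ := hC
  obtain ⟨n, a, hainj, haA⟩ : ∃ (n : ℕ) (a : Fin n → P), Function.Injective a ∧
      ∀ c, c ∈ A ↔ ∃ i, a i = c :=
    ⟨A.card, fun i => A.equivFin.symm i, fun i j h => A.equivFin.symm.injective (Subtype.ext h),
      fun c => ⟨fun h => ⟨A.equivFin ⟨c, h⟩, by simp⟩, by rintro ⟨i, rfl⟩; exact (A.equivFin.symm i).2⟩⟩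
  have hmem : ∀ i, a i ∈ A := fun i => (haA _).2 ⟨i, rfl⟩
  choose F hF hF' using hfull
  let e : (Fin n → Bool) → DualVertex P := fun x => F {c | ∃ i, a i = c ∧ x i = true}
  have he : ∀ x, AgreeOff A U (e x) := fun x => hF _
  have he' : ∀ x i, a i ∈ (e x).carrier ↔ x i = true := by
    intro x i
    rw [hF' _ _ (hmem i)]
    constructor
    · rintro ⟨j, hj, h⟩
      rwa [hainj hj] at h
    · exact fun h => ⟨i, rfl, h⟩
  have hinj : Function.Injective e := by
    intro x y h
    funext i
    have := he' x i
    rw [h, he' y i] at this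
    exact Bool.eq_iff_iff.2 this.symm
  have hsurj : ∀ W, AgreeOff A U W → e (fun i => decide (a i ∈ W.carrier)) = W := by
    intro W hW
    refine DualVertex.ext' fun c => ?_
    by_cases h : ∃ b ∈ A, SameHyp c b
    · obtain ⟨b, hb, hcb⟩ := h
      obtain ⟨i, rfl⟩ := (haA b).1 hb
      refine hcb.mem_iff ?_
      rw [he']
      simp
    · push Not at h
      rw [he _ c h, hW c h]
  refine ⟨n, e, hinj, ?_, ?_⟩
  · ext W
    exact ⟨by rintro ⟨x, rfl⟩; exact he x, fun h => ⟨_, hsurj W h⟩⟩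
  intro S hS
  constructor
  · rintro ⟨U', A', -, -, rfl⟩
    have hU' : AgreeOff A U U' := hS (show AgreeOff A' U' U' from fun c _ => Iff.rfl)
    refine ⟨fun i => decide (a i ∈ U'.carrier), {i | ¬ ∃ b ∈ A', SameHyp (a i) b}, ?_⟩
    ext W
    constructor
    · intro hW
      refine ⟨_, ?_, hsurj W (hS hW)⟩
      intro i hi
      have := hW (a i) (fun b hb h => hi ⟨b, hb, h⟩)
      simp [this]
    · rintro ⟨x, hx, rfl⟩ c hc
      by_cases h : ∃ b ∈ A, SameHyp c b
      · obtain ⟨b, hb, hcb⟩ := h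
        obtain ⟨i, rfl⟩ := (haA b).1 hb
        refine hcb.mem_iff ?_
        have := hx i (fun ⟨b, hb, h⟩ => hc b hb (hcb.trans h))
        rw [he', this]
        simp
      · push Not at h
        rw [he x c h, hU' c h]
  · rintro ⟨a₀, s, rfl⟩
    have key : ∀ c, (∀ b ∈ A.filter (fun b => ∃ i, i ∉ s ∧ a i = b), ¬ SameHyp c b) →
        ∀ i, SameHyp c (a i) → i ∈ s := by
      intro c hc i hi
      by_contra h
      exact hc (a i) (Finset.mem_filter.2 ⟨hmem i, i, h, rfl⟩) hi
    have agree : ∀ x, (∀ i ∈ s, x i = a₀ i) →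
        AgreeOff (A.filter (fun b => ∃ i, i ∉ s ∧ a i = b)) (e a₀) (e x) := by
      intro x hx c hc
      by_cases h : ∃ b ∈ A, SameHyp c b
      · obtain ⟨b, hb, hcb⟩ := h
        obtain ⟨i, rfl⟩ := (haA b).1 hb
        refine hcb.mem_iff ?_
        rw [he', he', hx i (key c hc i hcb)]
      · push Not at h
        rw [he x c h, he a₀ c h]
    refine ⟨e a₀, A.filter (fun b => ∃ i, i ∉ s ∧ a i = b), ?_, ?_, ?_⟩
    · intro b hb c hc
      exact hA b (Finset.mem_filter.1 hb).1 c (Finset.mem_filter.1 hc).1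
    · intro B
      refine ⟨e (fun i => if i ∈ s then a₀ i else decide (a i ∈ B)), agree _ ?_, ?_⟩
      · intro i hi
        simp [hi]
      · intro b hb
        obtain ⟨-, i, hi, rfl⟩ := Finset.mem_filter.1 hb
        rw [he']
        simp [hi]
    · ext W
      constructor
      · rintro ⟨x, hx, rfl⟩
        exact agree x hx
      · intro hW
        have hWA : AgreeOff A U W := by
          intro c hc
          rw [hW c (fun b hb => hc b (Finset.mem_filter.1 hb).1), he a₀ c hc]
        refine ⟨_, ?_, hsurj W hWA⟩
        intro i hi
        have := hW (a i) (by
          intro b hb h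
          obtain ⟨hb, j, hj, rfl⟩ := Finset.mem_filter.1 hb
          exact hj (hainj (hA _ (hmem i) _ (hmem j) h) ▸ hi))
        rw [he'] at this
        simp [this]

/-- The cube complex dual to a pocset: its vertices are the ultrafilters with the descending chain
condition, and `2ⁿ` of them form a cube when they differ on a set of `n` hyperplanes only. -/
def dualComplex (P : Type*) [PrePocset P] : CubeComplex (DualVertex P) where
  IsCube := IsDualCube
  isCube_singleton := isDualCube_singleton
  exists_chart := isDualCube_chart
  isCube_inter := isDualCube_inter

section DualAction

variable {G : Type*} [Group G] [MulAction G P] [IsAction G P]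

/-- The action on the vertices of the dual complex: `g` maps the ultrafilter `U` to `gU`. -/
instance : MulAction G (DualVertex P) where
  smul g U :=
    { carrier := {a | g⁻¹ • a ∈ U.carrier}
      compl_mem_iff := fun a => by
        change g⁻¹ • aᶜ ∈ U.carrier ↔ g⁻¹ • a ∉ U.carrier
        rw [IsAction.smul_compl]
        exact U.compl_mem_iff _
      mem_of_le := fun a b ha hab => U.mem_of_le _ _ ha (IsAction.smul_le_smul _ _ _ hab)
      dcc := fun ⟨s, h1, h2⟩ => U.dcc ⟨fun n => g⁻¹ • s n, h1, fun n => (smul_lt_iff _).2 (h2 n)⟩ }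
  one_smul U := DualVertex.ext' fun a => by
    change (1 : G)⁻¹ • a ∈ U.carrier ↔ _
    simp
  mul_smul g g' U := DualVertex.ext' fun a => by
    change (g * g')⁻¹ • a ∈ U.carrier ↔ g'⁻¹ • g⁻¹ • a ∈ U.carrier
    rw [mul_inv_rev, mul_smul]

theorem mem_smul_dualVertex (g : G) (U : DualVertex P) (a : P) :
    a ∈ (g • U).carrier ↔ g⁻¹ • a ∈ U.carrier := Iff.rfl

theorem AgreeOff.smul [DecidableEq P] (g : G) {A : Finset P} {U W : DualVertex P}
    (h : AgreeOff A U W) : AgreeOff (A.image (fun a => g • a)) (g • U) (g • W) := by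
  intro c hc
  rw [mem_smul_dualVertex, mem_smul_dualVertex]
  refine h _ fun a ha hs => hc (g • a) (Finset.mem_image_of_mem _ ha) ?_
  simpa using (smul_sameHyp_iff g).2 hs

instance : (dualComplex P).IsAction G where
  isCube_image g C hC := by
    classical
    obtain ⟨U, A, hA, hfull, rfl⟩ := hC
    refine ⟨g • U, A.image (fun a => g • a), ?_, ?_, ?_⟩
    · simp only [Finset.mem_image]
      rintro _ ⟨a, ha, rfl⟩ _ ⟨b, hb, rfl⟩ h
      rw [hA a ha b hb ((smul_sameHyp_iff g).1 h)]
    · intro B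
      obtain ⟨W, h1, h2⟩ := hfull {a | g • a ∈ B}
      refine ⟨g • W, h1.smul g, ?_⟩
      simp only [Finset.mem_image]
      rintro _ ⟨a, ha, rfl⟩
      rw [mem_smul_dualVertex, inv_smul_smul, h2 a ha]
      rfl
    · ext W
      constructor
      · rintro ⟨W, hW, rfl⟩
        exact AgreeOff.smul g hW
      · intro hW
        refine ⟨g⁻¹ • W, ?_, smul_inv_smul g W⟩
        have := AgreeOff.smul g⁻¹ hW
        rw [Finset.image_image, inv_smul_smul] at this
        simpa [Function.comp_def] using this

end DualAction

end Pocset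

/-! ## The pocset of halfspaces -/

namespace CubeComplex

variable {V : Type*} (X : CubeComplex V)

theorem isHalfspace_compl {S : Set V} (h : X.IsHalfspace S) : X.IsHalfspace Sᶜ := by
  obtain ⟨a, b, hab, h1, h2⟩ := h
  have hd : ∀ u v, X.Dual b a u v ↔ X.Dual a b u v := by
    intro u v
    constructor
    · intro h
      induction h with
      | base => exact Dual.flip Dual.base
      | flip _ ih => exact Dual.flip ih
      | opposite _ hs ih => exact Dual.opposite ih hs
    · intro h
      induction h with
      | base => exact Dual.flip Dual.base
      | flip _ ih => exact Dual.flip ih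
      | opposite _ hs ih => exact Dual.opposite ih hs
  refine ⟨b, a, hab.symm, ?_, ?_⟩
  · simpa [SameSide, hd] using h2
  · simpa [SameSide, hd] using h1

/-- Halfspaces are ordered by inclusion, and the involution is the complement. -/
instance : PrePocset X.Halfspace where
  le S T := S.1 ⊆ T.1
  compl S := ⟨S.1ᶜ, X.isHalfspace_compl S.2⟩
  compl_invol S := Subtype.ext (compl_compl S.1)

theorem isPocset_halfspace : IsPocset X.Halfspace where
  le_refl S := subset_refl S.1
  le_trans _ _ _ h h' := Set.Subset.trans h h'
  le_antisymm _ _ h h' := Subtype.ext (Set.Subset.antisymm h h')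
  compl_le_compl _ _ h := Set.compl_subset_compl.2 h
  not_le_compl S h := by
    obtain ⟨a, b, -, h1, -⟩ := S.2
    have ha : a ∈ S.1 := h1 ▸ Relation.ReflTransGen.refl
    exact h ha ha
  not_compl_le S h := by
    obtain ⟨a, b, -, -, h2⟩ := S.2
    have hb : b ∈ S.1ᶜ := h2 ▸ Relation.ReflTransGen.refl
    exact hb (h hb)

section Action

variable {G : Type*} [Group G] [MulAction G V] [X.IsAction G] (g : G)

theorem adj_smul {u v : V} (h : X.graph.Adj u v) : X.graph.Adj (g • u) (g • v) := by
  refine ⟨fun h' => h.1 (MulAction.injective g h'), ?_⟩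
  have := IsAction.isCube_image (X := X) g _ h.2
  rwa [Set.image_pair] at this

theorem IsSquare.smul {a b c d : V} (h : X.IsSquare a b c d) :
    X.IsSquare (g • a) (g • b) (g • c) (g • d) := by
  obtain ⟨h1, h2, h3, h4, h5, h6, h7⟩ := h
  refine ⟨?_, fun h => h2 (MulAction.injective g h), fun h => h3 (MulAction.injective g h),
    X.adj_smul g h4, X.adj_smul g h5, X.adj_smul g h6, X.adj_smul g h7⟩
  have := IsAction.isCube_image (X := X) g _ h1
  simpa only [Set.image_insert_eq, Set.image_singleton] using this

theorem Dual.smul {a b u v : V} (h : X.Dual a b u v) :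
    X.Dual (g • a) (g • b) (g • u) (g • v) := by
  induction h with
  | base => exact Dual.base
  | flip _ ih => exact Dual.flip ih
  | opposite _ hs ih => exact Dual.opposite ih (hs.smul X g)

theorem SameSide.smul {a b u v : V} (h : X.SameSide a b u v) :
    X.SameSide (g • a) (g • b) (g • u) (g • v) := by
  induction h with
  | refl => exact Relation.ReflTransGen.refl
  | tail _ h ih =>
    exact ih.tail ⟨X.adj_smul g h.1, fun h' => h.2 (by simpa using h'.smul X g⁻¹)⟩

theorem image_sameSide (a b c : V) : (fun v => g • v) '' {v | X.SameSide a b c v} =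
    {v | X.SameSide (g • a) (g • b) (g • c) v} := by
  ext v
  constructor
  · rintro ⟨v, hv, rfl⟩
    exact SameSide.smul X g hv
  · intro hv
    refine ⟨g⁻¹ • v, ?_, smul_inv_smul g v⟩
    simpa using SameSide.smul X g⁻¹ hv

theorem isHalfspace_image {S : Set V} (h : X.IsHalfspace S) :
    X.IsHalfspace ((fun v => g • v) '' S) := by
  obtain ⟨a, b, hab, h1, h2⟩ := h
  refine ⟨g • a, g • b, X.adj_smul g hab, ?_, ?_⟩
  · rw [← X.image_sameSide, ← h1]
  · rw [← X.image_sameSide, ← h2, Set.image_compl_eq (MulAction.bijective g)]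

/-- The induced action on halfspaces. -/
instance : MulAction G X.Halfspace where
  smul g S := ⟨(fun v => g • v) '' S.1, X.isHalfspace_image g S.2⟩
  one_smul S := Subtype.ext (by
    change (fun v => (1 : G) • v) '' S.1 = S.1
    simp)
  mul_smul g g' S := Subtype.ext (by
    change (fun v => (g * g') • v) '' S.1 = (fun v => g • v) '' ((fun v => g' • v) '' S.1)
    rw [Set.image_image]
    simp only [mul_smul])

instance : Pocset.IsAction G X.Halfspace where
  smul_le_smul _ _ _ h := Set.image_mono h
  smul_compl g _ := Subtype.ext (Set.image_compl_eq (MulAction.bijective g))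

end Action

end CubeComplex

/-!
Let `r` be the congruence of the fold, on the halfspaces of the CAT(0) cube complex `X`. The proof
describes the quotient pocset by subsets of the vertex set of `X` and shows that every vertex of the
dual complex `X'` is at bounded distance from the image of a vertex of `X`. As `G` acts coboundedly
on `X` and the map from `X` to `X'` is equivariant and does not increase distances, this suffices.

*The congruence.* The translates of the folded pair are the edges of a graph on the halfspaces whose
components are, up to complements, the non-trivial classes of `r`; no component contains
complementary halfspaces, as there are no inversions in the target. Because the pair is elementary,
any two members of a component face each other (`eq_or_facing_of_path`, `isFacingCongr_fold`). The
rest of the argument uses only this property, `IsFacingCongr`.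

*Regions.* To a class of pairwise facing halfspaces corresponds the intersection of its members, and
to the class of their complements the disjoint union of its members. An edge of `X` crosses the
boundary of such a region precisely if it crosses a hyperplane of the class, and the order of the
quotient is the inclusion of regions (`le_iff_region_subset`). In particular the quotient is a
pocset, and a vertex of `X` determines a vertex of `X'`, namely the set of the regions that contain
it (`toDual`).

*Closeness.* Let `U` be a vertex of `X'`. The halfspaces that contain some region in `U` intersect
pairwise, so by the Helly property they have a common vertex `v` (`exists_mem_of_region_subset`).
The distance from `U` to `v` is at most the number of regions in `U` that do not contain `v`. Such
regions are unions of disjoint halfspaces. Pairwise incomparable ones are the directions of a cube,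
so there are at most `d = dim X'` of them (`card_le_of_antichain`). Let `N` bound the number of
halfspaces between the complement of one member of a translate of the folded pair and the other
member. If there were a chain of more than `N` such regions, then all members of the smallest one
would lie in one and the same member of the largest one (`exists_region_subset_of_chain`): two
members that are adjacent in the graph and lie in different members of the largest region would have
`N + 1` halfspaces in between. That member would contain `v`, a contradiction. So the distance is at
most `N * d`.

*Geometry of `X`.* The facts needed about halfspaces follow from the quadrangle condition for the
1-skeleton (`quadrangle`). It is derived from an analogue of Levi's lemma for trace monoids, for
edge paths up to square moves (`TraceEq.levi`), which gives normal forms of homotopy classes of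
paths: any two geodesics with the same end points differ by square moves.
-/

/-! ### Squares and 3-cubes -/

namespace CubeComplex

variable {V : Type*} {X : CubeComplex V}

namespace IsSquare

variable {a b c d : V}

theorem rotate (h : X.IsSquare a b c d) : X.IsSquare b c d a := by
  obtain ⟨h1, h2, h3, h4, h5, h6, h7⟩ := h
  refine ⟨?_, h3, h2.symm, h5, h6, h7, h4⟩
  convert h1 using 1
  ext x
  simp only [Set.mem_insert_iff, Set.mem_singleton_iff]
  tauto

theorem reflect (h : X.IsSquare a b c d) : X.IsSquare a d c b := by
  obtain ⟨h1, h2, h3, h4, h5, h6, h7⟩ := h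
  refine ⟨?_, h2, h3.symm, h7.symm, h6.symm, h5.symm, h4.symm⟩
  convert h1 using 1
  ext x
  simp only [Set.mem_insert_iff, Set.mem_singleton_iff]
  tauto

theorem isCube (h : X.IsSquare a b c d) : X.IsCube {a, b, c, d} := h.1

theorem ne_opp (h : X.IsSquare a b c d) : a ≠ c := h.2.1

theorem ne_opp' (h : X.IsSquare a b c d) : b ≠ d := h.2.2.1

theorem adj₁ (h : X.IsSquare a b c d) : X.graph.Adj a b := h.2.2.2.1

theorem adj₂ (h : X.IsSquare a b c d) : X.graph.Adj b c := h.2.2.2.2.1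

theorem adj₃ (h : X.IsSquare a b c d) : X.graph.Adj c d := h.2.2.2.2.2.1

theorem adj₄ (h : X.IsSquare a b c d) : X.graph.Adj d a := h.2.2.2.2.2.2

end IsSquare

theorem IsCube.exists_ncard_eq {C : Set V} (h : X.IsCube C) :
    C.Finite ∧ ∃ n, C.ncard = 2 ^ n := by
  obtain ⟨n, e, he, rfl, -⟩ := X.exists_chart C h
  refine ⟨Set.finite_range e, n, ?_⟩
  rw [← Set.image_univ, Set.ncard_image_of_injective _ he, Set.ncard_univ]
  simp

/-- Two squares with three common vertices coincide: their intersection is a cube, and the number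
of vertices of a cube is a power of two. -/
theorem IsSquare.unique {a b c d d' : V} (h : X.IsSquare a b c d) (h' : X.IsSquare a b c d') :
    d = d' := by
  have hC := X.isCube_inter _ _ h.isCube h'.isCube ⟨a, by simp, by simp⟩
  obtain ⟨-, n, hn⟩ := hC.exists_ncard_eq
  by_contra hne
  have : ({a, b, c, d} ∩ {a, b, c, d'} : Set V) = {a, b, c} := by
    ext x
    simp only [Set.mem_inter_iff, Set.mem_insert_iff, Set.mem_singleton_iff]
    constructor
    · rintro ⟨h1, h2⟩
      rcases h1 with h1 | h1 | h1 | h1 <;> try tauto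
      rcases h2 with h2 | h2 | h2 | h2 <;> try tauto
      exact absurd (h1.symm.trans h2) hne
    · tauto
  rw [this] at hn
  have h3 : ({a, b, c} : Set V).ncard = 3 := by
    rw [Set.ncard_eq_three]
    exact ⟨a, b, c, h.adj₁.ne, h.ne_opp, h.adj₂.ne, rfl⟩
  rw [h3] at hn
  rcases n with _ | n
  · simp at hn
  · rw [pow_succ] at hn
    omega

theorem IsSquare.unique_opp {a b c c' d : V} (h : X.IsSquare a b c d) (h' : X.IsSquare a b c' d) :
    c = c' :=
  h.rotate.rotate.rotate.unique h'.rotate.rotate.rotate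

/-- In a chart of a cube, the edges at a vertex change one coordinate. -/
theorem exists_eq_update {n : ℕ} {E : (Fin n → Bool) → V} (hE : Function.Injective E)
    (hface : ∀ S, S ⊆ Set.range E → (X.IsCube S ↔
      ∃ (a : Fin n → Bool) (s : Set (Fin n)), S = E '' {x | ∀ i ∈ s, x i = a i}))
    {x : Fin n → Bool} {u : V} (hu : u ∈ Set.range E) (h : X.graph.Adj (E x) u) :
    ∃ i, u = E (Function.update x i (!x i)) := by
  obtain ⟨z, rfl⟩ := hu
  obtain ⟨a, s, hs⟩ := (hface {E x, E z} (by rintro _ (rfl | rfl) <;> simp)).1 h.2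
  have hx : ∀ i ∈ s, x i = a i := by
    have : E x ∈ E '' {x | ∀ i ∈ s, x i = a i} := hs ▸ Or.inl rfl
    obtain ⟨y, hy, hxy⟩ := this
    exact hE hxy ▸ hy
  have hz : ∀ i ∈ s, z i = a i := by
    have : E z ∈ E '' {x | ∀ i ∈ s, x i = a i} := hs ▸ Or.inr rfl
    obtain ⟨y, hy, hxy⟩ := this
    exact hE hxy ▸ hy
  have hne : x ≠ z := fun h' => h.1 (congrArg E h')
  obtain ⟨i, hi⟩ := Function.ne_iff.1 hne
  have his : i ∉ s := fun h' => hi ((hx i h').trans (hz i h').symm)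
  have hmem : E (Function.update x i (!x i)) ∈ ({E x, E z} : Set V) := by
    rw [hs]
    refine ⟨_, fun j hj => ?_, rfl⟩
    rw [Function.update_of_ne (by rintro rfl; exact his hj), hx j hj]
  refine ⟨i, ?_⟩
  rcases hmem with h' | h'
  · have := congrFun (hE h') i
    simp at this
  · exact h'.symm

theorem isSquare_update {n : ℕ} {E : (Fin n → Bool) → V} (hE : Function.Injective E)
    (hface : ∀ S, S ⊆ Set.range E → (X.IsCube S ↔
      ∃ (a : Fin n → Bool) (s : Set (Fin n)), S = E '' {x | ∀ i ∈ s, x i = a i}))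
    (x : Fin n → Bool) {i j : Fin n} (hij : i ≠ j) :
    X.IsSquare (E x) (E (Function.update x i (!x i)))
      (E (Function.update (Function.update x i (!x i)) j (!x j)))
      (E (Function.update x j (!x j))) := by
  have hadj : ∀ (y : Fin n → Bool) k, X.graph.Adj (E y) (E (Function.update y k (!y k))) := by
    intro y k
    refine ⟨fun h => ?_, ?_⟩
    · have := congrFun (hE h) k
      simp at this
    · refine (hface _ (by rintro _ (rfl | rfl) <;> simp)).2 ⟨y, {k}ᶜ, ?_⟩
      ext v
      constructor
      · rintro (rfl | rfl)
        · exact ⟨y, fun _ _ => rfl, rfl⟩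
        · exact ⟨_, fun l hl => Function.update_of_ne hl _ _, rfl⟩
      · rintro ⟨z, hz, rfl⟩
        by_cases hk : z k = y k
        · left
          congr 1
          funext l
          by_cases hl : l = k
          · rw [hl, hk]
          · exact hz l hl
        · right
          change E z = _
          congr 1
          funext l
          by_cases hl : l = k
          · subst hl
            simpa using Bool.eq_not_of_ne hk
          · rw [Function.update_of_ne hl]
            exact hz l hl
  have hcomm : Function.update (Function.update x i (!x i)) j (!x j) =
      Function.update (Function.update x j (!x j)) i (!x i) := Function.update_comm hij _ _ _
  refine ⟨?_, ?_, ?_, hadj _ _, ?_, ?_, (hadj _ _).symm⟩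
  · refine (hface _ (by rintro _ (rfl | rfl | rfl | rfl) <;> simp)).2 ⟨x, {k | k ≠ i ∧ k ≠ j}, ?_⟩
    ext v
    constructor
    · rintro (rfl | rfl | rfl | rfl)
      · exact ⟨x, fun _ _ => rfl, rfl⟩
      · exact ⟨_, fun l hl => Function.update_of_ne hl.1 _ _, rfl⟩
      · exact ⟨_, fun l hl => by
          rw [Function.update_of_ne hl.2, Function.update_of_ne hl.1], rfl⟩
      · exact ⟨_, fun l hl => Function.update_of_ne hl.2 _ _, rfl⟩
    · rintro ⟨z, hz, rfl⟩
      have key : ∀ w : Fin n → Bool, (∀ l, l ≠ i → l ≠ j → w l = x l) → z i = w i → z j = w j →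
          z = w := by
        intro w hw h1 h2
        funext l
        by_cases hi : l = i
        · rw [hi, h1]
        by_cases hj : l = j
        · rw [hj, h2]
        rw [hw l hi hj, hz l ⟨hi, hj⟩]
      by_cases h1 : z i = x i <;> by_cases h2 : z j = x j
      · left
        rw [key x (fun _ _ _ => rfl) h1 h2]
      · right; right; right
        change E z = _
        rw [key (Function.update x j (!x j)) (fun l _ h => Function.update_of_ne h _ _)
          (by rw [Function.update_of_ne hij, h1]) (by simpa using Bool.eq_not_of_ne h2)]
      · right; left
        rw [key (Function.update x i (!x i)) (fun l h _ => Function.update_of_ne h _ _)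
          (by simpa using Bool.eq_not_of_ne h1) (by rw [Function.update_of_ne hij.symm, h2])]
      · right; right; left
        rw [key (Function.update (Function.update x i (!x i)) j (!x j))
          (fun l h h' => by rw [Function.update_of_ne h', Function.update_of_ne h])
          (by rw [Function.update_of_ne hij]; simpa using Bool.eq_not_of_ne h1)
          (by simpa using Bool.eq_not_of_ne h2)]
  · intro h
    have := congrFun (hE h) j
    rw [Function.update_self] at this
    simp at this
  · intro h
    have := congrFun (hE h) i
    rw [Function.update_self, Function.update_of_ne hij] at this
    simp at this
  · have := hadj (Function.update x i (!x i)) j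
    rwa [Function.update_of_ne hij.symm] at this
  · have := hadj (Function.update x j (!x j)) i
    rw [Function.update_of_ne hij] at this
    rw [hcomm]
    exact this.symm

/-- The cube condition: three squares at `e`, any two of which share an edge at `e`, are faces of a
3-cube. The vertex of this cube opposite to `e` is `y`. -/
theorem exists_cube_of_isSquare (hX : X.IsNonpositivelyCurved) {e u c c' b d x : V}
    (h1 : X.IsSquare e u b c) (h2 : X.IsSquare e u d c') (h3 : X.IsSquare e c x c') :
    ∃ y, X.IsSquare u b y d ∧ X.IsSquare c b y x ∧ X.IsSquare c' d y x := by
  classical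
  obtain ⟨C, hC, heC, hN⟩ := hX e {u, c, c'} (by
      simp only [Finset.mem_insert, Finset.mem_singleton]
      rintro _ (rfl | rfl | rfl)
      · exact h1.adj₁
      · exact h1.adj₄.symm
      · exact h2.adj₄.symm) (by
      simp only [Finset.mem_insert, Finset.mem_singleton]
      rintro p (rfl | rfl | rfl) q (rfl | rfl | rfl) hne
      · exact absurd rfl hne
      · exact ⟨_, h1.isCube, by simp, by simp, by simp⟩
      · exact ⟨_, h2.isCube, by simp, by simp, by simp⟩
      · exact ⟨_, h1.isCube, by simp, by simp, by simp⟩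
      · exact absurd rfl hne
      · exact ⟨_, h3.isCube, by simp, by simp, by simp⟩
      · exact ⟨_, h2.isCube, by simp, by simp, by simp⟩
      · exact ⟨_, h3.isCube, by simp, by simp, by simp⟩
      · exact absurd rfl hne)
  obtain ⟨n, E, hE, rfl, hface⟩ := X.exists_chart C hC
  obtain ⟨z, rfl⟩ := heC
  obtain ⟨i, rfl⟩ := exists_eq_update hE hface (hN (by simp : u ∈ _)) h1.adj₁
  obtain ⟨j, rfl⟩ := exists_eq_update hE hface (hN (by simp : c ∈ _)) h1.adj₄.symm
  obtain ⟨k, rfl⟩ := exists_eq_update hE hface (hN (by simp : c' ∈ _)) h2.adj₄.symm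
  have hij : i ≠ j := by rintro rfl; exact h1.ne_opp' rfl
  have hik : i ≠ k := by rintro rfl; exact h2.ne_opp' rfl
  have hjk : j ≠ k := by rintro rfl; exact h3.ne_opp' rfl
  obtain rfl := h1.unique_opp (isSquare_update hE hface z hij)
  obtain rfl := h2.unique_opp (isSquare_update hE hface z hik)
  obtain rfl := h3.unique_opp (isSquare_update hE hface z hjk)
  have s1 := isSquare_update hE hface (Function.update z i (!z i)) hjk
  have s2 := isSquare_update hE hface (Function.update z j (!z j)) hik
  have s3 := isSquare_update hE hface (Function.update z k (!z k)) hij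
  rw [Function.update_of_ne hij.symm, Function.update_of_ne hik.symm] at s1
  rw [Function.update_of_ne hij, Function.update_of_ne hjk.symm,
    Function.update_comm hij.symm] at s2
  rw [Function.update_of_ne hik, Function.update_of_ne hjk, Function.update_comm hik.symm,
    Function.update_comm hjk.symm, Function.update_comm hjk.symm] at s3
  exact ⟨_, s1, s2, s3⟩

end CubeComplex

/-! ### Edge paths up to square moves -/

namespace CubeComplex

variable {V : Type*} {X : CubeComplex V}

/-- An elementary square move on a list of vertices: two consecutive edges of a square are replaced
by the other two. -/
inductive SquareMove (X : CubeComplex V) : List V → List V → Prop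
  | head {a b c d : V} (h : X.IsSquare a b c d) (l : List V) :
      SquareMove X (a :: b :: c :: l) (a :: d :: c :: l)
  | tail (a : V) {l l' : List V} : SquareMove X l l' → SquareMove X (a :: l) (a :: l')

/-- Two lists of vertices are trace equivalent if they are related by square moves. -/
def TraceEq (X : CubeComplex V) : List V → List V → Prop := Relation.ReflTransGen X.SquareMove

theorem SquareMove.symm {l m : List V} (h : X.SquareMove l m) : X.SquareMove m l := by
  induction h with
  | head h l => exact .head h.reflect l
  | tail a _ ih => exact .tail a ih

namespace TraceEq

theorem refl (l : List V) : X.TraceEq l l := Relation.ReflTransGen.refl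

theorem trans {l m n : List V} (h : X.TraceEq l m) (h' : X.TraceEq m n) : X.TraceEq l n :=
  Relation.ReflTransGen.trans h h'

theorem symm {l m : List V} (h : X.TraceEq l m) : X.TraceEq m l := by
  induction h with
  | refl => exact refl _
  | tail _ h ih => exact trans (Relation.ReflTransGen.single h.symm) ih

theorem cons (a : V) {l m : List V} (h : X.TraceEq l m) : X.TraceEq (a :: l) (a :: m) := by
  induction h with
  | refl => exact refl _
  | tail _ h ih => exact trans ih (Relation.ReflTransGen.single (.tail a h))

theorem square {a b c d : V} (h : X.IsSquare a b c d) (l : List V) :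
    X.TraceEq (a :: b :: c :: l) (a :: d :: c :: l) :=
  Relation.ReflTransGen.single (.head h l)

theorem length_eq {l m : List V} (h : X.TraceEq l m) : l.length = m.length := by
  induction h with
  | refl => rfl
  | tail _ h ih =>
    refine ih.trans ?_
    clear * - h
    induction h with
    | head => rfl
    | tail _ _ ih => simp only [List.length_cons, ih]

theorem exists_cons {u : V} {l m : List V} (h : X.TraceEq (u :: l) m) : ∃ l', m = u :: l' := by
  induction h with
  | refl => exact ⟨l, rfl⟩
  | tail _ h ih =>
    obtain ⟨l', rfl⟩ := ih
    cases h with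
    | head h l => exact ⟨_, rfl⟩
    | tail _ h => exact ⟨_, rfl⟩

theorem head_eq {u v : V} {l m : List V} (h : X.TraceEq (u :: l) (v :: m)) : u = v := by
  obtain ⟨l', h'⟩ := h.exists_cons
  simp only [List.cons.injEq] at h'
  exact h'.1.symm

/-- The structure of trace equivalence (the analogue of Levi's lemma for trace monoids): equivalent
lists with the same first vertex either have the same second vertex and equivalent tails, or their
first edges span a square, across which one list can be transformed into the other. -/
theorem levi (hX : X.IsNonpositivelyCurved) {u b d : V} {p q : List V}
    (h : X.TraceEq (u :: b :: p) (u :: d :: q)) :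
    (b = d ∧ X.TraceEq (b :: p) (d :: q)) ∨ ∃ c r, X.IsSquare u b c d ∧
      X.TraceEq (b :: p) (b :: c :: r) ∧ X.TraceEq (d :: q) (d :: c :: r) := by
  obtain ⟨n, hn⟩ : ∃ n, p.length = n := ⟨_, rfl⟩
  induction n using Nat.strong_induction_on generalizing u b d p q with
  | _ n IH =>
    suffices H : ∀ t, X.TraceEq (u :: b :: p) t → ∃ d q, t = u :: d :: q ∧
        ((b = d ∧ X.TraceEq (b :: p) (d :: q)) ∨ ∃ c r, X.IsSquare u b c d ∧
          X.TraceEq (b :: p) (b :: c :: r) ∧ X.TraceEq (d :: q) (d :: c :: r)) by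
      obtain ⟨d', q', heq, H⟩ := H _ h
      simp only [List.cons.injEq, true_and] at heq
      obtain ⟨rfl, rfl⟩ := heq
      exact H
    intro t ht
    induction ht with
    | refl => exact ⟨b, p, rfl, Or.inl ⟨rfl, refl _⟩⟩
    | @tail t t' hbt hstep ih =>
      obtain ⟨e, s, rfl, ih⟩ := ih
      cases hstep with
      | tail _ hstep =>
        obtain ⟨s', rfl⟩ := exists_cons (Relation.ReflTransGen.single hstep)
        refine ⟨e, s', rfl, ?_⟩
        have hs : X.TraceEq (e :: s) (e :: s') := Relation.ReflTransGen.single hstep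
        rcases ih with ⟨rfl, ih⟩ | ⟨c, r, hsq, h1, h2⟩
        · exact Or.inl ⟨rfl, ih.trans hs⟩
        · exact Or.inr ⟨c, r, hsq, h1, hs.symm.trans h2⟩
      | @head _ _ c' d hsq' s' =>
        refine ⟨d, c' :: s', rfl, ?_⟩
        rcases ih with ⟨rfl, ih⟩ | ⟨c, r, hsq, h1, h2⟩
        · exact Or.inr ⟨c', s', hsq', ih, refl _⟩
        -- Two squares share the edge `u e`. The lemma for the shorter lists at `e` shows that they
        -- coincide or that a third square joins them, and then the cube condition applies.
        · have hl := length_eq hbt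
          have hl2 := h2.length_eq
          simp only [List.length_cons] at hl hl2
          rcases IH s'.length (by omega) h2 rfl with ⟨rfl, h3⟩ | ⟨x, r', hx, h3, h4⟩
          · obtain rfl := hsq.reflect.unique hsq'
            exact Or.inl ⟨rfl, h1.trans (h3.symm.cons _)⟩
          · obtain ⟨y, hy, hy1, hy2⟩ := exists_cube_of_isSquare hX hsq.rotate.rotate.rotate
              hsq'.reflect.rotate.rotate.rotate hx.reflect
            exact Or.inr ⟨y, x :: r', hy,
              (h1.trans (h4.cons _)).trans (square hy1.rotate.reflect _),
              (h3.cons _).trans (square hy2.rotate.reflect _)⟩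

/-- Trace equivalence is left cancellative. -/
theorem cancel (hX : X.IsNonpositivelyCurved) {u u' b : V} {p q : List V}
    (h : X.TraceEq (u :: b :: p) (u' :: b :: q)) : X.TraceEq (b :: p) (b :: q) := by
  obtain rfl := h.head_eq
  rcases h.levi hX with ⟨-, h⟩ | ⟨c, r, hsq, -, -⟩
  · exact h
  · exact absurd rfl hsq.ne_opp'

end TraceEq

/-- `l` is equivalent to a list whose second vertex is `w`. -/
def IsPred (X : CubeComplex V) (w : V) (l : List V) : Prop :=
  ∃ u q, X.TraceEq l (u :: w :: q)

open Classical in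
/-- Prepend the vertex `w` to `l`; if this creates a backtrack up to trace equivalence, then cancel
it. -/
noncomputable def step (X : CubeComplex V) (w : V) (l : List V) : List V :=
  if h : X.IsPred w l then w :: h.choose_spec.choose else w :: l

/-- Cancelling a backtrack is well defined up to trace equivalence. -/
theorem step_of_traceEq (hX : X.IsNonpositivelyCurved) {u w : V} {l q : List V}
    (h : X.TraceEq l (u :: w :: q)) : X.TraceEq (X.step w l) (w :: q) := by
  have hp : X.IsPred w l := ⟨u, q, h⟩
  rw [step, dif_pos hp]
  exact (hp.choose_spec.choose_spec.symm.trans h).cancel hX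

theorem step_of_not_isPred {w : V} {l : List V} (h : ¬ X.IsPred w l) : X.step w l = w :: l :=
  dif_neg h

theorem step_eq_cons (w : V) (l : List V) : ∃ l', X.step w l = w :: l' := by
  unfold step
  split_ifs
  · exact ⟨_, rfl⟩
  · exact ⟨_, rfl⟩

theorem step_congr (hX : X.IsNonpositivelyCurved) (w : V) {l m : List V} (h : X.TraceEq l m) :
    X.TraceEq (X.step w l) (X.step w m) := by
  by_cases hl : X.IsPred w l
  · obtain ⟨u, q, hq⟩ := hl
    exact (step_of_traceEq hX hq).trans (step_of_traceEq hX (h.symm.trans hq)).symm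
  · have hm : ¬ X.IsPred w m := fun ⟨u, q, hq⟩ => hl ⟨u, q, h.trans hq⟩
    rw [step_of_not_isPred hl, step_of_not_isPred hm]
    exact h.cons w

/-- The list contains a backtrack. -/
inductive HasBacktrack : List V → Prop
  | head (a b : V) (l : List V) : HasBacktrack (a :: b :: a :: l)
  | tail (a : V) {l : List V} : HasBacktrack l → HasBacktrack (a :: l)

/-- No list in the trace equivalence class has a backtrack. -/
def IsReduced (X : CubeComplex V) (l : List V) : Prop := ∀ m, X.TraceEq l m → ¬ HasBacktrack m

theorem IsReduced.of_traceEq {l m : List V} (h : X.IsReduced l) (h' : X.TraceEq l m) :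
    X.IsReduced m := fun n hn => h n (h'.trans hn)

theorem IsReduced.tail {a : V} {l : List V} (h : X.IsReduced (a :: l)) : X.IsReduced l :=
  fun m hm hb => h (a :: m) (hm.cons a) (.tail a hb)

/-- It suffices to look for a backtrack at the first edge: by Levi's lemma, a backtrack that starts
later can be moved to the front. -/
theorem IsReduced.cons (hX : X.IsNonpositivelyCurved) {u w : V} {p : List V}
    (h : X.IsReduced (u :: p)) (hw : ¬ X.IsPred w (u :: p)) : X.IsReduced (w :: u :: p) := by
  obtain ⟨n, hn⟩ : ∃ n, p.length = n := ⟨_, rfl⟩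
  induction n generalizing u w p with
  | zero =>
    rw [List.length_eq_zero_iff] at hn
    subst hn
    intro m hm hb
    have := hm.length_eq
    cases hb with
    | head => simp at this
    | tail _ hb =>
      cases hb with
      | head => simp at this
      | tail _ hb => cases hb <;> simp at this
  | succ n IH =>
    intro m hm hb
    have hlen := hm.length_eq
    rcases m with _ | ⟨w', _ | ⟨b, t⟩⟩
    · simp at hlen
    · simp at hlen
    obtain rfl := hm.head_eq
    rcases hm.levi hX with ⟨rfl, h1⟩ | ⟨c, r, hsq, h1, h2⟩
    · cases hb with
      | head _ _ t => exact hw ⟨u, t, h1⟩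
      | tail _ hb => exact h _ h1 hb
    · have hred : X.IsReduced (c :: r) := (h.of_traceEq h1).tail
      cases hb with
      | head _ _ t =>
        rcases h2.levi hX with ⟨rfl, -⟩ | ⟨x, r', hx, h3, h4⟩
        · exact hsq.ne_opp rfl
        · obtain rfl := hsq.rotate.rotate.unique hx.rotate.rotate.rotate
          exact h _ (h1.trans (h4.cons _)) (.head _ _ _)
      | tail _ hb =>
        have hpred : X.IsPred b (c :: r) := by
          by_contra hcon
          have hl := h1.length_eq
          simp only [List.length_cons] at hl
          exact IH hred hcon (by omega) _ h2.symm hb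
        obtain ⟨c', q, hq⟩ := hpred
        obtain rfl := hq.head_eq
        exact hw ⟨u, b :: q, h1.trans ((hq.cons u).trans (.square hsq.rotate _))⟩

theorem IsReduced.step (hX : X.IsNonpositivelyCurved) {u w : V} {p : List V}
    (h : X.IsReduced (u :: p)) : X.IsReduced (X.step w (u :: p)) := by
  by_cases hw : X.IsPred w (u :: p)
  · obtain ⟨v, q, hq⟩ := hw
    exact ((h.of_traceEq hq).tail).of_traceEq (step_of_traceEq hX hq).symm
  · rw [step_of_not_isPred hw]
    exact h.cons hX hw

/-- A step along an edge and the step back cancel. -/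
theorem step_step (hX : X.IsNonpositivelyCurved) {u w : V} {p : List V}
    (h : X.IsReduced (u :: p)) : X.TraceEq (X.step u (X.step w (u :: p))) (u :: p) := by
  by_cases hw : X.IsPred w (u :: p)
  · obtain ⟨v, q, hq⟩ := hw
    obtain rfl := hq.head_eq
    have h1 := step_of_traceEq hX hq
    refine (step_congr hX u h1).trans ?_
    rw [step_of_not_isPred]
    · exact hq.symm
    · rintro ⟨w', r, hr⟩
      obtain rfl := hr.head_eq
      exact h _ (hq.trans (hr.cons u)) (.head _ _ _)
  · rw [step_of_not_isPred hw]
    exact step_of_traceEq hX (.refl _)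

/-- The steps along the two halves of the boundary of a square agree. -/
theorem step_step_square (hX : X.IsNonpositivelyCurved) {u b c d : V} (hsq : X.IsSquare u b c d)
    (p : List V) : X.TraceEq (X.step c (X.step b (u :: p))) (X.step c (X.step d (u :: p))) := by
  have key : ∀ {b d : V}, X.IsSquare u b c d → ∀ q, X.TraceEq (u :: p) (u :: b :: q) →
      ¬ X.IsPred d (u :: p) →
      X.TraceEq (X.step c (X.step b (u :: p))) (X.step c (X.step d (u :: p))) := by
    intro b d hsq q hq hd
    rw [step_of_not_isPred hd]
    have h1 := step_congr hX c (step_of_traceEq hX hq)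
    rw [step_of_not_isPred (w := c) (l := b :: q)] at h1
    · refine h1.trans (step_of_traceEq hX (u := d) ?_).symm
      exact (hq.cons d).trans (.square hsq.rotate.rotate.rotate _)
    · rintro ⟨b', r, hr⟩
      obtain rfl := hr.head_eq
      exact hd ⟨u, c :: r, hq.trans ((hr.cons u).trans (.square hsq _))⟩
  by_cases hb : X.IsPred b (u :: p) <;> by_cases hd : X.IsPred d (u :: p)
  · obtain ⟨u', q, hq⟩ := hb
    obtain ⟨u'', q', hq'⟩ := hd
    obtain rfl := hq.head_eq
    obtain rfl := hq'.head_eq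
    rcases (hq.symm.trans hq').levi hX with ⟨rfl, -⟩ | ⟨c', r, hsq', h1, h2⟩
    · exact absurd rfl hsq.ne_opp'
    · obtain rfl := hsq.unique_opp hsq'
      exact (step_of_traceEq hX (h := (step_of_traceEq hX hq).trans h1)).trans
        (step_of_traceEq hX (h := (step_of_traceEq hX hq').trans h2)).symm
  · obtain ⟨u', q, hq⟩ := hb
    obtain rfl := hq.head_eq
    exact key hsq q hq hd
  · obtain ⟨u', q, hq⟩ := hd
    obtain rfl := hq.head_eq
    exact (key hsq.reflect q hq hb).symm
  · have key' : ∀ {b d : V}, X.IsSquare u b c d → ¬ X.IsPred d (u :: p) →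
        ¬ X.IsPred c (b :: u :: p) := by
      rintro b d hsq hd ⟨b', r, hr⟩
      obtain rfl := hr.head_eq
      rcases hr.levi hX with ⟨rfl, -⟩ | ⟨x, r', hx, h1, -⟩
      · exact hsq.ne_opp rfl
      · obtain rfl := hsq.unique hx.rotate.reflect
        exact hd ⟨u, r', h1⟩
    rw [step_of_not_isPred hb, step_of_not_isPred hd, step_of_not_isPred (key' hsq hd),
      step_of_not_isPred (key' hsq.reflect hb)]
    exact .square hsq.rotate.rotate.reflect _

end CubeComplex

/-! ### Geodesics in a CAT(0) cube complex -/

namespace CubeComplex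

variable {V : Type*} {X : CubeComplex V}

open SimpleGraph

theorem support_eq_cons {u v : V} (p : X.graph.Walk u v) : p.support = u :: p.support.tail :=
  (Walk.cons_tail_support p).symm

/-- The reduced list of vertices obtained from an edge path to `v₀` by starting at the end of the
path and following it backwards by steps. -/
noncomputable def rep {v₀ : V} : ∀ {u : V}, X.graph.Walk u v₀ → List V
  | _, .nil => [v₀]
  | u, .cons _ p => X.step u (rep p)

theorem rep_eq_cons {u v₀ : V} (p : X.graph.Walk u v₀) : ∃ l, rep p = u :: l := by
  cases p with
  | nil => exact ⟨[], rfl⟩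
  | cons h p => exact X.step_eq_cons _ _

theorem isReduced_singleton (v : V) : X.IsReduced [v] := by
  intro m hm hb
  have := hm.length_eq
  cases hb with
  | head => simp at this
  | tail _ hb => cases hb <;> simp at this

theorem isReduced_rep (hX : X.IsNonpositivelyCurved) {u v₀ : V} (p : X.graph.Walk u v₀) :
    X.IsReduced (rep p) := by
  induction p with
  | nil => exact isReduced_singleton _
  | cons h p ih =>
    obtain ⟨l, hl⟩ := rep_eq_cons p
    change X.IsReduced (X.step _ (rep p))
    rw [hl] at ih ⊢
    exact ih.step hX

/-- Up to trace equivalence, the reduced list depends only on the homotopy class of the path. -/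
theorem Homotopic.rep_traceEq (hX : X.IsNonpositivelyCurved) {u v₀ : V} {p q : X.graph.Walk u v₀}
    (h : X.Homotopic p q) : X.TraceEq (rep p) (rep q) := by
  induction h with
  | refl => exact .refl _
  | symm _ ih => exact ih.symm
  | trans _ _ ih ih' => exact ih.trans ih'
  | cons h _ ih => exact step_congr hX _ ih
  | backtrack h h' p =>
    have hp := isReduced_rep hX p
    obtain ⟨l, hl⟩ := rep_eq_cons p
    change X.TraceEq (X.step _ (X.step _ (rep p))) (rep p)
    rw [hl] at hp ⊢
    exact step_step hX hp
  | square hab hbc had hdc hsq p =>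
    obtain ⟨l, hl⟩ := rep_eq_cons p
    change X.TraceEq (X.step _ (X.step _ (rep p))) (X.step _ (X.step _ (rep p)))
    rw [hl]
    exact step_step_square hX hsq.rotate.rotate.reflect l

theorem rep_traceEq_support (hX : X.IsNonpositivelyCurved) {u v₀ : V} (p : X.graph.Walk u v₀)
    (h : X.IsReduced p.support) : X.TraceEq (rep p) p.support := by
  induction p with
  | nil => exact .refl _
  | @cons u w _ huw p ih =>
    rw [Walk.support_cons] at h ⊢
    refine (step_congr hX u (ih h.tail)).trans ?_
    rw [step_of_not_isPred]
    · exact .refl _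
    · rintro ⟨w', q, hq⟩
      rw [support_eq_cons] at hq h
      obtain rfl := hq.head_eq
      exact h _ (hq.cons u) (.head _ _ _)

theorem Homotopic.append_right {u v w : V} {p q : X.graph.Walk u v} (h : X.Homotopic p q)
    (r : X.graph.Walk v w) : X.Homotopic (p.append r) (q.append r) := by
  induction h with
  | refl => exact .refl _
  | symm _ ih => exact .symm (ih r)
  | trans _ _ ih ih' => exact .trans (ih r) (ih' r)
  | cons h _ ih => exact .cons h (ih r)
  | backtrack h h' p => exact .backtrack h h' _
  | square hab hbc had hdc hsq p => exact .square hab hbc had hdc hsq _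

theorem Homotopic.append_left {u v w : V} (r : X.graph.Walk u v) {p q : X.graph.Walk v w}
    (h : X.Homotopic p q) : X.Homotopic (r.append p) (r.append q) := by
  induction r with
  | nil => exact h
  | cons h' r ih => exact .cons h' (ih h)

theorem homotopic_reverse_append {u v : V} (p : X.graph.Walk u v) :
    X.Homotopic (p.reverse.append p) .nil := by
  induction p with
  | nil => exact .refl _
  | cons h p ih =>
    rw [Walk.reverse_cons, ← Walk.append_assoc]
    exact .trans (.append_left _ (.backtrack h.symm h p)) ih

/-- In a simply connected complex, edge paths with the same end points are homotopic. -/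
theorem IsSimplyConnected.homotopic (hX : X.IsSimplyConnected) {u v : V}
    (p q : X.graph.Walk u v) : X.Homotopic p q := by
  have h1 := (hX.2 u (p.append q.reverse)).append_right q
  rw [← Walk.append_assoc] at h1
  have h2 := (homotopic_reverse_append q).append_left p
  rw [Walk.append_nil] at h2
  exact .trans (.symm h2) h1

theorem Homotopic.length_mod_two {u v : V} {p q : X.graph.Walk u v} (h : X.Homotopic p q) :
    p.length % 2 = q.length % 2 := by
  induction h with
  | refl => rfl
  | symm _ ih => exact ih.symm
  | trans _ _ ih ih' => exact ih.trans ih'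
  | cons h _ ih => simp only [Walk.length_cons]; omega
  | backtrack h h' p => simp only [Walk.length_cons]; omega
  | square hab hbc had hdc hsq p => simp only [Walk.length_cons]

theorem exists_walk_of_traceEq {u v : V} (p : X.graph.Walk u v) {m : List V}
    (h : X.TraceEq p.support m) : ∃ q : X.graph.Walk u v, q.support = m := by
  induction h with
  | refl => exact ⟨p, rfl⟩
  | tail _ h ih =>
    obtain ⟨q, rfl⟩ := ih
    clear * - h
    generalize hl : q.support = l at h
    induction h generalizing u with
    | @head a b c d hsq l =>
      cases q with
      | nil => simp at hl
      | cons h1 q =>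
        cases q with
        | nil => simp at hl
        | cons h2 q =>
          rw [Walk.support_cons, Walk.support_cons, support_eq_cons] at hl
          simp only [List.cons.injEq] at hl
          obtain ⟨rfl, rfl, rfl, rfl⟩ := hl
          refine ⟨.cons hsq.adj₄.symm (.cons hsq.adj₃.symm q), ?_⟩
          rw [Walk.support_cons, Walk.support_cons, Walk.cons_tail_support]
    | tail a hm ih =>
      cases q with
      | nil =>
        simp only [Walk.support_nil, List.cons.injEq] at hl
        obtain ⟨rfl, rfl⟩ := hl
        cases hm
      | cons h1 q =>
        simp only [Walk.support_cons, List.cons.injEq] at hl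
        obtain ⟨rfl, hl⟩ := hl
        obtain ⟨q', hq'⟩ := ih q hl
        exact ⟨.cons h1 q', by rw [Walk.support_cons, hq']⟩

theorem exists_shorter_of_hasBacktrack {u v : V} (p : X.graph.Walk u v)
    (h : HasBacktrack p.support) : ∃ q : X.graph.Walk u v, q.length < p.length := by
  induction p with
  | nil =>
    rcases h with _ | ⟨_, h⟩
    cases h
  | @cons u w v h1 p ih =>
    rw [Walk.support_cons] at h
    generalize hl : p.support = l at h
    cases h with
    | head a b l =>
      cases p with
      | nil => simp at hl
      | cons h2 p =>
        rw [Walk.support_cons, support_eq_cons] at hl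
        simp only [List.cons.injEq] at hl
        obtain ⟨rfl, rfl, rfl⟩ := hl
        exact ⟨p, by simp only [Walk.length_cons]; omega⟩
    | tail _ h =>
      obtain ⟨q, hq⟩ := ih (hl ▸ h)
      exact ⟨.cons h1 q, by simpa using hq⟩

theorem isReduced_of_geodesic {u v : V} (p : X.graph.Walk u v)
    (hp : p.length = X.graph.dist u v) : X.IsReduced p.support := by
  intro m hm hb
  obtain ⟨q, rfl⟩ := exists_walk_of_traceEq p hm
  obtain ⟨r, hr⟩ := exists_shorter_of_hasBacktrack q hb
  have h1 := hm.length_eq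
  rw [Walk.length_support, Walk.length_support] at h1
  have := X.graph.dist_le r
  omega

/-- Any two geodesics with the same end points differ by square moves. -/
theorem geodesic_traceEq (hX : X.IsCAT0) {u v : V} (p q : X.graph.Walk u v)
    (hp : p.length = X.graph.dist u v) (hq : q.length = X.graph.dist u v) :
    X.TraceEq p.support q.support :=
  ((rep_traceEq_support hX.1 p (isReduced_of_geodesic p hp)).symm.trans
    ((hX.2.homotopic p q).rep_traceEq hX.1)).trans
    (rep_traceEq_support hX.1 q (isReduced_of_geodesic q hq))

theorem IsCAT0.connected (hX : X.IsCAT0) : X.graph.Connected := hX.2.1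

/-- The 1-skeleton is bipartite. -/
theorem dist_adj (hX : X.IsCAT0) (x : V) {u v : V} (h : X.graph.Adj u v) :
    X.graph.dist u x = X.graph.dist v x + 1 ∨ X.graph.dist v x = X.graph.dist u x + 1 := by
  obtain ⟨p, hp⟩ := hX.connected.exists_walk_length_eq_dist u x
  obtain ⟨q, hq⟩ := hX.connected.exists_walk_length_eq_dist v x
  have h1 := (hX.2.homotopic p (.cons h q)).length_mod_two
  have h2 := X.graph.dist_le (Walk.cons h q)
  have h3 := X.graph.dist_le (Walk.cons h.symm p)
  simp only [Walk.length_cons] at h1 h2 h3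
  omega

/-- The quadrangle condition. -/
theorem quadrangle (hX : X.IsCAT0) {x u w w' : V} (hw : X.graph.Adj u w) (hw' : X.graph.Adj u w')
    (hd : X.graph.dist u x = X.graph.dist w x + 1) (hd' : X.graph.dist u x = X.graph.dist w' x + 1)
    (hne : w ≠ w') : ∃ c, X.IsSquare u w c w' ∧ X.graph.dist w x = X.graph.dist c x + 1 := by
  obtain ⟨p, hp⟩ := hX.connected.exists_walk_length_eq_dist w x
  obtain ⟨q, hq⟩ := hX.connected.exists_walk_length_eq_dist w' x
  have h := geodesic_traceEq hX (Walk.cons hw p) (Walk.cons hw' q)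
    (by simp only [Walk.length_cons]; omega) (by simp only [Walk.length_cons]; omega)
  rw [Walk.support_cons, Walk.support_cons, support_eq_cons p, support_eq_cons q] at h
  rcases h.levi hX.1 with ⟨h, -⟩ | ⟨c, r, hsq, h1, -⟩
  · exact absurd h hne
  refine ⟨c, hsq, ?_⟩
  rw [Walk.cons_tail_support] at h1
  obtain ⟨p', hp'⟩ := exists_walk_of_traceEq p h1
  have hlen := h1.length_eq
  cases p' with
  | nil => simp at hp'
  | cons h2 p' =>
    rw [Walk.support_cons, support_eq_cons] at hp'
    simp only [List.cons.injEq, true_and] at hp'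
    obtain ⟨rfl, rfl⟩ := hp'
    rw [Walk.cons_tail_support, List.length_cons, Walk.length_support, Walk.length_support] at hlen
    have := X.graph.dist_le p'
    rcases dist_adj hX x h2 with h3 | h3 <;> omega

end CubeComplex

/-! ### Halfspaces of a CAT(0) cube complex -/

namespace CubeComplex

variable {V : Type*} {X : CubeComplex V}

open SimpleGraph

/-- The vertices that are closer to `a` than to `b`. -/
def side (X : CubeComplex V) (a b : V) : Set V := {x | X.graph.dist a x < X.graph.dist b x}

theorem mem_side {a b x : V} : x ∈ X.side a b ↔ X.graph.dist a x < X.graph.dist b x := Iff.rfl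

theorem left_mem_side {a b : V} (h : X.graph.Adj a b) : a ∈ X.side a b := by
  rw [mem_side, dist_self, dist_comm, dist_eq_one_iff_adj.2 h]
  exact one_pos

theorem side_compl (hX : X.IsCAT0) {a b : V} (h : X.graph.Adj a b) :
    (X.side a b)ᶜ = X.side b a := by
  ext x
  rw [Set.mem_compl_iff, mem_side, mem_side]
  rcases dist_adj hX x h with h | h <;> omega

theorem right_notMem_side (a b : V) : b ∉ X.side a b := by
  rw [mem_side, dist_self]
  exact Nat.not_lt_zero _

theorem IsSquare.flip {u v w z : V} (h : X.IsSquare u v w z) : X.IsSquare z w v u :=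
  h.rotate.reflect.rotate.rotate

theorem side_subset_of_isSquare (hX : X.IsCAT0) {u v w z : V} (h : X.IsSquare u v w z) :
    X.side u v ⊆ X.side z w := by
  intro x hx
  rw [mem_side] at hx ⊢
  rcases dist_adj hX x h.adj₃ with h1 | h1
  · omega
  exfalso
  have h2 := dist_adj hX x h.adj₁
  have h3 := dist_adj hX x h.adj₂
  have h4 := dist_adj hX x h.adj₄
  obtain ⟨y, hy, hyd⟩ := quadrangle hX (x := x) h.adj₁.symm h.adj₂ (by omega) (by omega) h.ne_opp
  obtain rfl := hy.unique_opp h.rotate.reflect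
  omega

theorem side_eq_of_isSquare (hX : X.IsCAT0) {u v w z : V} (h : X.IsSquare u v w z) :
    X.side u v = X.side z w :=
  (side_subset_of_isSquare hX h).antisymm (side_subset_of_isSquare hX h.flip)

theorem Dual.side_eq (hX : X.IsCAT0) {a b u v : V} (hab : X.graph.Adj a b) (h : X.Dual a b u v) :
    X.graph.Adj u v ∧ (X.side u v = X.side a b ∨ X.side u v = (X.side a b)ᶜ) := by
  induction h with
  | base => exact ⟨hab, Or.inl rfl⟩
  | flip _ ih =>
    obtain ⟨h1, h2⟩ := ih
    refine ⟨h1.symm, ?_⟩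
    rw [← side_compl hX h1]
    rcases h2 with h2 | h2
    · exact Or.inr (by rw [h2])
    · exact Or.inl (by rw [h2, compl_compl])
  | opposite _ hs ih => exact ⟨hs.adj₃.symm, by rw [← side_eq_of_isSquare hX hs]; exact ih.2⟩

theorem exists_adj_closer (hX : X.IsCAT0) {u x : V} (h : u ≠ x) :
    ∃ w, X.graph.Adj u w ∧ X.graph.dist u x = X.graph.dist w x + 1 := by
  obtain ⟨p, hp⟩ := hX.connected.exists_walk_length_eq_dist u x
  cases p with
  | nil => exact absurd rfl h
  | cons h1 p =>
    refine ⟨_, h1, ?_⟩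
    rw [Walk.length_cons] at hp
    have := X.graph.dist_le p
    rcases dist_adj hX x h1 with h2 | h2 <;> omega

/-- An edge with end points on different sides of the hyperplane of `ab` crosses this hyperplane. -/
theorem dual_of_mem_side (hX : X.IsCAT0) {a b u v : V} (hab : X.graph.Adj a b)
    (huv : X.graph.Adj u v) (hu : u ∈ X.side a b) (hv : v ∉ X.side a b) : X.Dual a b u v := by
  obtain ⟨k, hk⟩ : ∃ k, X.graph.dist u a = k := ⟨_, rfl⟩
  have hcomm : ∀ y z, X.graph.dist y z = X.graph.dist z y := fun _ _ => dist_comm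
  induction k generalizing u v with
  | zero =>
    obtain rfl := hX.connected.dist_eq_zero_iff.1 hk
    rw [mem_side] at hv
    have h1 : X.graph.dist u v = 1 := dist_eq_one_iff_adj.2 huv
    have h2 := dist_adj hX v hab
    obtain rfl := hX.connected.dist_eq_zero_iff.1 (show X.graph.dist b v = 0 by omega)
    exact .base
  | succ k ih =>
    rw [mem_side, hcomm a, hcomm b] at hu hv
    have h1 := dist_adj hX u hab
    have h2 := dist_adj hX v hab
    rw [hcomm a, hcomm b] at h1 h2
    have h3 := dist_adj hX a huv
    have h4 := dist_adj hX b huv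
    obtain ⟨u', huu', hu'⟩ := exists_adj_closer hX (u := u) (x := a) (by rintro rfl; simp at hk)
    have h5 := dist_adj hX u' hab
    rw [hcomm a, hcomm b] at h5
    have h6 := dist_adj hX b huu'
    obtain ⟨v', hsq, hv'⟩ := quadrangle hX (x := b) huv huu' (by omega) (by omega)
      (by rintro rfl; omega)
    have h7 := dist_adj hX a hsq.adj₂
    refine .opposite (ih hsq.adj₃.symm ?_ ?_ (by omega)) hsq.flip
    · rw [mem_side, hcomm a, hcomm b]
      omega
    · rw [mem_side, hcomm a, hcomm b]
      omega

theorem side_eq_of_mem_side (hX : X.IsCAT0) {a b u v : V} (hab : X.graph.Adj a b)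
    (huv : X.graph.Adj u v) (hu : u ∈ X.side a b) (hv : v ∉ X.side a b) :
    X.side a b = X.side u v := by
  rcases ((dual_of_mem_side hX hab huv hu hv).side_eq hX hab).2 with h | h
  · exact h.symm
  · have := left_mem_side huv
    rw [h] at this
    exact absurd hu this

theorem Dual.swap {a b u v : V} (h : X.Dual a b u v) : X.Dual b a u v := by
  induction h with
  | base => exact .flip .base
  | flip _ ih => exact .flip ih
  | opposite _ hs ih => exact .opposite ih hs

theorem setOf_sameSide (hX : X.IsCAT0) {a b : V} (hab : X.graph.Adj a b) :
    {v | X.SameSide a b a v} = X.side a b := by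
  ext v
  constructor
  · intro h
    change Relation.ReflTransGen _ a v at h
    induction h with
    | refl => exact left_mem_side hab
    | tail _ h ih =>
      by_contra hcon
      exact h.2 (dual_of_mem_side hX hab h.1 ih hcon)
  · intro hv
    obtain ⟨k, hk⟩ : ∃ k, X.graph.dist v a = k := ⟨_, rfl⟩
    induction k generalizing v with
    | zero =>
      obtain rfl := hX.connected.dist_eq_zero_iff.1 hk
      exact Relation.ReflTransGen.refl
    | succ k ih =>
      obtain ⟨w, hvw, hw⟩ := exists_adj_closer hX (u := v) (x := a) (by rintro rfl; simp at hk)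
      have hws : w ∈ X.side a b := by
        rw [mem_side, X.graph.dist_comm (u := a), X.graph.dist_comm (u := b)] at hv ⊢
        have h1 := dist_adj hX b hvw
        omega
      refine (ih w hws (by omega)).tail ⟨hvw.symm, fun hd => ?_⟩
      rcases (hd.side_eq hX hab) with ⟨h1, h2 | h2⟩
      · exact right_notMem_side _ _ (h2 ▸ hv)
      · have := left_mem_side h1
        rw [h2] at this
        exact this hws

theorem isHalfspace_side (hX : X.IsCAT0) {a b : V} (hab : X.graph.Adj a b) :
    X.IsHalfspace (X.side a b) := by
  refine ⟨a, b, hab, (setOf_sameSide hX hab).symm, ?_⟩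
  rw [side_compl hX hab, ← setOf_sameSide hX hab.symm]
  have h : ∀ u v, X.Dual b a u v ↔ X.Dual a b u v := fun u v => ⟨.swap, .swap⟩
  simp only [SameSide, h]

theorem IsHalfspace.exists_eq_side (hX : X.IsCAT0) {S : Set V} (h : X.IsHalfspace S) :
    ∃ a b, X.graph.Adj a b ∧ S = X.side a b := by
  obtain ⟨a, b, hab, rfl, -⟩ := h
  exact ⟨a, b, hab, setOf_sameSide hX hab⟩

namespace Halfspace

theorem mem_compl {h : X.Halfspace} {v : V} : v ∈ (hᶜ).1 ↔ v ∉ h.1 := Iff.rfl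

theorem le_def {h k : X.Halfspace} : h ≤ k ↔ h.1 ⊆ k.1 := Iff.rfl

/-- A halfspace is bounded by an edge. -/
theorem exists_edge (hX : X.IsCAT0) (h : X.Halfspace) :
    ∃ u v, X.graph.Adj u v ∧ u ∈ h.1 ∧ v ∉ h.1 := by
  obtain ⟨a, b, hab, heq⟩ := h.2.exists_eq_side hX
  exact ⟨a, b, hab, heq ▸ left_mem_side hab, heq ▸ right_notMem_side _ _⟩

/-- An edge is separated by at most one hyperplane. -/
theorem eq_of_edge (hX : X.IsCAT0) {u v : V} (huv : X.graph.Adj u v) {h k : X.Halfspace}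
    (hu : u ∈ h.1) (hv : v ∉ h.1) (hu' : u ∈ k.1) (hv' : v ∉ k.1) : h = k := by
  obtain ⟨a, b, hab, heq⟩ := h.2.exists_eq_side hX
  obtain ⟨c, d, hcd, heq'⟩ := k.2.exists_eq_side hX
  apply Subtype.ext
  rw [heq] at hu hv
  rw [heq'] at hu' hv'
  rw [heq, heq', side_eq_of_mem_side hX hab huv hu hv, side_eq_of_mem_side hX hcd huv hu' hv']

/-- Only finitely many halfspaces separate two given vertices. -/
theorem finite_separating (hX : X.IsCAT0) (u v : V) :
    {h : X.Halfspace | u ∈ h.1 ∧ v ∉ h.1}.Finite := by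
  obtain ⟨p⟩ := hX.connected.preconnected u v
  induction p with
  | nil =>
    refine Set.finite_empty.subset ?_
    rintro h ⟨h1, h2⟩
    exact h2 h1
  | @cons u w v huw p ih =>
    have h1 : {h : X.Halfspace | u ∈ h.1 ∧ w ∉ h.1}.Subsingleton := fun h hh k hk =>
      eq_of_edge hX huw hh.1 hh.2 hk.1 hk.2
    refine (h1.finite.union ih).subset ?_
    rintro h ⟨hu, hv⟩
    by_cases hw : w ∈ h.1
    · exact Or.inr ⟨hw, hv⟩
    · exact Or.inl ⟨hu, hw⟩

theorem nonempty (hX : X.IsCAT0) (h : X.Halfspace) : ∃ v, v ∈ h.1 :=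
  let ⟨u, _, _, hu, _⟩ := h.exists_edge hX
  ⟨u, hu⟩

theorem finite_between (hX : X.IsCAT0) (a b : X.Halfspace) :
    {c : X.Halfspace | a ≤ c ∧ c ≤ b}.Finite := by
  obtain ⟨u, hu⟩ := a.nonempty hX
  obtain ⟨v, hv⟩ := (bᶜ).nonempty hX
  exact (finite_separating hX u v).subset fun c hc => ⟨hc.1 hu, fun h => hv (hc.2 h)⟩

/-- From a vertex of a halfspace one can move towards the complement: some edge at the vertex
crosses a hyperplane that separates the vertex from the complement of the halfspace. -/
theorem exists_adj_le (hX : X.IsCAT0) {h : X.Halfspace} {v : V} (hv : v ∈ h.1) :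
    ∃ u, ∃ c : X.Halfspace, X.graph.Adj v u ∧ v ∈ c.1 ∧ u ∉ c.1 ∧ c ≤ h := by
  obtain ⟨y, hy⟩ := (hᶜ).nonempty hX
  obtain ⟨n, hn⟩ : ∃ n, X.graph.dist v y = n := ⟨_, rfl⟩
  induction n generalizing v with
  | zero =>
    obtain rfl := hX.connected.dist_eq_zero_iff.1 hn
    exact absurd hv hy
  | succ n ih =>
    obtain ⟨w, hvw, hwy⟩ := exists_adj_closer hX (u := v) (x := y) (by rintro rfl; exact hy hv)
    by_cases hw : w ∈ h.1
    · obtain ⟨u, c, hwu, hwc, huc, hch⟩ := ih hw (by omega)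
      obtain ⟨a, b, hab, heq⟩ := c.2.exists_eq_side hX
      by_cases hvc : v ∈ c.1
      · by_cases hle : X.side v w ⊆ h.1
        · exact ⟨w, ⟨_, isHalfspace_side hX hvw⟩, hvw, left_mem_side hvw, right_notMem_side _ _,
            hle⟩
        · -- Some `x` outside `h` has both `v` and `u` as neighbours of `w` closer to `x`.
          obtain ⟨x, hx1, hx2⟩ := Set.not_subset.1 hle
          have hceq : c.1 = X.side w u := by
            rw [heq] at hwc huc ⊢
            exact side_eq_of_mem_side hX hab hwu hwc huc
          have hxc : x ∉ X.side w u := fun h' => hx2 (hch (hceq ▸ h'))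
          rw [mem_side] at hx1 hxc
          have h1 := dist_adj hX x hvw
          have h2 := dist_adj hX x hwu
          obtain ⟨s, hsq, -⟩ := quadrangle hX (x := x) hvw.symm hwu (by omega) (by omega)
            (by rintro rfl; exact huc hvc)
          refine ⟨s, c, hsq.adj₂, hvc, ?_, hch⟩
          rw [hceq, side_eq_of_isSquare hX hsq.reflect]
          exact right_notMem_side _ _
      · -- The hyperplane of `c` would be crossed by `vw`, away from `y`.
        exfalso
        have h1 : c.1 = X.side w v := by
          rw [heq] at hwc hvc ⊢
          exact side_eq_of_mem_side hX hab hvw.symm hwc hvc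
        have h2 : y ∈ c.1 := by
          rw [h1, mem_side]
          omega
        exact hy (hch h2)
    · exact ⟨w, h, hvw, hv, hw, fun _ h => h⟩

/-- The Helly property of halfspaces: pairwise intersecting halfspaces have a common vertex,
provided that only finitely many of them do not contain some given vertex. -/
theorem exists_mem_of_pairwise (hX : X.IsCAT0) (F : Set X.Halfspace)
    (hF : ∀ h ∈ F, ∀ k ∈ F, ∃ v, v ∈ h.1 ∧ v ∈ k.1) (v₀ : V)
    (hfin : {h ∈ F | v₀ ∉ h.1}.Finite) : ∃ v, ∀ h ∈ F, v ∈ h.1 := by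
  -- The number of halfspaces above elements of `F` that do not contain the vertex is decreased.
  have hB : {h : X.Halfspace | v₀ ∉ h.1 ∧ ∃ k ∈ F, k ≤ h}.Finite := by
    have : {h : X.Halfspace | v₀ ∉ h.1 ∧ ∃ k ∈ F, k ≤ h} ⊆
        ⋃ k ∈ {h ∈ F | v₀ ∉ h.1}, {h | v₀ ∉ h.1 ∧ k ≤ h} := by
      rintro h ⟨h1, k, hk, hkh⟩
      simp only [Set.mem_iUnion]
      exact ⟨k, ⟨hk, fun h' => h1 (hkh h')⟩, h1, hkh⟩
    refine (hfin.biUnion fun k _ => ?_).subset this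
    obtain ⟨u, hu⟩ := k.nonempty hX
    exact (finite_separating hX u v₀).subset fun h hh => ⟨hh.2 hu, hh.1⟩
  clear hfin
  obtain ⟨n, hn⟩ : ∃ n, {h : X.Halfspace | v₀ ∉ h.1 ∧ ∃ k ∈ F, k ≤ h}.ncard = n := ⟨_, rfl⟩
  induction n using Nat.strong_induction_on generalizing v₀ with
  | _ n ih =>
    by_cases hv₀ : ∀ h ∈ F, v₀ ∈ h.1
    · exact ⟨v₀, hv₀⟩
    push Not at hv₀
    obtain ⟨k, hk, hvk⟩ := hv₀
    obtain ⟨u, c, hadj, hvc, huc, hck⟩ := exists_adj_le hX (h := kᶜ) hvk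
    have hkc : k ≤ cᶜ := fun x hx hxc => hck hxc hx
    have hsub : {h : X.Halfspace | u ∉ h.1 ∧ ∃ k ∈ F, k ≤ h} ⊂
        {h : X.Halfspace | v₀ ∉ h.1 ∧ ∃ k ∈ F, k ≤ h} := by
      refine ⟨?_, fun h' => (h' (show cᶜ ∈ _ from ⟨fun h => h hvc, k, hk, hkc⟩)).1 huc⟩
      rintro h ⟨h1, k', hk', hkh⟩
      refine ⟨fun hv => ?_, k', hk', hkh⟩
      obtain rfl := eq_of_edge hX hadj hv h1 hvc huc
      obtain ⟨x, hx, hx'⟩ := hF k hk k' hk'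
      exact hkc hx (hkh hx')
    exact ih _ (hn ▸ Set.ncard_lt_ncard hsub hB) u (hB.subset hsub.1) rfl

end Halfspace

end CubeComplex

/-! ### The dual complex of a pocset -/

namespace Pocset

variable {Q : Type*} [PrePocset Q]

theorem Lt.trans' (hQ : IsPocset Q) {a b c : Q} (h : Lt a b) (h' : Lt b c) : Lt a c := by
  refine ⟨hQ.le_trans _ _ _ h.1 h'.1, ?_⟩
  rintro rfl
  exact h.2 (hQ.le_antisymm _ _ h.1 h'.1)

theorem Lt.irrefl' {a : Q} (h : Lt a a) : False := h.2 rfl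

theorem lt_of_strictAnti (hQ : IsPocset Q) {s : ℕ → Q} (hs : ∀ n, Lt (s (n + 1)) (s n)) {m n : ℕ}
    (h : m < n) : Lt (s n) (s m) := by
  induction n, h using Nat.le_induction with
  | base => exact hs m
  | succ n _ ih => exact (hs n).trans' hQ ih

/-- Change the orientation that `U` chooses for the elements of `A`. For the result to be a vertex
of the dual complex, it suffices that `A` is closed downwards in `U` and that its elements separate
`U` from another vertex `W`. -/
def flipVertex (hQ : IsPocset Q) (U W : DualVertex Q) (A : Set Q)
    (hA : ∀ a ∈ A, a ∈ U.carrier ∧ a ∉ W.carrier)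
    (hdown : ∀ a ∈ A, ∀ b ∈ U.carrier, b ≤ a → b ∈ A) : DualVertex Q where
  carrier := {x | (x ∈ U.carrier ∧ x ∉ A) ∨ xᶜ ∈ A}
  compl_mem_iff x := by
    have h1 := hA x
    have h2 := hA xᶜ
    have h3 := U.compl_mem_iff x
    simp only [Set.mem_ofPred_eq, PrePocset.compl_invol]
    tauto
  mem_of_le x y hx hxy := by
    by_contra hy
    simp only [Set.mem_ofPred_eq, not_or, not_and, not_not] at hx hy
    obtain ⟨hy1, hy2⟩ := hy
    have hyx := hQ.compl_le_compl _ _ hxy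
    rcases hx with ⟨hx, hxA⟩ | hx
    · exact hxA (hdown y (hy1 (U.mem_of_le _ _ hx hxy)) x hx hxy)
    · by_cases hyU : y ∈ U.carrier
      · have h1 : x ∈ W.carrier := by
          have := (W.compl_mem_iff xᶜ).2 (hA _ hx).2
          rwa [PrePocset.compl_invol] at this
        exact (hA y (hy1 hyU)).2 (W.mem_of_le _ _ h1 hxy)
      · exact hy2 (hdown _ hx _ ((U.compl_mem_iff y).2 hyU) hyx)
  dcc := by
    rintro ⟨s, hs, hlt⟩
    have hUW : ∀ n, s n ∈ U.carrier ∨ s n ∈ W.carrier := by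
      intro n
      rcases hs n with h | h
      · exact Or.inl h.1
      · refine Or.inr ?_
        have := (W.compl_mem_iff (s n)ᶜ).2 (hA _ h).2
        rwa [PrePocset.compl_invol] at this
    by_cases hfreq : ∃ᶠ n in Filter.atTop, s n ∈ U.carrier
    · obtain ⟨φ, hφ, h⟩ := Filter.extraction_of_frequently_atTop hfreq
      exact U.dcc ⟨s ∘ φ, h, fun n => lt_of_strictAnti hQ hlt (hφ n.lt_succ_self)⟩
    · rw [Filter.not_frequently] at hfreq
      have : ∀ᶠ n in Filter.atTop, s n ∈ W.carrier :=
        hfreq.mono fun n hn => (hUW n).resolve_left hn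
      obtain ⟨φ, hφ, h⟩ := Filter.extraction_of_frequently_atTop this.frequently
      exact W.dcc ⟨s ∘ φ, h, fun n => lt_of_strictAnti hQ hlt (hφ n.lt_succ_self)⟩

theorem mem_flipVertex {hQ : IsPocset Q} {U W : DualVertex Q} {A : Set Q}
    {hA : ∀ a ∈ A, a ∈ U.carrier ∧ a ∉ W.carrier}
    {hdown : ∀ a ∈ A, ∀ b ∈ U.carrier, b ≤ a → b ∈ A} {x : Q} :
    x ∈ (flipVertex hQ U W A hA hdown).carrier ↔ (x ∈ U.carrier ∧ x ∉ A) ∨ xᶜ ∈ A := Iff.rfl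

theorem isDualCube_pair {U W : DualVertex Q} {x : Q}
    (h : ∀ c, ¬ SameHyp c x → (c ∈ W.carrier ↔ c ∈ U.carrier)) (hne : U ≠ W) :
    IsDualCube ({U, W} : Set (DualVertex Q)) := by
  have hx : x ∈ W.carrier ↔ x ∉ U.carrier := by
    by_contra hcon
    refine hne (DualVertex.ext' fun c => ?_).symm
    by_cases hc : SameHyp c x
    · exact hc.mem_iff (by tauto)
    · exact h c hc
  refine ⟨U, {x}, by simp, fun B => ?_, ?_⟩
  · by_cases hB : x ∈ B ↔ x ∈ U.carrier
    · exact ⟨U, fun _ _ => Iff.rfl, by simpa using hB.symm⟩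
    · refine ⟨W, fun c hc => h c (hc x (by simp)), ?_⟩
      simp only [Finset.mem_singleton, forall_eq]
      tauto
  · ext T
    constructor
    · rintro (rfl | rfl)
      · exact fun _ _ => Iff.rfl
      · exact fun c hc => h c (hc x (by simp))
    · intro hT
      have hT' : ∀ c, ¬ SameHyp c x → (c ∈ T.carrier ↔ c ∈ U.carrier) := fun c hc =>
        hT c (by simpa using hc)
      by_cases hxT : x ∈ T.carrier ↔ x ∈ U.carrier
      · left
        refine DualVertex.ext' fun c => ?_
        by_cases hc : SameHyp c x
        · exact hc.mem_iff hxT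
        · exact hT' c hc
      · right
        refine DualVertex.ext' fun c => ?_
        by_cases hc : SameHyp c x
        · exact hc.mem_iff (by tauto)
        · exact (hT' c hc).trans (h c hc).symm

theorem edist_le_one {U W : DualVertex Q} {x : Q}
    (h : ∀ c, ¬ SameHyp c x → (c ∈ W.carrier ↔ c ∈ U.carrier)) :
    (dualComplex Q).graph.edist U W ≤ 1 := by
  by_cases hne : U = W
  · subst hne
    simp
  · have hadj : (dualComplex Q).graph.Adj U W := ⟨hne, isDualCube_pair h hne⟩
    exact (SimpleGraph.edist_eq_one_iff_adj.2 hadj).le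

/-- The distance of two vertices of the dual complex is at most the number of hyperplanes that
separate them. -/
theorem edist_le_ncard (hQ : IsPocset Q) (U W : DualVertex Q)
    (hfin : {x | x ∈ U.carrier ∧ x ∉ W.carrier}.Finite) :
    (dualComplex Q).graph.edist U W ≤ {x | x ∈ U.carrier ∧ x ∉ W.carrier}.ncard := by
  let _ : PartialOrder Q :=
    { le_refl := hQ.le_refl, le_trans := hQ.le_trans, le_antisymm := hQ.le_antisymm }
  obtain ⟨n, hn⟩ : ∃ n, {x | x ∈ U.carrier ∧ x ∉ W.carrier}.ncard = n := ⟨_, rfl⟩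
  rw [hn]
  induction n generalizing U with
  | zero =>
    rw [Set.ncard_eq_zero hfin, Set.eq_empty_iff_forall_notMem] at hn
    have : U = W := by
      refine DualVertex.ext' fun a => ⟨fun ha => ?_, fun ha => ?_⟩
      · by_contra h
        exact hn a ⟨ha, h⟩
      · by_contra h
        refine hn aᶜ ⟨(U.compl_mem_iff a).2 h, fun h' => (W.compl_mem_iff a).1 h' ha⟩
    rw [this]
    simp
  | succ n ih =>
    have hne : {x | x ∈ U.carrier ∧ x ∉ W.carrier}.Nonempty := by
      rw [← Set.ncard_pos hfin]
      omega
    obtain ⟨x, hx⟩ := hfin.exists_minimal hne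
    have hxUW : x ∈ U.carrier ∧ x ∉ W.carrier := hx.1
    let U₁ := flipVertex hQ U W {x} (by rintro a rfl; exact hx.1) (by
      rintro a rfl b hb hba
      exact (hx.eq_of_le (y := b) ⟨hb, fun h => hxUW.2 (W.mem_of_le _ _ h hba)⟩ hba))
    have hU₁ : {y | y ∈ U₁.carrier ∧ y ∉ W.carrier} =
        {y | y ∈ U.carrier ∧ y ∉ W.carrier} \ {x} := by
      ext y
      simp only [Set.mem_ofPred_eq, U₁, mem_flipVertex, Set.mem_singleton_iff, Set.mem_sdiff]
      constructor
      · rintro ⟨⟨h1, h2⟩ | rfl, h3⟩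
        · exact ⟨⟨h1, h3⟩, h2⟩
        · exact absurd ((W.compl_mem_iff y).2 h3) hxUW.2
      · rintro ⟨⟨h1, h2⟩, h3⟩
        exact ⟨Or.inl ⟨h1, h3⟩, h2⟩
    have h1 : (dualComplex Q).graph.edist U U₁ ≤ 1 := by
      refine edist_le_one (x := x) fun c hc => ?_
      simp only [U₁, mem_flipVertex, Set.mem_singleton_iff]
      have h1 : c ≠ x := fun h => hc (Or.inl h)
      have h2 : cᶜ ≠ x := fun h => hc (Or.inr (by rw [← h, PrePocset.compl_invol]))
      tauto
    have h2 := ih U₁ (by rw [hU₁]; exact hfin.sdiff) (by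
      rw [hU₁, Set.ncard_sdiff_singleton_of_mem hx.1, hn, Nat.add_sub_cancel])
    refine SimpleGraph.edist_triangle.trans ((add_le_add h1 h2).trans ?_)
    rw [Nat.cast_succ, add_comm]

/-- Incomparable elements that separate two vertices of the dual complex are the directions of a
cube. -/
theorem card_le_of_antichain (hQ : IsPocset Q) {d : ℕ}
    (hd : ∀ C : Set (DualVertex Q), IsDualCube C → C.ncard ≤ 2 ^ d) (U W : DualVertex Q)
    (B : Finset Q) (hB : ∀ a ∈ B, a ∈ U.carrier ∧ a ∉ W.carrier)
    (hanti : ∀ a ∈ B, ∀ b ∈ B, ¬ Lt a b) : B.card ≤ d := by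
  classical
  -- First everything below `B` is flipped, so that the elements of `B` become minimal.
  let E : Set Q := {y | (y ∈ U.carrier ∧ y ∉ W.carrier) ∧ ∃ a ∈ B, Lt y a}
  have hmemE : ∀ {y a}, y ∈ U.carrier → a ∈ B → Lt y a → y ∈ E := fun {y a} hy ha h =>
    ⟨⟨hy, fun hW => (hB a ha).2 (W.mem_of_le _ _ hW h.1)⟩, a, ha, h⟩
  let U₁ := flipVertex hQ U W E (fun a ha => ha.1) (by
    rintro a ⟨-, c, hc, hac⟩ b hb hba
    by_cases heq : b = a
    · exact hmemE hb hc (heq ▸ hac)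
    · exact hmemE hb hc (Lt.trans' hQ ⟨hba, heq⟩ hac))
  have hBU₁ : ∀ a ∈ B, a ∈ U₁.carrier := by
    intro a ha
    refine Or.inl ⟨(hB a ha).1, ?_⟩
    rintro ⟨-, c, hc, hac⟩
    exact hanti a ha c hc hac
  have hmin : ∀ a ∈ B, ∀ b ∈ U₁.carrier, b ≤ a → b = a := by
    intro a ha b hb hba
    by_contra hne
    rcases hb with ⟨h1, h2⟩ | h
    · exact h2 (hmemE h1 ha ⟨hba, hne⟩)
    · have h1 := (W.compl_mem_iff bᶜ).2 h.1.2
      rw [PrePocset.compl_invol] at h1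
      exact (hB a ha).2 (W.mem_of_le _ _ h1 hba)
  have hncompl : ∀ a ∈ B, aᶜ ∉ B := fun a ha ha' =>
    (U.compl_mem_iff a).1 (hB _ ha').1 (hB a ha).1
  let F : Set Q → DualVertex Q := fun S => flipVertex hQ U₁ W {a | a ∈ B ∧ a ∉ S}
    (fun a ha => ⟨hBU₁ a ha.1, (hB a ha.1).2⟩)
    (fun a ha b hb hba => by rwa [hmin a ha.1 b hb hba])
  have hF : ∀ S, ∀ a ∈ B, (a ∈ (F S).carrier ↔ a ∈ S) := by
    intro S a ha
    simp only [F, mem_flipVertex, Set.mem_ofPred_eq]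
    have h1 := hBU₁ a ha
    have h2 := hncompl a ha
    tauto
  have hagree : ∀ S, AgreeOff B U₁ (F S) := by
    intro S c hc
    simp only [F, mem_flipVertex, Set.mem_ofPred_eq]
    have h1 : c ∉ B := fun h => hc c h (Or.inl rfl)
    have h2 : cᶜ ∉ B := fun h => hc _ h (Or.inr (PrePocset.compl_invol c).symm)
    simp [h1, h2]
  have hcube : IsDualCube {T | AgreeOff B U₁ T} := by
    refine ⟨U₁, B, ?_, fun S => ⟨F S, hagree S, hF S⟩, rfl⟩
    rintro a ha b hb (rfl | rfl)
    · rfl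
    · exact absurd ha (hncompl b hb)
  have hfin := (CubeComplex.IsCube.exists_ncard_eq (X := dualComplex Q) hcube).1
  have hle : (B.powerset : Set (Finset Q)).ncard ≤ {T | AgreeOff B U₁ T}.ncard := by
    refine Set.ncard_le_ncard_of_injOn (fun S : Finset Q => F (S : Set Q)) (fun S _ => hagree S)
      ?_ hfin
    intro S hS T hT heq
    simp only [Finset.coe_powerset, Set.mem_preimage, Set.mem_powerset_iff, Finset.coe_subset]
      at hS hT
    have heq' : F (S : Set Q) = F (T : Set Q) := heq
    ext a
    by_cases ha : a ∈ B
    · have h1 := hF S a ha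
      have h2 := hF T a ha
      rw [heq', h2] at h1
      exact h1.symm
    · exact ⟨fun h => absurd (hS h) ha, fun h => absurd (hT h) ha⟩
  rw [Set.ncard_coe_finset, Finset.card_powerset] at hle
  exact (Nat.pow_le_pow_iff_right one_lt_two).1 (hle.trans (hd _ hcube))

/-- Two vertices of a finite dimensional dual complex are separated by finitely many hyperplanes:
there are neither infinite chains nor infinite antichains of separating elements. -/
theorem finite_diff (hQ : IsPocset Q) {d : ℕ}
    (hd : ∀ C : Set (DualVertex Q), IsDualCube C → C.ncard ≤ 2 ^ d) (U W : DualVertex Q) :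
    {x | x ∈ U.carrier ∧ x ∉ W.carrier}.Finite := by
  by_contra hinf
  let s := Set.Infinite.natEmbedding _ hinf
  let t : ℕ → Q := fun n => s n
  have ht : ∀ n, t n ∈ U.carrier ∧ t n ∉ W.carrier := fun n => (s n).2
  have htinj : Function.Injective t := Subtype.val_injective.comp s.injective
  have : IsTrans Q Lt := ⟨fun _ _ _ => Lt.trans' hQ⟩
  have : IsTrans Q (fun a b => Lt b a) := ⟨fun _ _ _ h h' => Lt.trans' hQ h' h⟩
  obtain ⟨g, hg | hg⟩ := exists_increasing_or_nonincreasing_subseq Lt t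
  · refine W.dcc ⟨fun n => (t (g n))ᶜ, fun n => (W.compl_mem_iff _).2 (ht _).2, fun n => ?_⟩
    have := hg n (n + 1) n.lt_succ_self
    refine ⟨hQ.compl_le_compl _ _ this.1, fun h => this.2 ?_⟩
    change (t (g (n + 1)))ᶜ = (t (g n))ᶜ at h
    rw [← PrePocset.compl_invol (t (g n)), ← h, PrePocset.compl_invol]
  obtain ⟨g', hg' | hg'⟩ := exists_increasing_or_nonincreasing_subseq (fun a b => Lt b a) (t ∘ g)
  · exact U.dcc ⟨fun n => t (g (g' n)), fun n => (ht _).1, fun n => hg' n (n + 1) n.lt_succ_self⟩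
  classical
  have hinj : Function.Injective fun n => t (g (g' n)) :=
    htinj.comp (g.injective.comp g'.injective)
  have := card_le_of_antichain hQ hd U W ((Finset.range (d + 1)).image fun n => t (g (g' n)))
    (by
      simp only [Finset.mem_image]
      rintro _ ⟨n, -, rfl⟩
      exact ht _) (by
      simp only [Finset.mem_image]
      rintro _ ⟨m, -, rfl⟩ _ ⟨n, -, rfl⟩ hlt
      rcases lt_trichotomy m n with h | rfl | h
      · exact hg _ _ (g'.strictMono h) hlt
      · exact hlt.irrefl'
      · exact hg' _ _ h hlt)
  rw [Finset.card_image_of_injective _ hinj, Finset.card_range] at this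
  omega

/-- A finite set without antichains of more than `d` elements and without chains of more than `m`
elements has at most `m * d` elements. -/
theorem card_le_mul_of_chain {α : Type*} (r : α → α → Prop) (d : ℕ) (m : ℕ) (T : Finset α)
    (hanti : ∀ B ⊆ T, (∀ a ∈ B, ∀ b ∈ B, ¬ r a b) → B.card ≤ d)
    (hchain : ¬ ∃ s : ℕ → α, (∀ i ≤ m, s i ∈ T) ∧ ∀ i < m, r (s (i + 1)) (s i)) :
    T.card ≤ m * d := by
  classical
  induction m generalizing T with
  | zero =>
    rw [Nat.zero_mul, Nat.le_zero, Finset.card_eq_zero, Finset.eq_empty_iff_forall_notMem]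
    exact fun x hx => hchain ⟨fun _ => x, fun _ _ => hx, fun i hi => absurd hi (Nat.not_lt_zero i)⟩
  | succ m ih =>
    have h1 := ih (T.filter fun x => ∃ y ∈ T, r x y)
      (fun B hB => hanti B (hB.trans (Finset.filter_subset _ _))) (by
        rintro ⟨s, hs, hr⟩
        obtain ⟨-, y, hy, hys⟩ := Finset.mem_filter.1 (hs 0 (Nat.zero_le _))
        refine hchain ⟨fun i => Nat.casesOn i y s, fun i hi => ?_, fun i hi => ?_⟩
        · cases i with
          | zero => exact hy
          | succ i => exact (Finset.mem_filter.1 (hs i (by omega))).1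
        · cases i with
          | zero => exact hys
          | succ i => exact hr i (by omega))
    have h2 := hanti (T.filter fun x => ¬ ∃ y ∈ T, r x y) (Finset.filter_subset _ _) (by
      intro a ha b hb hab
      exact (Finset.mem_filter.1 ha).2 ⟨b, (Finset.mem_filter.1 hb).1, hab⟩)
    rw [← Finset.card_filter_add_card_filter_not (s := T) (fun x => ∃ y ∈ T, r x y), Nat.succ_mul]
    omega

theorem edist_le_mul (hQ : IsPocset Q) {d : ℕ}
    (hd : ∀ C : Set (DualVertex Q), IsDualCube C → C.ncard ≤ 2 ^ d) (U W : DualVertex Q) (m : ℕ)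
    (hchain : ¬ ∃ s : ℕ → Q, (∀ i ≤ m, s i ∈ U.carrier ∧ s i ∉ W.carrier) ∧
      ∀ i < m, Lt (s (i + 1)) (s i)) :
    (dualComplex Q).graph.edist U W ≤ (m * d : ℕ) := by
  have hfin := finite_diff hQ hd U W
  refine (edist_le_ncard hQ U W hfin).trans ?_
  rw [Nat.cast_le, Set.ncard_eq_toFinset_card _ hfin]
  refine card_le_mul_of_chain Lt d m _ (fun B hB hanti => card_le_of_antichain hQ hd U W B
    (fun a ha => by simpa using hB ha) hanti) ?_
  rintro ⟨s, hs, hs'⟩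
  exact hchain ⟨s, fun i hi => by simpa using hs i hi, hs'⟩

end Pocset

/-! ### Congruences with facing classes -/

namespace Pocset

open CubeComplex

variable {V : Type*} {X : CubeComplex V}

/-- A congruence on the halfspaces whose non-trivial classes are, up to complements, formed by
pairwise facing halfspaces. The predicate `pos` singles out an orientation of the non-trivial
classes. -/
structure IsFacingCongr (r : Congr X.Halfspace) (pos : X.Halfspace → Prop) : Prop where
  pos_of_rel : ∀ {a b}, r.r a b → pos a → pos b
  not_pos_compl : ∀ {a}, pos a → ¬ pos aᶜ
  facing : ∀ {a b}, r.r a b → pos a → a ≠ b → Facing a b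
  eq_of_rel : ∀ {a b}, r.r a b → ¬ pos a → ¬ pos aᶜ → a = b

/-- The set of vertices of `X` that lie on the side `x` of a wall of the quotient: the intersection
of the halfspaces in the class `x`, or their union when the complements are positive. -/
def region (r : Congr X.Halfspace) (pos : X.Halfspace → Prop) (x : r.Quot) : Set V :=
  {v | (∀ a, r.proj a = x → v ∈ a.1) ∨ ∃ a, r.proj a = x ∧ pos aᶜ ∧ v ∈ a.1}

theorem Congr.proj_eq_iff (r : Congr X.Halfspace) {a b : X.Halfspace} :
    r.proj a = r.proj b ↔ r.r a b := Quotient.eq (r := r.toSetoid)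

theorem Congr.exists_proj (r : Congr X.Halfspace) (x : r.Quot) : ∃ a, r.proj a = x :=
  Quotient.exists_rep x

theorem Congr.proj_compl (r : Congr X.Halfspace) (a : X.Halfspace) :
    r.proj aᶜ = (r.proj a)ᶜ := rfl

theorem _root_.CubeComplex.Halfspace.compl_compl' (a : X.Halfspace) : aᶜᶜ = a :=
  PrePocset.compl_invol a

theorem Facing.exists_mem {a b : X.Halfspace} (h : Facing a b) : ∃ v, v ∈ a.1 ∧ v ∈ b.1 := by
  by_contra hcon
  push Not at hcon
  refine h.2 (Subtype.ext (Set.Subset.antisymm h.1 fun v hv => ?_))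
  exact hcon v hv

theorem Facing.mem_of_notMem {a b : X.Halfspace} (h : Facing a b) {v : V} (hv : v ∉ b.1) :
    v ∈ a.1 := h.1 hv

section Region

variable {r : Congr X.Halfspace} {pos : X.Halfspace → Prop}

theorem region_congr {x : r.Quot} {u w : V} (h : ∀ c, r.proj c = x → (u ∈ c.1 ↔ w ∈ c.1)) :
    u ∈ region r pos x ↔ w ∈ region r pos x := by
  have key : ∀ {u w : V}, (∀ c, r.proj c = x → (u ∈ c.1 ↔ w ∈ c.1)) →
      u ∈ region r pos x → w ∈ region r pos x := by
    rintro u w h (hu | ⟨a, ha, hpos, hu⟩)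
    · exact Or.inl fun a ha => (h a ha).1 (hu a ha)
    · exact Or.inr ⟨a, ha, hpos, (h a ha).1 hu⟩
  exact ⟨key h, key fun c hc => (h c hc).symm⟩

namespace IsFacingCongr

variable (hr : IsFacingCongr r pos)

include hr

theorem mem_region_of_not_pos {a : X.Halfspace} (ha : ¬ pos aᶜ) {v : V} :
    v ∈ region r pos (r.proj a) ↔ ∀ b, r.r a b → v ∈ b.1 := by
  constructor
  · rintro (h | ⟨b, hb, hpos, -⟩) c hc
    · exact h c (r.proj_eq_iff.2 (r.iseqv.symm hc))
    · exact absurd (hr.pos_of_rel (r.compl_rel (r.proj_eq_iff.1 hb)) hpos) ha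
  · exact fun h => Or.inl fun b hb => h b (r.iseqv.symm (r.proj_eq_iff.1 hb))

theorem mem_region_of_pos {a : X.Halfspace} (ha : pos aᶜ) {v : V} :
    v ∈ region r pos (r.proj a) ↔ ∃ b, r.r a b ∧ v ∈ b.1 := by
  constructor
  · rintro (h | ⟨b, hb, -, hv⟩)
    · exact ⟨a, r.iseqv.refl a, h a rfl⟩
    · exact ⟨b, r.iseqv.symm (r.proj_eq_iff.1 hb), hv⟩
  · rintro ⟨b, hb, hv⟩
    exact Or.inr ⟨b, r.proj_eq_iff.2 (r.iseqv.symm hb), hr.pos_of_rel (r.compl_rel hb) ha, hv⟩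

theorem region_compl (x : r.Quot) : region r pos xᶜ = (region r pos x)ᶜ := by
  have key : ∀ a : X.Halfspace, ¬ pos a →
      region r pos (r.proj a)ᶜ = (region r pos (r.proj a))ᶜ := by
    intro a ha
    by_cases hac : pos aᶜ
    · ext v
      rw [← r.proj_compl, hr.mem_region_of_not_pos (by rwa [Halfspace.compl_compl']),
        Set.mem_compl_iff, hr.mem_region_of_pos hac]
      push Not
      constructor
      · intro h b hb
        exact h bᶜ (r.compl_rel hb)
      · intro h b hb
        have := h bᶜ (by simpa only [Halfspace.compl_compl'] using r.compl_rel hb)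
        rwa [Halfspace.mem_compl, not_not] at this
    · ext v
      rw [← r.proj_compl, hr.mem_region_of_not_pos (by rwa [Halfspace.compl_compl']),
        Set.mem_compl_iff, hr.mem_region_of_not_pos hac]
      constructor
      · intro h h'
        exact h aᶜ (r.iseqv.refl _) (h' a (r.iseqv.refl _))
      · intro h b hb
        obtain rfl := hr.eq_of_rel hb hac (by rwa [Halfspace.compl_compl'])
        intro hv
        refine h fun c hc => ?_
        obtain rfl := hr.eq_of_rel hc ha hac
        exact hv
  obtain ⟨a, rfl⟩ := r.exists_proj x
  by_cases ha : pos a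
  · have := key aᶜ (hr.not_pos_compl ha)
    rw [r.proj_compl, PrePocset.compl_invol] at this
    rw [this, compl_compl]
  · exact key a ha

/-- An edge crosses a wall of the quotient precisely if it crosses one of its hyperplanes. -/
theorem edge_iff (hX : X.IsCAT0) {u v : V} (huv : X.graph.Adj u v) {x : r.Quot} :
    (u ∈ region r pos x ∧ v ∉ region r pos x) ↔ ∃ a, r.proj a = x ∧ u ∈ a.1 ∧ v ∉ a.1 := by
  have key : ∀ {u v : V}, X.graph.Adj u v → ∀ a : X.Halfspace, ¬ pos aᶜ → u ∈ a.1 → v ∉ a.1 →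
      u ∈ region r pos (r.proj a) := by
    intro u v huv a ha hu hv
    rw [hr.mem_region_of_not_pos ha]
    intro b hb
    by_cases hab : a = b
    · exact hab ▸ hu
    have hpa : pos a := by
      by_contra hpa
      exact hab (hr.eq_of_rel hb hpa ha)
    have hpb := hr.pos_of_rel hb hpa
    have hvb : v ∈ b.1 :=
      (hr.facing (r.iseqv.symm hb) hpb (Ne.symm hab)).mem_of_notMem hv
    by_contra hub
    have := Halfspace.eq_of_edge hX huv.symm (h := aᶜ) (k := b) hv (fun h => h hu) hvb hub
    exact hr.not_pos_compl hpa (this ▸ hpb)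
  constructor
  · rintro ⟨hu, hv⟩
    obtain ⟨a, rfl⟩ := r.exists_proj x
    by_cases ha : pos aᶜ
    · obtain ⟨b, hb, hub⟩ := (hr.mem_region_of_pos ha).1 hu
      refine ⟨b, r.proj_eq_iff.2 (r.iseqv.symm hb), hub, fun h => hv ?_⟩
      exact (hr.mem_region_of_pos ha).2 ⟨b, hb, h⟩
    · by_contra hcon
      push Not at hcon
      exact hv ((hr.mem_region_of_not_pos ha).2 fun b hb =>
        hcon b (r.proj_eq_iff.2 (r.iseqv.symm hb)) ((hr.mem_region_of_not_pos ha).1 hu b hb))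
  · rintro ⟨a, rfl, hu, hv⟩
    by_cases ha : pos aᶜ
    · refine ⟨(hr.mem_region_of_pos ha).2 ⟨a, r.iseqv.refl _, hu⟩, ?_⟩
      have := key huv.symm aᶜ (by
        rw [Halfspace.compl_compl']
        exact fun h => hr.not_pos_compl h ha) hv (fun h => h hu)
      rwa [r.proj_compl, hr.region_compl] at this
    · exact ⟨key huv a ha hu hv, fun h =>
        hv ((hr.mem_region_of_not_pos ha).1 h a (r.iseqv.refl _))⟩

theorem exists_edge (hX : X.IsCAT0) (x : r.Quot) :
    ∃ u v, X.graph.Adj u v ∧ u ∈ region r pos x ∧ v ∉ region r pos x := by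
  obtain ⟨a, ha⟩ := r.exists_proj x
  obtain ⟨u, v, huv, hu, hv⟩ := a.exists_edge hX
  exact ⟨u, v, huv, (hr.edge_iff hX huv).2 ⟨a, ha, hu, hv⟩⟩

theorem eq_of_edge (hX : X.IsCAT0) {u v : V} (huv : X.graph.Adj u v) {x y : r.Quot}
    (hx : u ∈ region r pos x ∧ v ∉ region r pos x) (hy : u ∈ region r pos y ∧ v ∉ region r pos y) :
    x = y := by
  obtain ⟨a, rfl, hu, hv⟩ := (hr.edge_iff hX huv).1 hx
  obtain ⟨b, rfl, hu', hv'⟩ := (hr.edge_iff hX huv).1 hy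
  rw [Halfspace.eq_of_edge hX huv hu hv hu' hv']

theorem region_injective (hX : X.IsCAT0) {x y : r.Quot}
    (h : region r pos x = region r pos y) : x = y := by
  obtain ⟨u, v, huv, hx⟩ := hr.exists_edge hX x
  exact hr.eq_of_edge hX huv hx (h ▸ hx)

theorem finite_separating (hX : X.IsCAT0) (u v : V) :
    {x | u ∈ region r pos x ∧ v ∉ region r pos x}.Finite := by
  refine ((Halfspace.finite_separating hX u v).image r.proj).subset ?_
  rintro x ⟨hu, hv⟩
  obtain ⟨a, rfl⟩ := r.exists_proj x
  by_cases ha : pos aᶜ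
  · obtain ⟨b, hb, hub⟩ := (hr.mem_region_of_pos ha).1 hu
    refine ⟨b, ⟨hub, fun h => hv ?_⟩, r.proj_eq_iff.2 (r.iseqv.symm hb)⟩
    exact (hr.mem_region_of_pos ha).2 ⟨b, hb, h⟩
  · rw [hr.mem_region_of_not_pos ha] at hu hv
    push Not at hv
    obtain ⟨b, hb, hvb⟩ := hv
    exact ⟨b, ⟨hu b hb, hvb⟩, r.proj_eq_iff.2 (r.iseqv.symm hb)⟩

/-- Elements of the same class bound the same hyperplane or are nested. -/
theorem not_transverse {a b : X.Halfspace} (h : r.r a b) : ¬ Transverse a b := by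
  intro ht
  by_cases hab : a = b
  · exact ht.1 (hab ▸ fun _ h => h)
  by_cases ha : pos a
  · have := hr.facing (r.iseqv.symm h) (hr.pos_of_rel h ha) (Ne.symm hab)
    exact ht.2.2.1 this.1
  by_cases hac : pos aᶜ
  · have := hr.facing (r.compl_rel h) hac
      (fun h => hab (by rw [← Halfspace.compl_compl' a, h, Halfspace.compl_compl']))
    refine ht.2.1 fun v hv hvb => ?_
    exact this.1 (by rwa [Halfspace.compl_compl']) hv
  · exact hab (hr.eq_of_rel h ha hac)

end IsFacingCongr

end Region

end Pocset

/-! ### The order of the quotient -/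

namespace Pocset

open CubeComplex

variable {V : Type*} {X : CubeComplex V}

section Order

variable {r : Congr X.Halfspace} {pos : X.Halfspace → Prop}

/-- The vertices `u` and `w` are not separated by a hyperplane in one of the classes `x`, `y`. -/
def SameCell (r : Congr X.Halfspace) (x y : r.Quot) (u w : V) : Prop :=
  ∀ c : X.Halfspace, r.proj c = x ∨ r.proj c = y → (u ∈ c.1 ↔ w ∈ c.1)

theorem SameCell.symm {x y : r.Quot} {u w : V} (h : SameCell r x y u w) : SameCell r x y w u :=
  fun c hc => (h c hc).symm

theorem SameCell.trans {x y : r.Quot} {u v w : V} (h : SameCell r x y u v)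
    (h' : SameCell r x y v w) : SameCell r x y u w := fun c hc => (h c hc).trans (h' c hc)

theorem SameCell.mem_left {x y : r.Quot} {u w : V} (h : SameCell r x y u w) :
    u ∈ region r pos x ↔ w ∈ region r pos x := region_congr fun c hc => h c (Or.inl hc)

theorem SameCell.mem_right {x y : r.Quot} {u w : V} (h : SameCell r x y u w) :
    u ∈ region r pos y ↔ w ∈ region r pos y := region_congr fun c hc => h c (Or.inr hc)

/-- The cell of `u` is adjacent to a hyperplane of the class `z`. -/
def Touches (r : Congr X.Halfspace) (x y z : r.Quot) (u : V) : Prop :=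
  ∃ p q, ∃ a : X.Halfspace, X.graph.Adj p q ∧ r.proj a = z ∧ (p ∈ a.1 ↔ q ∉ a.1) ∧
    SameCell r x y u q

theorem SameHyp.mem_iff_mem {a b : X.Halfspace} (h : SameHyp a b) {u w : V}
    (hb : u ∈ b.1 ↔ w ∈ b.1) : u ∈ a.1 ↔ w ∈ a.1 := by
  rcases h with rfl | rfl
  · exact hb
  · rw [Halfspace.mem_compl, Halfspace.mem_compl, hb]

theorem sameHyp_of_edge (hX : X.IsCAT0) {u v : V} (huv : X.graph.Adj u v) {a b : X.Halfspace}
    (ha : u ∈ a.1 ↔ v ∉ a.1) (hb : u ∈ b.1 ↔ v ∉ b.1) : SameHyp a b := by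
  by_cases hua : u ∈ a.1 <;> by_cases hub : u ∈ b.1
  · exact Or.inl (Halfspace.eq_of_edge hX huv hua (ha.1 hua) hub (hb.1 hub))
  · refine Or.inr (Halfspace.eq_of_edge hX huv hua (ha.1 hua) hub ?_)
    exact fun h => h (by tauto)
  · refine Or.inr (Halfspace.eq_of_edge hX huv.symm (by tauto) hua ?_ ?_)
    · exact hb.1 hub
    · exact fun h => h hub
  · exact Or.inl (Halfspace.eq_of_edge hX huv.symm (by tauto) hua (by tauto) hub)

/-- If a cell touches hyperplanes of both classes `x < y`, then these hyperplanes are inseparable.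
Since they are then ordered in the same way as the classes, the cell lies outside of `x` and inside
of `y`. -/
theorem mem_of_touches (hX : X.IsCAT0) (hr : IsFacingCongr r pos) {x y : r.Quot}
    (hlt : r.QLt x y) {u : V} (hx : Touches r x y x u) (hy : Touches r x y y u) :
    u ∉ region r pos x ∧ u ∈ region r pos y := by
  obtain ⟨p, q, a, hpq, rfl, hpa, huq⟩ := hx
  obtain ⟨s, t, b, hst, rfl, hsb, hut⟩ := hy
  have hqt : SameCell r (r.proj a) (r.proj b) q t := huq.symm.trans hut
  obtain ⟨hdis, hins⟩ := hlt a b rfl rfl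
  have hab : Lt a b := by
    refine hins ⟨hdis.1, ?_⟩
    rintro c hc ⟨a', c', b', ha', hc', hb', h1, h2⟩
    have hpa' : p ∈ a'.1 ↔ q ∉ a'.1 := by
      rcases ha' with rfl | rfl
      · exact hpa
      · rw [Halfspace.mem_compl, Halfspace.mem_compl]; tauto
    have hsb' : s ∈ b'.1 ↔ t ∉ b'.1 := by
      rcases hb' with rfl | rfl
      · exact hsb
      · rw [Halfspace.mem_compl, Halfspace.mem_compl]; tauto
    have hqc : q ∈ c'.1 := by
      by_contra hq
      have hp : p ∈ a'.1 := hpa'.2 fun h => hq (h1.1 h)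
      exact h1.2 (Halfspace.eq_of_edge hX hpq hp (fun h => hq (h1.1 h)) (h1.1 hp) hq)
    have htc : t ∉ c'.1 := by
      intro ht
      have hs : s ∉ b'.1 := fun h => hsb'.1 h (h2.1 ht)
      exact h2.2 (Halfspace.eq_of_edge hX hst.symm ht (fun h => hs (h2.1 h)) (h2.1 ht) hs)
    exact htc ((hc'.mem_iff_mem (hqt c hc)).1 hqc)
  have hqa : q ∉ a.1 := by
    intro hq
    have hqb := hab.1 hq
    have htb := (hqt b (Or.inr rfl)).1 hqb
    have hta := (hqt a (Or.inl rfl)).1 hq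
    have hsb' : s ∉ b.1 := fun h => hsb.1 h htb
    exact hab.2 (Halfspace.eq_of_edge hX hst.symm hta (fun h => hsb' (hab.1 h)) htb hsb')
  have hp : p ∈ a.1 := hpa.2 hqa
  have hqb : q ∈ b.1 := by
    by_contra hq
    exact hab.2 (Halfspace.eq_of_edge hX hpq hp hqa (hab.1 hp) hq)
  have htb := (hqt b (Or.inr rfl)).1 hqb
  have hsb' : s ∉ b.1 := fun h => hsb.1 h htb
  rw [huq.mem_left (pos := pos), hut.mem_right (pos := pos)]
  exact ⟨((hr.edge_iff hX hpq).2 ⟨a, rfl, hp, hqa⟩).2,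
    ((hr.edge_iff hX hst.symm).2 ⟨b, rfl, htb, hsb'⟩).1⟩

theorem Touches.congr {x y z : r.Quot} {u w : V} (h : Touches r x y z w)
    (hs : SameCell r x y u w) : Touches r x y z u := by
  obtain ⟨p, q, a, h1, h2, h3, h4⟩ := h
  exact ⟨p, q, a, h1, h2, h3, hs.trans h4⟩

theorem sameCell_or_exists (x y : r.Quot) (u w : V) : SameCell r x y u w ∨
    ∃ c : X.Halfspace, (r.proj c = x ∨ r.proj c = y) ∧ (u ∈ c.1 ↔ w ∉ c.1) := by
  by_cases h : SameCell r x y u w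
  · exact Or.inl h
  · right
    unfold SameCell at h
    push Not at h
    obtain ⟨c, hc, h⟩ := h
    exact ⟨c, hc, by tauto⟩

theorem touches_or_touches (hX : X.IsCAT0) (x y : r.Quot) (u : V) :
    Touches r x y x u ∨ Touches r x y y u := by
  obtain ⟨a, ha⟩ := r.exists_proj x
  obtain ⟨p, q, hpq, hp, hq⟩ := a.exists_edge hX
  obtain ⟨w⟩ := hX.connected.preconnected u q
  induction w with
  | nil => exact Or.inl ⟨p, _, a, hpq, ha, ⟨fun _ => hq, fun _ => hp⟩, fun _ _ => Iff.rfl⟩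
  | @cons u w _ huw _ ih =>
    rcases sameCell_or_exists x y u w with h | ⟨c, hc | hc, h⟩
    · exact (ih hpq hq).imp (fun h' => h'.congr h) fun h' => h'.congr h
    · exact Or.inl ⟨w, u, c, huw.symm, hc, by tauto, fun _ _ => Iff.rfl⟩
    · exact Or.inr ⟨w, u, c, huw.symm, hc, by tauto, fun _ _ => Iff.rfl⟩

/-- An edge that crosses a hyperplane joins the region of its class to the complement of this
region. -/
theorem IsFacingCongr.mem_region_of_edge (hX : X.IsCAT0) (hr : IsFacingCongr r pos) {u w : V}
    (huw : X.graph.Adj u w) {c : X.Halfspace} (hc : u ∈ c.1 ↔ w ∉ c.1) :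
    u ∈ region r pos (r.proj c) ↔ w ∉ region r pos (r.proj c) := by
  by_cases hu : u ∈ c.1
  · have := (hr.edge_iff hX huw).2 ⟨c, rfl, hu, hc.1 hu⟩
    exact ⟨fun _ => this.2, fun _ => this.1⟩
  · have := (hr.edge_iff hX huw.symm).2 ⟨c, rfl, by tauto, hu⟩
    exact ⟨fun h => absurd h this.2, fun h => absurd this.1 h⟩

theorem region_subset_of_qLt (hX : X.IsCAT0) (hr : IsFacingCongr r pos) {x y : r.Quot}
    (hlt : r.QLt x y) : region r pos x ⊆ region r pos y := by
  intro u hux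
  by_contra huy
  -- By `mem_of_touches`, a path can neither enter `y` from a cell outside of `y` that touches the
  -- class `x`, nor leave `x` from a cell inside of `x` that touches the class `y`.
  rcases touches_or_touches hX x y u with ht | ht
  · obtain ⟨v, -, -, hv, -⟩ := hr.exists_edge hX y
    obtain ⟨w⟩ := hX.connected.preconnected u v
    clear hux
    induction w with
    | nil => exact huy hv
    | @cons u w _ huw _ ih =>
      rcases sameCell_or_exists x y u w with h | ⟨c, hc | hc, h⟩
      · exact ih (fun hw => huy (h.mem_right.2 hw)) (ht.congr h.symm) hv
      · refine ih (fun hw => ?_) ⟨u, w, c, huw, hc, h, fun _ _ => Iff.rfl⟩ hv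
        obtain ⟨d, hd, hwd, hud⟩ := (hr.edge_iff hX huw.symm).1 ⟨hw, huy⟩
        exact huy (mem_of_touches hX hr hlt ht
          ⟨w, u, d, huw.symm, hd, by tauto, fun _ _ => Iff.rfl⟩).2
      · exact huy (mem_of_touches hX hr hlt ht
          ⟨w, u, c, huw.symm, hc, by tauto, fun _ _ => Iff.rfl⟩).2
  · obtain ⟨-, v, -, -, hv⟩ := hr.exists_edge hX x
    obtain ⟨w⟩ := hX.connected.preconnected u v
    clear huy
    induction w with
    | nil => exact hv hux
    | @cons u w _ huw _ ih =>
      rcases sameCell_or_exists x y u w with h | ⟨c, hc | hc, h⟩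
      · exact ih (h.mem_left.1 hux) (ht.congr h.symm) hv
      · exact (mem_of_touches hX hr hlt
          ⟨w, u, c, huw.symm, hc, by tauto, fun _ _ => Iff.rfl⟩ ht).1 hux
      · refine ih ?_ ⟨u, w, c, huw, hc, h, fun _ _ => Iff.rfl⟩ hv
        by_contra hw
        obtain ⟨d, hd, hud, hwd⟩ := (hr.edge_iff hX huw).1 ⟨hux, hw⟩
        exact (mem_of_touches hX hr hlt
          ⟨w, u, d, huw.symm, hd, by tauto, fun _ _ => Iff.rfl⟩ ht).1 hux

/-- Halfspaces that bound the convex part of the region of `a`: the whole class of `a` if `a` is not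
the complement of a positive halfspace, and `a` itself otherwise. -/
def core (r : Congr X.Halfspace) (pos : X.Halfspace → Prop) (a : X.Halfspace) :
    Set X.Halfspace := {k | k = a ∨ (r.r a k ∧ ¬ pos aᶜ)}

theorem IsFacingCongr.facing_of_mem_core (hr : IsFacingCongr r pos) {a k l : X.Halfspace}
    (hk : k ∈ core r pos a) (hl : l ∈ core r pos a) (hne : k ≠ l) : Facing k l := by
  have key : ∀ {k l : X.Halfspace}, r.r a k → r.r a l → ¬ pos aᶜ → k ≠ l → Facing k l := by
    intro k l hk hl ha hne
    by_cases hpa : pos a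
    · exact hr.facing (r.iseqv.trans (r.iseqv.symm hk) hl) (hr.pos_of_rel hk hpa) hne
    · exact absurd ((hr.eq_of_rel hk hpa ha).symm.trans (hr.eq_of_rel hl hpa ha)) hne
  rcases hk with rfl | ⟨hk, ha⟩ <;> rcases hl with rfl | ⟨hl, ha'⟩
  · exact absurd rfl hne
  · exact key (r.iseqv.refl _) hl ha' hne
  · exact key hk (r.iseqv.refl _) ha hne
  · exact key hk hl ha hne

theorem IsFacingCongr.mem_region_of_core (hr : IsFacingCongr r pos) {a : X.Halfspace} {v : V}
    (h : ∀ k ∈ core r pos a, v ∈ k.1) : v ∈ region r pos (r.proj a) := by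
  by_cases ha : pos aᶜ
  · exact (hr.mem_region_of_pos ha).2 ⟨a, r.iseqv.refl _, h a (Or.inl rfl)⟩
  · exact (hr.mem_region_of_not_pos ha).2 fun b hb => h b (Or.inr ⟨hb, ha⟩)

theorem IsFacingCongr.core_subsingleton (hr : IsFacingCongr r pos) (a : X.Halfspace) (v : V) :
    {k ∈ core r pos a | v ∉ k.1}.Subsingleton := by
  rintro k ⟨hk, hvk⟩ l ⟨hl, hvl⟩
  by_contra hne
  exact hvk ((hr.facing_of_mem_core hk hl hne).mem_of_notMem hvl)

/-- If two halfspaces are transverse, then the regions of their classes intersect. -/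
theorem IsFacingCongr.exists_mem_of_transverse (hX : X.IsCAT0) (hr : IsFacingCongr r pos)
    {a b : X.Halfspace} (h : Transverse a b) :
    ∃ v, v ∈ region r pos (r.proj a) ∧ v ∈ region r pos (r.proj b) := by
  have hcross : ∀ k ∈ core r pos a, ∀ l ∈ core r pos b, ∃ v, v ∈ k.1 ∧ v ∈ l.1 := by
    intro k hk l hl
    have hk' : a ≤ k ∨ aᶜ ≤ k := by
      by_cases hka : k = a
      · exact Or.inl (hka ▸ fun _ h => h)
      · exact Or.inr (hr.facing_of_mem_core hk (Or.inl rfl) hka).1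
    have hl' : b ≤ l ∨ bᶜ ≤ l := by
      by_cases hlb : l = b
      · exact Or.inl (hlb ▸ fun _ h => h)
      · exact Or.inr (hr.facing_of_mem_core hl (Or.inl rfl) hlb).1
    obtain ⟨h1, h2, h3, h4⟩ := h
    simp only [Halfspace.le_def, Set.not_subset] at h1 h2 h3 h4
    obtain ⟨v₁, h11, h12⟩ := h1
    obtain ⟨v₂, h21, h22⟩ := h2
    obtain ⟨v₃, h31, h32⟩ := h3
    obtain ⟨v₄, h41, h42⟩ := h4
    rw [Halfspace.mem_compl, not_not] at h22 h42
    rcases hk' with hk' | hk' <;> rcases hl' with hl' | hl'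
    · exact ⟨v₂, hk' h21, hl' h22⟩
    · exact ⟨v₁, hk' h11, hl' h12⟩
    · exact ⟨v₄, hk' h41, hl' h42⟩
    · exact ⟨v₃, hk' h31, hl' h32⟩
  have hself : ∀ c : X.Halfspace, ∀ k ∈ core r pos c, ∀ l ∈ core r pos c,
      ∃ v, v ∈ k.1 ∧ v ∈ l.1 := by
    intro c k hk l hl
    by_cases hkl : k = l
    · obtain ⟨v, hv⟩ := k.nonempty hX
      exact ⟨v, hv, hkl ▸ hv⟩
    · exact (hr.facing_of_mem_core hk hl hkl).exists_mem
  obtain ⟨v₀, -⟩ := a.nonempty hX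
  obtain ⟨v, hv⟩ := Halfspace.exists_mem_of_pairwise hX (core r pos a ∪ core r pos b) (by
    rintro k (hk | hk) l (hl | hl)
    · exact hself a k hk l hl
    · exact hcross k hk l hl
    · obtain ⟨v, h1, h2⟩ := hcross l hl k hk
      exact ⟨v, h2, h1⟩
    · exact hself b k hk l hl) v₀ (by
    refine ((hr.core_subsingleton a v₀).finite.union (hr.core_subsingleton b v₀).finite).subset ?_
    rintro k ⟨hk | hk, hv⟩
    · exact Or.inl ⟨hk, hv⟩
    · exact Or.inr ⟨hk, hv⟩)
  exact ⟨v, hr.mem_region_of_core fun k hk => hv k (Or.inl hk),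
    hr.mem_region_of_core fun k hk => hv k (Or.inr hk)⟩

end Order

end Pocset

namespace Pocset

open CubeComplex

variable {V : Type*} {X : CubeComplex V}

section Order

variable {r : Congr X.Halfspace} {pos : X.Halfspace → Prop}

theorem Transverse.symm {a b : X.Halfspace} (h : Transverse a b) : Transverse b a := by
  obtain ⟨h1, h2, h3, h4⟩ := h
  have hle : ∀ {c d : X.Halfspace}, cᶜ ≤ dᶜ → d ≤ c := fun h => Set.compl_subset_compl.1 h
  have hle' : ∀ {c d : X.Halfspace}, c ≤ dᶜ → d ≤ cᶜ := fun h v hv hc => h hc hv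
  have hle'' : ∀ {c d : X.Halfspace}, cᶜ ≤ d → dᶜ ≤ c := by
    intro c d h v hv
    by_contra hc
    exact hv (h hc)
  exact ⟨fun h => h4 (fun v hv hb => hv (h hb)), fun h => h2 (hle' h), fun h => h3 (hle'' h),
    fun h => h1 (hle h)⟩

theorem Transverse.compl_right {a b : X.Halfspace} (h : Transverse a b) : Transverse a bᶜ := by
  obtain ⟨h1, h2, h3, h4⟩ := h
  refine ⟨h2, ?_, h4, ?_⟩ <;> rwa [Halfspace.compl_compl']

theorem transverse_of_sameHyp {a a' b b' : X.Halfspace} (ha : SameHyp a' a) (hb : SameHyp b' b)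
    (h : Transverse a' b') : Transverse a b := by
  rcases ha with rfl | rfl <;> rcases hb with rfl | rfl
  · exact h
  · have := h.compl_right
    rwa [Halfspace.compl_compl'] at this
  · have := h.symm.compl_right.symm
    rwa [Halfspace.compl_compl'] at this
  · have := h.symm.compl_right.symm.compl_right
    rwa [Halfspace.compl_compl', Halfspace.compl_compl'] at this

/-- Let `a` and `b` be disjoint halfspaces, and let `pq` and `st` be edges that leave them. If the
hyperplanes in `C` neither cross nor separate those of `a` and `b`, then they do not separate `q`
from `t`. -/
theorem sameCell_of_inseparable (hX : X.IsCAT0) {a b : X.Halfspace} {C : Set X.Halfspace}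
    (hdis : a ≤ bᶜ) (hne : ¬ SameHyp a b)
    (hta : ∀ c ∈ C, ¬ Transverse a c) (htb : ∀ c ∈ C, ¬ Transverse b c)
    (hins : ∀ c ∈ C, ¬ Separates c a b)
    {p q s t : V} (hpq : X.graph.Adj p q) (hp : p ∈ a.1) (hq : q ∉ a.1) (hst : X.graph.Adj s t)
    (hs : s ∈ b.1) (ht : t ∉ b.1) {c : X.Halfspace} (hc : c ∈ C) : q ∈ c.1 ↔ t ∈ c.1 := by
  have hpb : p ∉ b.1 := hdis hp
  have hsa : s ∉ a.1 := fun h => hdis h hs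
  have hta' : t ∉ a.1 := fun h => hne (Or.inr
    (Halfspace.eq_of_edge hX hst.symm h hsa ht (fun h => h hs)))
  have hqb : q ∉ b.1 := fun h => hne (Or.inr (Halfspace.eq_of_edge hX hpq hp hq hpb fun h' => h' h))
  have key : ∀ c', SameHyp c' c → q ∈ c'.1 → t ∉ c'.1 → False := by
    intro c' hc' hqc htc
    have hac : ¬ Transverse a c' := fun h => hta c hc (transverse_of_sameHyp (Or.inl rfl) hc' h)
    have hbc : ¬ Transverse b c' := fun h => htb c hc (transverse_of_sameHyp (Or.inl rfl) hc' h)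
    have hpc : p ∈ c'.1 := by
      by_contra hpc
      have := Halfspace.eq_of_edge hX hpq.symm hqc hpc (k := aᶜ) hq (fun h => h hp)
      exact htc (this ▸ hta')
    have hsc : s ∉ c'.1 := by
      intro hsc
      have := Halfspace.eq_of_edge hX hst hsc htc hs ht
      exact hqb (this ▸ hqc)
    have h1 : a ≤ c' := by
      by_contra h1
      refine hac ⟨h1, fun h => h hp hpc, fun h => htc (h hta'), fun h => ?_⟩
      exact h hq hqc
    have h2 : c' ≤ bᶜ := by
      by_contra h2
      refine hbc ⟨fun h => hsc (h hs), fun h => h2 fun v hv hvb => h hvb hv,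
        fun h => htc (h ht), fun h => h hqb hqc⟩
    refine hins c hc ⟨a, c', bᶜ, Or.inl rfl, hc', Or.inr rfl, ⟨h1, fun h => hq (h ▸ hqc)⟩,
      h2, fun h => htc (h ▸ ht)⟩
  by_cases h1 : q ∈ c.1 <;> by_cases h2 : t ∈ c.1
  · exact ⟨fun _ => h2, fun _ => h1⟩
  · exact (key c (Or.inl rfl) h1 h2).elim
  · exact (key cᶜ (Or.inr rfl) h1 (fun h => h h2)).elim
  · exact ⟨fun h => absurd h h1, fun h => absurd h h2⟩

theorem qLt_of_region_subset (hX : X.IsCAT0) (hr : IsFacingCongr r pos) {x y : r.Quot}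
    (h : region r pos x ⊆ region r pos y) (hne : x ≠ y) : r.QLt x y := by
  have hhyp : ∀ a b, r.proj a = x → r.proj b = y → ¬ SameHyp a b := by
    rintro a b rfl rfl (rfl | rfl)
    · exact hne rfl
    · rw [r.proj_compl, hr.region_compl] at h
      obtain ⟨u, v, -, -, hv⟩ := hr.exists_edge hX (r.proj b)
      exact hv (h hv)
  have htrans : ∀ a b, r.proj a = x → r.proj b = y → ¬ Transverse a b := by
    rintro a b rfl rfl ht
    obtain ⟨v, hv, hv'⟩ := hr.exists_mem_of_transverse hX ht.compl_right
    rw [r.proj_compl, hr.region_compl] at hv'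
    exact hv' (h hv)
  rintro a b rfl rfl
  refine ⟨⟨hhyp a b rfl rfl, htrans a b rfl rfl⟩, fun hins => ?_⟩
  have hta : ∀ c ∈ {c | r.proj c = r.proj a ∨ r.proj c = r.proj b}, ¬ Transverse a c := by
    rintro c (hc | hc)
    · exact hr.not_transverse (r.proj_eq_iff.1 hc.symm)
    · exact htrans a c rfl hc
  have htb : ∀ c ∈ {c | r.proj c = r.proj a ∨ r.proj c = r.proj b}, ¬ Transverse b c := by
    rintro c (hc | hc)
    · exact fun h => htrans c b hc rfl h.symm
    · exact hr.not_transverse (r.proj_eq_iff.1 hc.symm)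
  -- Let the hyperplanes of `a` and `b` bound disjoint halfspaces `a'`, `b'`. Edges leaving them end
  -- in a common cell, and the inclusion of the regions excludes three of the four orientations.
  have key : ∀ a' b' : X.Halfspace, SameHyp a' a → SameHyp b' b → a' ≤ b'ᶜ → a' = a ∧ b' = bᶜ := by
    intro a' b' ha' hb' hdis
    obtain ⟨p, q, hpq, hp, hq⟩ := a'.exists_edge hX
    obtain ⟨s, t, hst, hs, ht⟩ := b'.exists_edge hX
    have hpa : p ∈ a.1 ↔ q ∉ a.1 := by
      rcases ha' with rfl | rfl
      · exact ⟨fun _ => hq, fun _ => hp⟩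
      · exact ⟨fun h => absurd h hp, fun h => absurd h hq⟩
    have hsb : s ∈ b.1 ↔ t ∉ b.1 := by
      rcases hb' with rfl | rfl
      · exact ⟨fun _ => ht, fun _ => hs⟩
      · exact ⟨fun h => absurd h hs, fun h => absurd h ht⟩
    have hcell : SameCell r (r.proj a) (r.proj b) q t := by
      intro c hc
      refine sameCell_of_inseparable hX hdis
        (fun h => hhyp a b rfl rfl (ha'.symm.trans (h.trans hb')))
        (fun c hc h => hta c hc (transverse_of_sameHyp ha' (Or.inl rfl) h))
        (fun c hc h => htb c hc (transverse_of_sameHyp hb' (Or.inl rfl) h))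
        ?_ hpq hp hq hst hs ht hc
      rintro c hc ⟨a'', c', b'', h1, h2, h3, h4, h5⟩
      exact hins.2 c hc ⟨a'', c', b'', h1.trans ha', h2, h3.trans hb', h4, h5⟩
    have e1 := hr.mem_region_of_edge hX hpq hpa
    have e2 := hr.mem_region_of_edge hX hst hsb
    have c1 := hcell.mem_left (pos := pos)
    have c2 := hcell.mem_right (pos := pos)
    have e3 : p ∈ region r pos (r.proj b) ↔ q ∈ region r pos (r.proj b) := by
      by_contra hcon
      have : ∃ c, r.proj c = r.proj b ∧ (p ∈ c.1 ↔ q ∉ c.1) := by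
        by_cases hpb : p ∈ region r pos (r.proj b)
        · obtain ⟨c, hc, h1, h2⟩ := (hr.edge_iff hX hpq).1 ⟨hpb, fun h => hcon
            ⟨fun _ => h, fun _ => hpb⟩⟩
          exact ⟨c, hc, fun _ => h2, fun _ => h1⟩
        · obtain ⟨c, hc, h1, h2⟩ := (hr.edge_iff hX hpq.symm).1 ⟨by_contra fun h => hcon
            ⟨fun h' => absurd h' hpb, fun h' => absurd h' h⟩, hpb⟩
          exact ⟨c, hc, fun h => absurd h h2, fun h => absurd h1 h⟩
      obtain ⟨c, hc, hpc⟩ := this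
      exact hhyp a c rfl hc (sameHyp_of_edge hX hpq hpa hpc)
    have e4 : s ∈ region r pos (r.proj a) ↔ t ∈ region r pos (r.proj a) := by
      by_contra hcon
      have : ∃ c, r.proj c = r.proj a ∧ (s ∈ c.1 ↔ t ∉ c.1) := by
        by_cases hsa : s ∈ region r pos (r.proj a)
        · obtain ⟨c, hc, h1, h2⟩ := (hr.edge_iff hX hst).1 ⟨hsa, fun h => hcon
            ⟨fun _ => h, fun _ => hsa⟩⟩
          exact ⟨c, hc, fun _ => h2, fun _ => h1⟩
        · obtain ⟨c, hc, h1, h2⟩ := (hr.edge_iff hX hst.symm).1 ⟨by_contra fun h => hcon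
            ⟨fun h' => absurd h' hsa, fun h' => absurd h' h⟩, hsa⟩
          exact ⟨c, hc, fun h => absurd h h2, fun h => absurd h1 h⟩
      obtain ⟨c, hc, hsc⟩ := this
      exact hhyp c b hc rfl (sameHyp_of_edge hX hst hsc hsb)
    have hqx : q ∉ region r pos (r.proj a) := fun hq' =>
      e2.1 (h (e4.2 (c1.1 hq'))) (h (c1.1 hq'))
    have hty : t ∈ region r pos (r.proj b) := c2.1 (e3.1 (h (e1.2 hqx)))
    constructor
    · rcases ha' with rfl | rfl
      · rfl
      · exact absurd ((hr.edge_iff hX hpq.symm).2 ⟨a, rfl, by_contra hq, hp⟩).1 hqx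
    · rcases hb' with rfl | rfl
      · exact absurd hty ((hr.edge_iff hX hst).2 ⟨b', rfl, hs, ht⟩).2
      · rfl
  obtain ⟨a', b', ha', hb', hle⟩ : ∃ a' b', SameHyp a' a ∧ SameHyp b' b ∧ a' ≤ b'ᶜ := by
    have := htrans a b rfl rfl
    unfold Transverse at this
    by_contra hcon
    push Not at hcon
    refine this ⟨?_, ?_, ?_, ?_⟩
    · have := hcon a bᶜ (Or.inl rfl) (Or.inr rfl)
      rwa [Halfspace.compl_compl'] at this
    · exact hcon a b (Or.inl rfl) (Or.inl rfl)
    · have := hcon aᶜ bᶜ (Or.inr rfl) (Or.inr rfl)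
      rwa [Halfspace.compl_compl'] at this
    · exact hcon aᶜ b (Or.inr rfl) (Or.inl rfl)
  obtain ⟨rfl, rfl⟩ := key a' b' ha' hb' hle
  rw [Halfspace.compl_compl'] at hle
  exact ⟨hle, fun h => hne (congrArg r.proj h)⟩

/-- The order of the quotient is the inclusion of regions. -/
theorem le_iff_region_subset (hX : X.IsCAT0) (hr : IsFacingCongr r pos) {x y : r.Quot} :
    x ≤ y ↔ region r pos x ⊆ region r pos y := by
  constructor
  · rintro (rfl | h)
    · exact subset_rfl
    · exact region_subset_of_qLt hX hr h
  · intro h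
    by_cases hne : x = y
    · exact Or.inl hne
    · exact Or.inr (qLt_of_region_subset hX hr h hne)

theorem isPocset_quot (hX : X.IsCAT0) (hr : IsFacingCongr r pos) : IsPocset r.Quot where
  le_refl _ := Or.inl rfl
  le_trans a b c h h' := by
    rw [le_iff_region_subset hX hr] at *
    exact h.trans h'
  le_antisymm a b h h' := by
    rw [le_iff_region_subset hX hr] at *
    exact hr.region_injective hX (h.antisymm h')
  compl_le_compl a b h := by
    rw [le_iff_region_subset hX hr] at *
    rw [hr.region_compl, hr.region_compl]
    exact Set.compl_subset_compl.2 h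
  not_le_compl a h := by
    rw [le_iff_region_subset hX hr, hr.region_compl] at h
    obtain ⟨u, -, -, hu, -⟩ := hr.exists_edge hX a
    exact h hu hu
  not_compl_le a h := by
    rw [le_iff_region_subset hX hr, hr.region_compl] at h
    obtain ⟨-, v, -, -, hv⟩ := hr.exists_edge hX a
    exact hv (h hv)

/-- The vertex of the dual complex of the quotient determined by a vertex of `X`. -/
def toDual (hX : X.IsCAT0) (hr : IsFacingCongr r pos) (v : V) : DualVertex r.Quot where
  carrier := {x | v ∈ region r pos x}
  compl_mem_iff x := by
    change v ∈ region r pos xᶜ ↔ v ∉ region r pos x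
    rw [hr.region_compl]
    rfl
  mem_of_le x y hx hxy := (le_iff_region_subset hX hr).1 hxy hx
  dcc := by
    rintro ⟨s, hs, hlt⟩
    obtain ⟨-, u, -, -, hu⟩ := hr.exists_edge hX (s 0)
    have hsub : ∀ n, s n ≤ s 0 := by
      intro n
      induction n with
      | zero => exact Or.inl rfl
      | succ n ih => exact (isPocset_quot hX hr).le_trans _ _ _ (hlt n).1 ih
    have hinj : Function.Injective s := by
      have := fun {m n : ℕ} => lt_of_strictAnti (isPocset_quot hX hr) hlt (m := m) (n := n)
      intro m n hmn
      rcases lt_trichotomy m n with h | h | h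
      · exact ((this h).2 hmn.symm).elim
      · exact h
      · exact ((this h).2 hmn).elim
    refine Set.infinite_range_of_injective hinj ((hr.finite_separating hX v u).subset ?_)
    rintro _ ⟨n, rfl⟩
    exact ⟨hs n, fun h => hu ((le_iff_region_subset hX hr).1 (hsub n) h)⟩

theorem mem_toDual {hX : X.IsCAT0} {hr : IsFacingCongr r pos} {v : V} {x : r.Quot} :
    x ∈ (toDual hX hr v).carrier ↔ v ∈ region r pos x := Iff.rfl

theorem edist_toDual_le (hX : X.IsCAT0) (hr : IsFacingCongr r pos) (u v : V) :
    (dualComplex r.Quot).graph.edist (toDual hX hr u) (toDual hX hr v) ≤ X.graph.edist u v := by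
  obtain ⟨p, hp⟩ := hX.connected.exists_walk_length_eq_edist u v
  rw [← hp]
  clear hp
  induction p with
  | nil => simp
  | @cons u w v huw p ih =>
    have h1 : (dualComplex r.Quot).graph.edist (toDual hX hr u) (toDual hX hr w) ≤ 1 := by
      by_cases hx : ∃ x, ¬ (u ∈ region r pos x ↔ w ∈ region r pos x)
      · obtain ⟨x, hx⟩ : ∃ x, u ∈ region r pos x ∧ w ∉ region r pos x := by
          obtain ⟨x, hx⟩ := hx
          by_cases hu : u ∈ region r pos x
          · exact ⟨x, hu, fun h => hx ⟨fun _ => h, fun _ => hu⟩⟩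
          · refine ⟨xᶜ, ?_, ?_⟩
            · rwa [hr.region_compl]
            · rw [hr.region_compl]
              exact fun h => hx ⟨fun h' => absurd h' hu, fun h' => absurd h' h⟩
        refine edist_le_one (x := x) fun c hc => ?_
        rw [mem_toDual, mem_toDual]
        by_contra hcon
        by_cases hu : u ∈ region r pos c
        · exact hc (Or.inl (hr.eq_of_edge hX huw ⟨hu, fun h => hcon
            ⟨fun _ => hu, fun _ => h⟩⟩ hx))
        · refine hc (Or.inr ?_)
          have hw : w ∈ region r pos c := by_contra fun h => hcon
            ⟨fun h' => absurd h' h, fun h' => absurd h' hu⟩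
          refine hr.eq_of_edge hX huw.symm ⟨hw, hu⟩ ?_
          rw [hr.region_compl]
          exact ⟨hx.2, fun h => h hx.1⟩
      · push Not at hx
        rw [show toDual hX hr u = toDual hX hr w from DualVertex.ext' hx]
        simp
    refine SimpleGraph.edist_triangle.trans ((add_le_add h1 ih).trans ?_)
    rw [SimpleGraph.Walk.length_cons, Nat.cast_succ, add_comm]

end Order

end Pocset

/-! ### Vertices of the dual complex are close to vertices of `X` -/

namespace Pocset

open CubeComplex

variable {V : Type*} {X : CubeComplex V}

section Close

variable {r : Congr X.Halfspace} {pos : X.Halfspace → Prop}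

/-- If two regions are nested unions of disjoint halfspaces, then every member of the smaller class
lies in a member of the larger class. -/
theorem exists_le_of_lt (hX : X.IsCAT0) (hr : IsFacingCongr r pos) {k l : X.Halfspace}
    (hk : pos kᶜ) (hl : pos lᶜ) (hlt : Lt (r.proj k) (r.proj l)) :
    ∃ l', r.proj l' = r.proj l ∧ k ≤ l' := by
  have hsub := (le_iff_region_subset hX hr).1 hlt.1
  have hq : r.QLt (r.proj k) (r.proj l) := hlt.1.resolve_left hlt.2
  obtain ⟨p, q, hpq, hp, hq'⟩ := k.exists_edge hX
  have hpk := ((hr.edge_iff hX hpq).2 ⟨k, rfl, hp, hq'⟩).1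
  obtain ⟨l', hl', hpl⟩ := (hr.mem_region_of_pos hl).1 (hsub hpk)
  have hproj : r.proj l' = r.proj l := r.proj_eq_iff.2 (r.iseqv.symm hl')
  refine ⟨l', hproj, ?_⟩
  obtain ⟨⟨h1, h2⟩, -⟩ := hq k l' rfl hproj
  by_contra hle
  refine h2 ⟨hle, fun h => h hp hpl, fun h => ?_, fun h => ?_⟩
  · -- `k` and `l'` cover everything, but both lie in the region of `l`.
    obtain ⟨u, w, huw, -, hw⟩ := hr.exists_edge hX (r.proj l)
    have hl'w : w ∉ l'.1 := fun h' => hw ((hr.mem_region_of_pos hl).2 ⟨l', hl', h'⟩)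
    have hwk : w ∈ k.1 := by_contra fun h' => hl'w (h h')
    exact hw (hsub ((hr.mem_region_of_pos hk).2 ⟨k, r.iseqv.refl _, hwk⟩))
  · have hql : q ∉ l'.1 := fun h' => h hq' h'
    exact h1 (Or.inl (Halfspace.eq_of_edge hX hpq hp hq' hpl hql))

/-- A chain of walls whose regions are unions of disjoint halfspaces lifts to a chain of halfspaces
with a prescribed smallest element. -/
theorem exists_lift_chain (hX : X.IsCAT0) (hr : IsFacingCongr r pos) {s : ℕ → r.Quot} {n : ℕ}
    (hs : ∀ i < n, Lt (s (i + 1)) (s i)) (hpos : ∀ i ≤ n, ∀ a, r.proj a = s i → pos aᶜ)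
    {k : X.Halfspace} (hk : r.proj k = s n) :
    ∃ c : ℕ → X.Halfspace, c n = k ∧ (∀ i ≤ n, r.proj (c i) = s i) ∧
      ∀ i ≤ n, k ≤ c i ∧ c i ≤ c 0 := by
  induction n generalizing k with
  | zero =>
    refine ⟨fun _ => k, rfl, fun i hi => ?_, fun i hi => ⟨fun _ h => h, fun _ h => h⟩⟩
    rwa [Nat.le_zero.1 hi]
  | succ n ih =>
    obtain ⟨l, hl⟩ := r.exists_proj (s n)
    obtain ⟨l', hl', hkl⟩ := exists_le_of_lt hX hr (hpos _ le_rfl k hk) (hpos n (by omega) l hl)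
      (by rw [hk, hl]; exact hs n n.lt_succ_self)
    obtain ⟨c, hcn, hc, hle⟩ := ih (fun i hi => hs i (by omega)) (fun i hi => hpos i (by omega))
      (hl'.trans hl)
    have hle' : ∀ i ≤ n, k ≤ c i := fun i hi => Set.Subset.trans hkl (hle i hi).1
    refine ⟨fun i => if i ≤ n then c i else k, by simp, fun i hi => ?_, fun i hi => ?_⟩
    · by_cases h : i ≤ n
      · simpa [h] using hc i h
      · obtain rfl : i = n + 1 := by omega
        simpa using hk
    · by_cases h : i ≤ n
      · simpa [h] using ⟨hle' i h, (hle i h).2⟩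
      · obtain rfl : i = n + 1 := by omega
        simpa using ⟨fun _ h => h, hle' 0 (Nat.zero_le n)⟩

/-- If the non-trivial classes of the congruence are generated by pairs of halfspaces with at most
`N` halfspaces in between, then a chain of more than `N` unions of disjoint halfspaces has a single
halfspace between its smallest and its largest member. -/
theorem exists_region_subset_of_chain (hX : X.IsCAT0) (hr : IsFacingCongr r pos)
    {E : X.Halfspace → X.Halfspace → Prop} (hEr : ∀ a b, E a b → r.r a b)
    (hE : ∀ a b, pos a → r.r a b → Relation.ReflTransGen E a b) {N : ℕ}
    (hN : ∀ a b, E a b → {c : X.Halfspace | aᶜ ≤ c ∧ c ≤ b}.ncard ≤ N) {s : ℕ → r.Quot}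
    (hs : ∀ i < N, Lt (s (i + 1)) (s i)) (hpos : ∀ i ≤ N, ∀ a, r.proj a = s i → pos aᶜ) :
    ∃ k : X.Halfspace, region r pos (s N) ⊆ k.1 ∧ k.1 ⊆ region r pos (s 0) := by
  have hQ := isPocset_quot hX hr
  have hlt : ∀ j ≤ N, ∀ i < j, Lt (s j) (s i) := by
    intro j hj
    induction j with
    | zero => exact fun i hi => absurd hi (Nat.not_lt_zero i)
    | succ j ih =>
      intro i hi
      rcases (Nat.lt_succ_iff_lt_or_eq.1 hi) with h | rfl
      · exact (hs j (by omega)).trans' hQ (ih (by omega) i h)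
      · exact hs i (by omega)
  obtain ⟨k, hk⟩ := r.exists_proj (s N)
  obtain ⟨c, -, hc, hle⟩ := exists_lift_chain hX hr hs hpos hk
  -- Two different members of the class `s 0` are disjoint.
  have hdisj : ∀ l l' : X.Halfspace, r.proj l = s 0 → r.proj l' = s 0 → l ≠ l' → l ≤ l'ᶜ := by
    intro l l' hl hl' hne v hv
    have hf := hr.facing (r.compl_rel (r.proj_eq_iff.1 (hl'.trans hl.symm)))
      (hpos 0 (Nat.zero_le N) l' hl') fun h => hne (by
        rw [← Halfspace.compl_compl' l, ← h, Halfspace.compl_compl'])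
    exact hf.mem_of_notMem (fun h => h hv)
  have key : ∀ b, Relation.ReflTransGen E kᶜ b → r.proj bᶜ = s N ∧ bᶜ ≤ c 0 := by
    intro b hb
    induction hb with
    | refl => rw [Halfspace.compl_compl']; exact ⟨hk, (hle 0 (Nat.zero_le N)).1⟩
    | @tail b b' _ hbb' ih =>
      obtain ⟨hbN, hbc⟩ := ih
      have hbN' : r.proj b'ᶜ = s N := by
        rw [← hbN]
        exact r.proj_eq_iff.2 (r.compl_rel (r.iseqv.symm (hEr _ _ hbb')))
      refine ⟨hbN', ?_⟩
      obtain ⟨d, -, hd, hdle⟩ := exists_lift_chain hX hr hs hpos hbN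
      obtain ⟨e, -, he, hele⟩ := exists_lift_chain hX hr hs hpos hbN'
      have hd0 : d 0 = c 0 := by
        by_contra hne
        obtain ⟨v, hv⟩ := (bᶜ).nonempty hX
        exact hdisj _ _ (hd 0 (Nat.zero_le N)) (hc 0 (Nat.zero_le N)) hne
          ((hdle 0 (Nat.zero_le N)).1 hv) (hbc hv)
      by_cases h0 : e 0 = c 0
      · exact h0 ▸ (hele 0 (Nat.zero_le N)).1
      -- Otherwise the whole chain over `bᶜ` lies between `bᶜ` and `b'`.
      exfalso
      have hmem : ∀ i ≤ N, d i ∈ {c : X.Halfspace | bᶜ ≤ c ∧ c ≤ b'} := by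
        intro i hi
        refine ⟨(hdle i hi).1, fun v hv => ?_⟩
        by_contra hvb
        exact hdisj _ _ (hc 0 (Nat.zero_le N)) (he 0 (Nat.zero_le N)) (Ne.symm h0)
          (hd0 ▸ (hdle i hi).2 hv) ((hele 0 (Nat.zero_le N)).1 hvb)
      have hinj : Set.InjOn d (Finset.range (N + 1)) := by
        intro i hi j hj hij
        simp only [Finset.coe_range, Set.mem_Iio] at hi hj
        have hsij : s i = s j := by rw [← hd i (by omega), ← hd j (by omega), hij]
        rcases lt_trichotomy i j with h | h | h
        · exact absurd hsij.symm (hlt j (by omega) i h).2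
        · exact h
        · exact absurd hsij (hlt i (by omega) j h).2
      have h1 := Set.ncard_le_ncard_of_injOn (s := (Finset.range (N + 1) : Set ℕ)) d
        (fun i hi => hmem i (by simpa [Nat.lt_succ_iff] using hi)) hinj
        (Halfspace.finite_between hX bᶜ b')
      rw [Set.ncard_coe_finset, Finset.card_range] at h1
      have := hN _ _ hbb'
      omega
  refine ⟨c 0, fun v hv => ?_, fun v hv => ?_⟩
  · rw [← hk] at hv
    obtain ⟨l, hl, hvl⟩ := (hr.mem_region_of_pos (hpos N le_rfl k hk)).1 hv
    have := (key lᶜ (hE _ _ (hpos N le_rfl k hk) (r.compl_rel hl))).2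
    rw [Halfspace.compl_compl'] at this
    exact this hvl
  · have h0 := hc 0 (Nat.zero_le N)
    rw [← h0]
    exact (hr.mem_region_of_pos (hpos 0 (Nat.zero_le N) _ h0)).2 ⟨_, r.iseqv.refl _, hv⟩

/-- The halfspaces that contain a region of a vertex `U` of the dual complex have a common vertex.
-/
theorem exists_mem_of_region_subset (hX : X.IsCAT0) (hr : IsFacingCongr r pos) {d : ℕ}
    (hd : ∀ C : Set (DualVertex r.Quot), IsDualCube C → C.ncard ≤ 2 ^ d) (U : DualVertex r.Quot) :
    ∃ v, ∀ k : X.Halfspace, (∃ y ∈ U.carrier, region r pos y ⊆ k.1) → v ∈ k.1 := by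
  obtain ⟨v₀⟩ := hX.connected.nonempty
  refine Halfspace.exists_mem_of_pairwise hX {k | ∃ y ∈ U.carrier, region r pos y ⊆ k.1} ?_ v₀ ?_
  · rintro h ⟨y, hy, hyh⟩ k ⟨z, hz, hzk⟩
    by_contra hcon
    push Not at hcon
    have hle : y ≤ zᶜ := by
      rw [le_iff_region_subset hX hr, hr.region_compl]
      exact fun v hv hv' => hcon v (hyh hv) (hzk hv')
    exact (U.compl_mem_iff z).1 (U.mem_of_le _ _ hy hle) hz
  · choose p q _ hp _ using fun y => hr.exists_edge hX y
    refine ((finite_diff (isPocset_quot hX hr) hd U (toDual hX hr v₀)).biUnion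
      fun y _ => Halfspace.finite_separating hX (p y) v₀).subset ?_
    rintro k ⟨⟨y, hy, hyk⟩, hk⟩
    exact Set.mem_biUnion (show y ∈ _ from ⟨hy, fun h => hk (hyk (mem_toDual.1 h))⟩)
      ⟨hyk (hp y), hk⟩

/-- Every vertex `U` of the dual complex is close to a vertex of `X`: take a common vertex of the
halfspaces that contain a region of `U`. The elements separating it from `U` form antichains of at
most `d` elements by finite dimensionality, and chains of at most `N` elements, since a longer chain
has a halfspace between two of its regions, and this halfspace contains the chosen vertex. -/
theorem exists_edist_toDual_le (hX : X.IsCAT0) (hr : IsFacingCongr r pos)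
    {E : X.Halfspace → X.Halfspace → Prop} (hEr : ∀ a b, E a b → r.r a b)
    (hE : ∀ a b, pos a → r.r a b → Relation.ReflTransGen E a b) {N : ℕ}
    (hN : ∀ a b, E a b → {c : X.Halfspace | aᶜ ≤ c ∧ c ≤ b}.ncard ≤ N) {d : ℕ}
    (hd : ∀ C : Set (DualVertex r.Quot), IsDualCube C → C.ncard ≤ 2 ^ d) (U : DualVertex r.Quot) :
    ∃ v, (dualComplex r.Quot).graph.edist U (toDual hX hr v) ≤ (N * d : ℕ) := by
  obtain ⟨v, hv⟩ := exists_mem_of_region_subset hX hr hd U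
  refine ⟨v, edist_le_mul (isPocset_quot hX hr) hd _ _ _ ?_⟩
  rintro ⟨s, hs, hlt⟩
  -- A class of pairwise facing halfspaces does not separate `U` from `v`.
  have hpos : ∀ i ≤ N, ∀ a, r.proj a = s i → pos aᶜ := by
    intro i hi a ha
    by_contra hcon
    refine (hs i hi).2 (mem_toDual.2 ?_)
    rw [← ha, hr.mem_region_of_not_pos hcon]
    intro b hb
    refine hv b ⟨s i, (hs i hi).1, fun w hw => ?_⟩
    rw [← ha, hr.mem_region_of_not_pos hcon] at hw
    exact hw b hb
  obtain ⟨k, hk, hk'⟩ := exists_region_subset_of_chain hX hr hEr hE hN hlt hpos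
  exact (hs 0 (Nat.zero_le N)).2 (mem_toDual.2 (hk' (hv k ⟨s N, (hs N le_rfl).1, hk⟩)))

end Close

end Pocset

/-! ### The congruence of an elementary fold -/

namespace Pocset

open CubeComplex

section FoldGraph

variable {P G : Type*} [Group G] [MulAction G P]

variable (G) in
/-- The members of the orbits of the folded elements. These are the elements that are identified
with others, in the orientation in which the folded pair faces. -/
def FoldPos (a b c : P) : Prop := ∃ g : G, c = g • a ∨ c = g • b

variable (G) in
/-- The translates of the folded pair, in both orders. -/
def FoldEdge (a b c d : P) : Prop := ∃ g : G, (c = g • a ∧ d = g • b) ∨ (c = g • b ∧ d = g • a)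

theorem FoldEdge.symm {a b c d : P} (h : FoldEdge G a b c d) : FoldEdge G a b d c := by
  obtain ⟨g, h | h⟩ := h
  · exact ⟨g, Or.inr h.symm⟩
  · exact ⟨g, Or.inl h.symm⟩

theorem FoldEdge.pos_left {a b c d : P} (h : FoldEdge G a b c d) : FoldPos G a b c := by
  obtain ⟨g, h | h⟩ := h
  · exact ⟨g, Or.inl h.1⟩
  · exact ⟨g, Or.inr h.1⟩

theorem FoldEdge.smul (g : G) {a b c d : P} (h : FoldEdge G a b c d) :
    FoldEdge G a b (g • c) (g • d) := by
  obtain ⟨g', ⟨rfl, rfl⟩ | ⟨rfl, rfl⟩⟩ := h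
  · exact ⟨g * g', Or.inl ⟨(mul_smul ..).symm, (mul_smul ..).symm⟩⟩
  · exact ⟨g * g', Or.inr ⟨(mul_smul ..).symm, (mul_smul ..).symm⟩⟩

theorem FoldPos.smul (g : G) {a b c : P} (h : FoldPos G a b c) : FoldPos G a b (g • c) := by
  obtain ⟨g', rfl | rfl⟩ := h
  · exact ⟨g * g', Or.inl (mul_smul ..).symm⟩
  · exact ⟨g * g', Or.inr (mul_smul ..).symm⟩

theorem eq_or_pos_of_reflTransGen {a b c d : P} (h : Relation.ReflTransGen (FoldEdge G a b) c d) :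
    c = d ∨ FoldPos G a b c ∧ FoldPos G a b d := by
  induction h with
  | refl => exact Or.inl rfl
  | tail _ h ih =>
    rcases ih with rfl | ih
    · exact Or.inr ⟨h.pos_left, h.symm.pos_left⟩
    · exact Or.inr ⟨ih.1, h.symm.pos_left⟩

variable [PrePocset P]

theorem FoldEdge.foldRel {a b c d : P} (h : FoldEdge G a b c d) : FoldRel G a b c d := by
  obtain ⟨g, ⟨rfl, rfl⟩ | ⟨rfl, rfl⟩⟩ := h
  · exact FoldRel.smul g FoldRel.base
  · exact (FoldRel.smul g FoldRel.base).symm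

/-- If the fold identifies two elements, then they, or their complements, are connected by a path of
translates of the folded pair. -/
theorem FoldRel.reflTransGen [IsAction G P] {a b c d : P}
    (hpos : ∀ e, FoldPos G a b e → ¬ FoldPos G a b eᶜ) (h : FoldRel G a b c d) :
    Relation.ReflTransGen (FoldEdge G a b) c d ∨ Relation.ReflTransGen (FoldEdge G a b) cᶜ dᶜ := by
  have hsymm : ∀ {c d}, Relation.ReflTransGen (FoldEdge G a b) c d →
      Relation.ReflTransGen (FoldEdge G a b) d c := by
    intro c d h
    induction h with
    | refl => exact .refl
    | tail _ h ih => exact .head h.symm ih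
  have hsmul : ∀ (g : G) {c d}, Relation.ReflTransGen (FoldEdge G a b) c d →
      Relation.ReflTransGen (FoldEdge G a b) (g • c) (g • d) := by
    intro g c d h
    induction h with
    | refl => exact .refl
    | tail _ h ih => exact ih.tail (h.smul g)
  have hcompl : ∀ {c d : P}, cᶜ = dᶜ → c = d := fun {c d} h => by
    rw [← PrePocset.compl_invol c, h, PrePocset.compl_invol]
  induction h with
  | base => exact Or.inl (.single ⟨1, Or.inl ⟨(one_smul ..).symm, (one_smul ..).symm⟩⟩)
  | refl c => exact Or.inl .refl
  | symm _ ih => exact ih.imp hsymm hsymm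
  | trans _ _ ih ih' =>
    rcases ih with h | h <;> rcases ih' with h' | h'
    · exact Or.inl (h.trans h')
    · rcases eq_or_pos_of_reflTransGen h with rfl | hp
      · exact Or.inr h'
      rcases eq_or_pos_of_reflTransGen h' with he | hp'
      · rw [← hcompl he]
        exact Or.inl h
      · exact absurd hp'.1 (hpos _ hp.2)
    · rcases eq_or_pos_of_reflTransGen h' with rfl | hp
      · exact Or.inr h
      rcases eq_or_pos_of_reflTransGen h with he | hp'
      · rw [hcompl he]
        exact Or.inl h'
      · exact absurd hp'.2 (hpos _ hp.1)
    · exact Or.inr (h.trans h')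
  | compl _ ih =>
    rw [PrePocset.compl_invol, PrePocset.compl_invol]
    exact ih.symm
  | smul g _ ih =>
    rw [← IsAction.smul_compl, ← IsAction.smul_compl]
    exact ih.imp (hsmul g) (hsmul g)

end FoldGraph

section Fold

variable {V G P : Type*} [Group G] {X : CubeComplex V} [MulAction G V] [X.IsAction G]
  [MulAction G P] {f : X.Halfspace → P} {h₁ h₂ : X.Halfspace}

theorem Facing.symm {a b : X.Halfspace} (h : Facing a b) : Facing b a := by
  refine ⟨fun v hv => by_contra fun hb => hv (h.1 hb), fun h' => h.2 ?_⟩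
  rw [← h', Halfspace.compl_compl']

theorem FoldPos.map_eq (hfG : ∀ (g : G) (h : X.Halfspace), f (g • h) = g • f h)
    (hfold : f h₁ = f h₂) {a : X.Halfspace} (ha : FoldPos G h₁ h₂ a) : ∃ g : G, f a = g • f h₁ := by
  obtain ⟨g, rfl | rfl⟩ := ha
  · exact ⟨g, hfG g h₁⟩
  · exact ⟨g, by rw [hfG, hfold]⟩

theorem FoldEdge.isElementaryFoldable
    (hfG : ∀ (g : G) (h : X.Halfspace), f (g • h) = g • f h)
    (hfold : IsElementaryFoldable f h₁ h₂) {a b : X.Halfspace} (h : FoldEdge G h₁ h₂ a b) :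
    IsElementaryFoldable f a b := by
  have key : ∀ g : G, IsElementaryFoldable f (g • h₁) (g • h₂) := by
    intro g
    refine ⟨?_, by rw [hfG, hfG, hfold.2.1], fun c d hcd hfcd hc hd => ?_⟩
    · have := (smul_lt_iff g).2 hfold.1
      rwa [IsAction.smul_compl] at this
    · obtain ⟨h, h'⟩ := hfold.2.2 (g⁻¹ • c) (g⁻¹ • d)
        (by
          have := (smul_lt_iff g⁻¹).2 hcd
          rwa [IsAction.smul_compl] at this)
        (by rw [hfG, hfG, hfcd])
        (by simpa using (smul_le_iff g⁻¹).2 hc) (by simpa using (smul_le_iff g⁻¹).2 hd)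
      rw [← h, ← h', smul_inv_smul, smul_inv_smul]
      exact ⟨rfl, rfl⟩
  obtain ⟨g, ⟨rfl, rfl⟩ | ⟨rfl, rfl⟩⟩ := h
  · exact key g
  · obtain ⟨h, h', h''⟩ := key g
    exact ⟨h.symm, h'.symm, fun c d hcd hf hc hd =>
      (h'' d c hcd.symm hf.symm hd hc).symm⟩

variable [PrePocset P]

/-- The ends of a path of translates of the folded pair coincide or face each other. They are not
transverse, having the same image. If `s 0 ≤ s k`, then `s 0` and `s (k - 1)` form a foldable pair
below the translate of the folded pair at the end of the path, so `s 0 = s k`; similarly if `s k ≤ s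
0`. They are not disjoint, since both contain the complement of `s (k - 1)`. -/
theorem eq_or_facing_of_path (hX : X.IsCAT0) (hP : IsPocset P) (hf : IsAdmissible f)
    (hfG : ∀ (g : G) (h : X.Halfspace), f (g • h) = g • f h)
    (hfold : IsElementaryFoldable f h₁ h₂) (k : ℕ) (s : ℕ → X.Halfspace)
    (hs : ∀ i < k, FoldEdge G h₁ h₂ (s i) (s (i + 1))) :
    f (s 0) = f (s k) ∧ (s 0 = s k ∨ Facing (s 0) (s k)) := by
  induction k generalizing s with
  | zero => exact ⟨rfl, Or.inl rfl⟩
  | succ k ih =>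
    obtain ⟨f1, i1⟩ := ih s fun i hi => hs i (by omega)
    obtain ⟨-, i2⟩ := ih (fun i => s (i + 1)) fun i hi => hs (i + 1) (by omega)
    have e1 := hs 0 (by omega)
    have e2 := hs k (by omega)
    have m1 := e1.isElementaryFoldable hfG hfold
    have m2 := e2.isElementaryFoldable hfG hfold
    have f2 : f (s 0) = f (s (k + 1)) := f1.trans m2.2.1
    refine ⟨f2, ?_⟩
    rcases i1 with i1 | i1
    · exact Or.inr (i1 ▸ m2.1)
    rcases i2 with i2 | i2
    · exact Or.inr (i2 ▸ m1.1)
    have hnt : ¬ Transverse (s 0) (s (k + 1)) := fun h =>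
      (hf.map_transverse _ _ h).1 (f2 ▸ hP.le_refl _)
    have h1 : s 0 ≤ s (k + 1) → s 0 = s (k + 1) := fun h =>
      ((e2.symm.isElementaryFoldable hfG hfold).2.2 (s 0) (s k) i1 f1 h fun _ h => h).1
    have h2 : s (k + 1) ≤ s 0 → s (k + 1) = s 0 := fun h =>
      (m1.2.2 (s (k + 1)) (s 1) i2.symm (f2.symm.trans m1.2.1) h fun _ h => h).1
    have h3 : ¬ s 0 ≤ (s (k + 1))ᶜ := by
      intro h
      obtain ⟨v, hv⟩ := (s k)ᶜ.nonempty hX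
      exact h (i1.1 hv) (m2.1.symm.1 hv)
    by_contra hcon
    push Not at hcon
    refine hnt ⟨fun h => hcon.1 (h1 h), h3, fun h => hcon.2 ⟨fun v hv => ?_, fun h' => ?_⟩,
      fun h => hcon.1 (h2 fun v hv => by_contra fun h' => h h' hv).symm⟩
    · exact by_contra fun h' => hv (h h')
    · rw [← h', hf.map_compl] at f2
      exact hP.not_compl_le (f (s (k + 1))) (by rw [f2]; exact hP.le_refl _)

theorem exists_path_of_reflTransGen {α : Type*} {E : α → α → Prop} {a b : α}
    (h : Relation.ReflTransGen E a b) :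
    ∃ (k : ℕ) (s : ℕ → α), s 0 = a ∧ s k = b ∧ ∀ i < k, E (s i) (s (i + 1)) := by
  induction h using Relation.ReflTransGen.head_induction_on with
  | refl => exact ⟨0, fun _ => b, rfl, rfl, fun i hi => absurd hi (Nat.not_lt_zero i)⟩
  | @head a c h _ ih =>
    obtain ⟨k, s, h0, hk, hs⟩ := ih
    refine ⟨k + 1, fun i => Nat.casesOn i a s, rfl, hk, fun i hi => ?_⟩
    cases i with
    | zero =>
      change E a (s 0)
      rwa [h0]
    | succ i => exact hs i (by omega)

variable [IsAction G P]

theorem FoldPos.not_compl (hPinv : WithoutInversions G P) (hf : IsAdmissible f)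
    (hfG : ∀ (g : G) (h : X.Halfspace), f (g • h) = g • f h)
    (hfold : f h₁ = f h₂) {a : X.Halfspace} (ha : FoldPos G h₁ h₂ a) : ¬ FoldPos G h₁ h₂ aᶜ := by
  intro hac
  obtain ⟨g, hg⟩ := ha.map_eq hfG hfold
  obtain ⟨g', hg'⟩ := hac.map_eq hfG hfold
  rw [hf.map_compl, hg, ← IsAction.smul_compl] at hg'
  refine hPinv (g⁻¹ * g') (f h₁) ?_
  rw [mul_smul, ← hg', inv_smul_smul]

theorem reflTransGen_of_pos (hPinv : WithoutInversions G P) (hf : IsAdmissible f)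
    (hfG : ∀ (g : G) (h : X.Halfspace), f (g • h) = g • f h) (hfold : f h₁ = f h₂)
    {a b : X.Halfspace} (ha : FoldPos G h₁ h₂ a) (hab : FoldRel G h₁ h₂ a b) :
    Relation.ReflTransGen (FoldEdge G h₁ h₂) a b := by
  rcases hab.reflTransGen fun e he => he.not_compl hPinv hf hfG hfold with h | h
  · exact h
  rcases eq_or_pos_of_reflTransGen h with he | hp
  · rw [← Halfspace.compl_compl' b, ← he, Halfspace.compl_compl']
  · exact absurd hp.1 (ha.not_compl hPinv hf hfG hfold)

theorem isFacingCongr_fold (hX : X.IsCAT0) (hP : IsPocset P) (hPinv : WithoutInversions G P)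
    (hf : IsAdmissible f) (hfG : ∀ (g : G) (h : X.Halfspace), f (g • h) = g • f h)
    (hfold : IsElementaryFoldable f h₁ h₂) :
    IsFacingCongr (foldCongr G h₁ h₂) (FoldPos G h₁ h₂) where
  pos_of_rel hab ha := by
    rcases eq_or_pos_of_reflTransGen (reflTransGen_of_pos hPinv hf hfG hfold.2.1 ha hab) with h | h
    · exact h ▸ ha
    · exact h.2
  not_pos_compl ha := ha.not_compl hPinv hf hfG hfold.2.1
  facing hab ha hne := by
    obtain ⟨k, s, rfl, rfl, hs⟩ :=
      exists_path_of_reflTransGen (reflTransGen_of_pos hPinv hf hfG hfold.2.1 ha hab)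
    exact (eq_or_facing_of_path hX hP hf hfG hfold k s hs).2.resolve_left hne
  eq_of_rel {a b} hab ha hac := by
    rcases FoldRel.reflTransGen (fun e he => he.not_compl hPinv hf hfG hfold.2.1) hab with h | h
    · exact (eq_or_pos_of_reflTransGen h).resolve_right fun h => ha h.1
    · have := (eq_or_pos_of_reflTransGen h).resolve_right fun h => hac h.1
      rw [← Halfspace.compl_compl' a, this, Halfspace.compl_compl']

theorem FoldEdge.ncard_between {a b : X.Halfspace} (h : FoldEdge G h₁ h₂ a b) :
    {c : X.Halfspace | aᶜ ≤ c ∧ c ≤ b}.ncard ≤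
      {c : X.Halfspace | h₁ᶜ ≤ c ∧ c ≤ h₂}.ncard + {c : X.Halfspace | h₂ᶜ ≤ c ∧ c ≤ h₁}.ncard := by
  have key : ∀ (g : G) (k l : X.Halfspace), {c : X.Halfspace | (g • k)ᶜ ≤ c ∧ c ≤ g • l}.ncard =
      {c : X.Halfspace | kᶜ ≤ c ∧ c ≤ l}.ncard := by
    intro g k l
    rw [← Set.ncard_image_of_injective {c : X.Halfspace | kᶜ ≤ c ∧ c ≤ l} (MulAction.injective g)]
    congr 1
    ext c
    constructor
    · rintro ⟨h, h'⟩
      rw [← IsAction.smul_compl] at h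
      refine ⟨g⁻¹ • c, ⟨?_, ?_⟩, smul_inv_smul g c⟩
      · simpa using (smul_le_iff g⁻¹).2 h
      · simpa using (smul_le_iff g⁻¹).2 h'
    · rintro ⟨c, ⟨h, h'⟩, rfl⟩
      change (g • k)ᶜ ≤ g • c ∧ g • c ≤ g • l
      refine ⟨?_, (smul_le_iff g).2 h'⟩
      rw [← IsAction.smul_compl]
      exact (smul_le_iff g).2 h
  obtain ⟨g, ⟨rfl, rfl⟩ | ⟨rfl, rfl⟩⟩ := h <;> rw [key] <;> omega

theorem smul_mem_region (g : G) {v : V} {x : Fold G h₁ h₂}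
    (hv : v ∈ region (foldCongr G h₁ h₂) (FoldPos G h₁ h₂) x) :
    g • v ∈ region (foldCongr G h₁ h₂) (FoldPos G h₁ h₂) (g • x) := by
  rcases hv with hv | ⟨a, rfl, ha, hv⟩
  · refine Or.inl fun a ha => ?_
    have h1 := hv (g⁻¹ • a) (by rw [foldCongr_proj_smul, ha, inv_smul_smul])
    have h2 : g • v ∈ (g • g⁻¹ • a).1 := Set.mem_image_of_mem _ h1
    rwa [smul_inv_smul] at h2
  · refine Or.inr ⟨g • a, foldCongr_proj_smul G h₁ h₂ g a, ?_, Set.mem_image_of_mem _ hv⟩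
    rw [← IsAction.smul_compl]
    exact ha.smul g

theorem toDual_smul (hX : X.IsCAT0)
    (hr : IsFacingCongr (foldCongr G h₁ h₂) (FoldPos G h₁ h₂)) (g : G) (v : V) :
    toDual hX hr (g • v) = g • toDual hX hr v := by
  refine DualVertex.ext' fun x => ?_
  rw [mem_smul_dualVertex, mem_toDual, mem_toDual]
  constructor
  · intro h
    simpa using smul_mem_region g⁻¹ h
  · intro h
    simpa using smul_mem_region g h

end Fold

end Pocset

theorem mainTheorem6 {V G P : Type*} [Group G]
    (X : CubeComplex V) (hX : X.IsCAT0) [MulAction G V] [X.IsAction G]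
    (hcob : X.IsCobounded G) (hinv : Pocset.WithoutInversions G X.Halfspace)
    [PrePocset P] (hP : IsPocset P) (hPfin : Pocset.IsLocallyFinite P)
    [MulAction G P] [Pocset.IsAction G P] (hPinv : Pocset.WithoutInversions G P)
    (f : X.Halfspace → P) (hf : Pocset.IsResolution f)
    (hfG : ∀ (g : G) (h : X.Halfspace), f (g • h) = g • f h)
    (h₁ h₂ : X.Halfspace) (hfold : Pocset.IsElementaryFoldable f h₁ h₂)
    (hfd : (Pocset.dualComplex (Pocset.Fold G h₁ h₂)).IsFiniteDimensional) :
    (Pocset.dualComplex (Pocset.Fold G h₁ h₂)).IsCobounded G := by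
  obtain ⟨hf, -⟩ := hf
  have hr := Pocset.isFacingCongr_fold (G := G) hX hP hPinv hf hfG hfold
  obtain ⟨d, hd⟩ := hfd
  obtain ⟨x₀, R, hR⟩ := hcob
  obtain ⟨N, hN⟩ : ∃ N : ℕ, ∀ a b : X.Halfspace, Pocset.FoldEdge G h₁ h₂ a b →
      {c : X.Halfspace | aᶜ ≤ c ∧ c ≤ b}.ncard ≤ N :=
    ⟨_, fun _ _ h => h.ncard_between⟩
  refine ⟨Pocset.toDual hX hr x₀, N * d + R, fun U => ?_⟩
  obtain ⟨v, hv⟩ := Pocset.exists_edist_toDual_le hX hr (fun _ _ h => Pocset.FoldEdge.foldRel h)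
    (fun _ _ ha h => Pocset.reflTransGen_of_pos hPinv hf hfG hfold.2.1 ha h) hN hd U
  obtain ⟨g, hg⟩ := hR v
  refine ⟨g, ?_⟩
  rw [← Pocset.toDual_smul]
  refine SimpleGraph.edist_triangle.trans ((add_le_add hv
    ((Pocset.edist_toDual_le hX hr _ _).trans hg)).trans ?_)
  rw [Nat.cast_add]
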